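/- **Setup.** Let $d\ge 2$, $1\le i\le d-1$. A $d$-polytope is the convex hull of a finite set in $\mathbb R^d$ that affinely spans $\mathbb R^d$; its faces are $\emptyset$, the polytope itself, and its intersections with supporting hyperplanes ($\dim\emptyset=-1$); $\mathcal L(P)$ is the set of faces of $P$ ordered by inclusion. $P$ is $j$-simplicial if all its $j$-faces are simplices, and $i$-simple if every $(d-i-1)$-face lies in exactly $i+1$ facets. A vertex is simple if it lies in exactly $d$ facets. Write $[d]=\{1,\dots,d\}$ and $[u_k:k\in S]=\mathrm{conv}\{u_k:k\in S\}$. Let $P_1,P_2\subset\mathbb R^d$ be $(d-i)$-simplicial $i$-simple $d$-polytopes such that $P_1$ has a simplex facet $F=[u_1,\dots,u_d]$ and $P_2$ has a simple vertex $v$ whose neighbors, in some order, are $u_1',\dots,u_d'$. Let $H_k$ be the facet of $P_1$ with $H_k\cap F=[u_j:j\ne k]$, and let $H_k'$ be the facet of $P_2$ that contains the edges $[v,u_j']$ for $j\neq k$ but not $[v,u_k']$. An empty intersection of the $H_k$ (of the $H'_k$) means $P_1$ (respectively $P_2$). Put $P_2'=\mathrm{conv}(V(P_2)\setminus\{v\})$,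 where $V(P_2)$ is the vertex set of $P_2$. **The merge.** A projective transformation $\varphi$ of $\mathbb R^d$ defined on all of $P_1$ and an affine automorphism $\psi$ of $\mathbb R^d$ are *in merging position* if the hyperplanes $\mathrm{aff}\,\varphi(F),\mathrm{aff}\,\varphi(H_1),\dots,\mathrm{aff}\,\varphi(H_d)$ bound a $d$-simplex $\Sigma\supseteq\varphi(P_1)$ and, if $a$ is the vertex of $\Sigma$ not in $\varphi(F)$, then $\psi(v)=a$ and $\psi(u_k')=\varphi(u_k)$ for all $k$. The merge is then $P_1\rhd P_2:=\varphi(P_1)\cup\psi(P_2')$. **The quotient poset.** Let $$\mathcal L(P_1)^-=\mathcal L(P_1)\setminus\{\sigma:\sigma\subseteq F,\ \dim\sigma\ge d-i\},\qquad \mathcal L(P_2)^-=\mathcal L(P_2)\setminus\{\sigma:v\in\sigma,\ \dim\sigma<d-i\}.$$ Let $\mathcal L=(\mathcal L(P_1)^-\sqcup\mathcal L(P_2)^-)/\!\sim$, where $\sim$ is the equivalence relation on the disjoint sum generated by $$[u_k:k\in S]\sim[u_k':k\in S]\quad (S\subseteq[d],\ |S|\le d-i),\qquad \bigcap_{k\in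 S}H_k\sim\bigcap_{k\in S}H_k'\quad(S\subseteq[d],\ |S|\le i),$$ and where one class is below another if some representative of the first is below some representative of the second in $\mathcal L(P_1)^-\sqcup\mathcal L(P_2)^-$. **Theorem.** There are $\varphi,\psi$ in merging position. For all $\varphi,\psi$ in merging position, $P_1\rhd P_2$ is a $d$-polytope and $\mathcal L$ is its face lattice. Precisely, there is an order isomorphism $\mathcal L\to\mathcal L(P_1\rhd P_2)$ that sends - the class of $\bigcap_{k\in S}H_k$, for $S\subseteq[d]$ with $|S|\le i$, to $\varphi\big(\bigcap_{k\in S}H_k\big)\cup\psi\big(P_2'\cap\bigcap_{k\in S}H_k'\big)$; - the class of any other $\sigma\in\mathcal L(P_1)^-$ to $\varphi(\sigma)$; - the class of any $\tau\in\mathcal L(P_2)^-$ with $v\notin\tau$ to $\psi(\tau)$. -/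

import Mathlib

namespace PolytopeMerge

/-- The ambient Euclidean space `ℝ^d`. -/
abbrev E (d : ℕ) : Type := EuclideanSpace ℝ (Fin d)

/-- `P` is a `d`-polytope in `ℝ^d`: the convex hull of finitely many points, full-dimensional. -/
def IsPolytope {d : ℕ} (P : Set (E d)) : Prop :=
  (∃ s : Finset (E d), P = convexHull ℝ (s : Set (E d))) ∧ affineSpan ℝ P = ⊤

/-- Faces of `P`: the empty set, `P` itself (take the functional `0`), and the intersections of `P`
with supporting hyperplanes. -/
def IsFace {d : ℕ} (P B : Set (E d)) : Prop := IsExposed ℝ P B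

open Classical in
/-- The dimension of (the affine span of) a set, with `dim ∅ = -1`. -/
noncomputable def dim {d : ℕ} (B : Set (E d)) : ℤ :=
  if B = ∅ then -1 else (Module.finrank ℝ (vectorSpan ℝ B) : ℤ)

/-- Facets of a `d`-polytope in `ℝ^d`: the faces of dimension `d - 1`. -/
def IsFacet {d : ℕ} (P B : Set (E d)) : Prop := IsFace P B ∧ dim B = (d : ℤ) - 1

/-- The vertices (`0`-dimensional faces) of `P`. -/
def vertices {d : ℕ} (P : Set (E d)) : Set (E d) := {x | IsFace P {x}}

/-- `B` is a `j`-simplex. -/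
def IsSimplex {d : ℕ} (j : ℕ) (B : Set (E d)) : Prop :=
  ∃ p : Fin (j + 1) → E d, AffineIndependent ℝ p ∧ B = convexHull ℝ (Set.range p)

/-- `P` is `j`-simplicial: all its `j`-faces are simplices. -/
def IsSimplicial {d : ℕ} (j : ℕ) (P : Set (E d)) : Prop :=
  ∀ B, IsFace P B → dim B = j → IsSimplex j B

/-- `P` is `i`-simple: every `(d-i-1)`-face lies in exactly `i + 1` facets. -/
def IsSimple {d : ℕ} (i : ℕ) (P : Set (E d)) : Prop :=
  ∀ B, IsFace P B → dim B = (d : ℤ) - i - 1 → {G | IsFacet P G ∧ B ⊆ G}.ncard = i + 1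

/-- The convex hull `[u_k : k ∈ S]`. -/
def hullOf {d : ℕ} (u : Fin d → E d) (S : Finset (Fin d)) : Set (E d) :=
  convexHull ℝ (u '' (S : Set (Fin d)))

/-- `F = [u_1, …, u_d]`. -/
def facetOf {d : ℕ} (u : Fin d → E d) : Set (E d) := hullOf u Finset.univ

/-- `[u_1, …, u_d]` is a simplex facet of `P` with (ordered) vertices `u_1, …, u_d`. -/
def IsSimplexFacet {d : ℕ} (P : Set (E d)) (u : Fin d → E d) : Prop :=
  AffineIndependent ℝ u ∧ IsFacet P (facetOf u)

/-- `v` is a simple vertex of `P`: a vertex lying in exactly `d` facets. -/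
def IsSimpleVertex {d : ℕ} (P : Set (E d)) (v : E d) : Prop :=
  v ∈ vertices P ∧ {G | IsFacet P G ∧ v ∈ G}.ncard = d

/-- `w_1, …, w_d` is a list, without repetition, of all neighbors of `v` in `P`: the vertices
`w ≠ v` such that `[v, w]` is an edge of `P`. -/
def IsNeighborList {d : ℕ} (P : Set (E d)) (v : E d) (w : Fin d → E d) : Prop :=
  Function.Injective w ∧
    Set.range w = {x | x ∈ vertices P ∧ x ≠ v ∧ IsFace P (segment ℝ v x)}

/-- The facet `H_k` of `P` that is adjacent to the simplex facet `F = [u_1, …, u_d]` along the ridge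
`[u_j : j ≠ k]`. There is exactly one such facet, so it equals the union of all of them. -/
def adjFacet {d : ℕ} (P : Set (E d)) (u : Fin d → E d) (k : Fin d) : Set (E d) :=
  ⋃₀ {H | IsFacet P H ∧ H ∩ facetOf u = hullOf u {k}ᶜ}

/-- The facet `H'_k` of `P` that contains all the edges `[v, w_j]` except for `[v, w_k]`. There is
exactly one such facet when `v` is simple, so it equals the union of all of them. -/
def vertexFacet {d : ℕ} (P : Set (E d)) (v : E d) (w : Fin d → E d) (k : Fin d) : Set (E d) :=
  ⋃₀ {H | IsFacet P H ∧ ∀ j, segment ℝ v (w j) ⊆ H ↔ j ≠ k}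

/-- `⋂_{k ∈ S} H_k`, a subset of `P` (equal to `P` for `S = ∅`). -/
def adjInter {d : ℕ} (P : Set (E d)) (u : Fin d → E d) (S : Finset (Fin d)) : Set (E d) :=
  P ∩ ⋂ k ∈ S, adjFacet P u k

/-- `⋂_{k ∈ S} H'_k`, a subset of `P` (equal to `P` for `S = ∅`). -/
def vertexInter {d : ℕ} (P : Set (E d)) (v : E d) (w : Fin d → E d) (S : Finset (Fin d)) :
    Set (E d) :=
  P ∩ ⋂ k ∈ S, vertexFacet P v w k

/-! ### The merge -/

/-- The projective transformation `x ↦ (A x + b) / (c x + δ)` of `ℝ^d` given by the invertible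
linear map `T (x, t) = (A x + t b, c x + t δ)` of `ℝ^d × ℝ`. -/
noncomputable def projMap {d : ℕ} (T : (E d × ℝ) ≃ₗ[ℝ] (E d × ℝ)) (x : E d) : E d :=
  (T (x, 1)).2⁻¹ • (T (x, 1)).1

/-- The projective transformation `φ` given by `T` and the affine transformation `ψ` bring `P₁` and
`P₂` into position for merging along the facet `[u_1, …, u_d]` of `P₁` and the vertex `v` of `P₂`
with neighbors `w_1, …, w_d`:
* `φ` is defined on all of `P₁`;
* the affine hulls of the facets `φ(F), φ(H_1), …, φ(H_d)` of `φ(P₁)` bound a simplex `Σ` with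
  vertices `φ(u_1), …, φ(u_d)` and `a`, where `a` is common to the affine hulls of the `φ(H_k)` and
  not on that of `φ(F)`, and `φ(P₁) ⊆ Σ`;
* `ψ` sends `v` to `a` and each `w_k` to `φ(u_k)`. -/
def MergePosition {d : ℕ} (P₁ : Set (E d)) (u : Fin d → E d) (v : E d) (w : Fin d → E d)
    (T : (E d × ℝ) ≃ₗ[ℝ] (E d × ℝ)) (ψ : E d ≃ᵃ[ℝ] E d) : Prop :=
  (∀ x ∈ P₁, (T (x, 1)).2 ≠ 0) ∧
  ∃ a : E d,
    (∀ k, a ∈ affineSpan ℝ (projMap T '' adjFacet P₁ u k)) ∧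
    a ∉ affineSpan ℝ (projMap T '' facetOf u) ∧
    projMap T '' P₁ ⊆ convexHull ℝ (insert a (Set.range fun k => projMap T (u k))) ∧
    ψ v = a ∧ ∀ k, ψ (w k) = projMap T (u k)

/-- `P' = conv (V(P) \ {v})`. -/
def removeVertex {d : ℕ} (P : Set (E d)) (v : E d) : Set (E d) :=
  convexHull ℝ (vertices P \ {v})

/-- The merge `P₁ ⊳ P₂`: the union of `φ(P₁)` and `ψ(P₂')`. -/
def merge {d : ℕ} (P₁ P₂ : Set (E d)) (v : E d)
    (T : (E d × ℝ) ≃ₗ[ℝ] (E d × ℝ)) (ψ : E d ≃ᵃ[ℝ] E d) : Set (E d) :=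
  projMap T '' P₁ ∪ ψ '' removeVertex P₂ v

/-! ### The face lattice and the quotient poset -/

/-- The face poset of `P`, ordered by inclusion. -/
abbrev FacePoset {d : ℕ} (P : Set (E d)) : Type := {B : Set (E d) // IsFace P B}

/-- `L(P₁)⁻`: all faces of `P₁` but those faces of `F` of dimension at least `d - i`. -/
abbrev FaceMinus₁ {d : ℕ} (i : ℕ) (P₁ : Set (E d)) (u : Fin d → E d) : Type :=
  {B : Set (E d) // IsFace P₁ B ∧ ¬ (B ⊆ facetOf u ∧ (d : ℤ) - i ≤ dim B)}

/-- `L(P₂)⁻`: all faces of `P₂` but those containing `v` and of dimension less than `d - i`. -/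
abbrev FaceMinus₂ {d : ℕ} (i : ℕ) (P₂ : Set (E d)) (v : E d) : Type :=
  {B : Set (E d) // IsFace P₂ B ∧ ¬ (v ∈ B ∧ dim B < (d : ℤ) - i)}

/-- The identifications: `[u_k : k ∈ S] ∼ [w_k : k ∈ S]` for `|S| ≤ d - i`, and
`⋂_{k ∈ S} H_k ∼ ⋂_{k ∈ S} H'_k` for `|S| ≤ i`. -/
inductive Glue {d : ℕ} (i : ℕ) (P₁ : Set (E d)) (u : Fin d → E d) (P₂ : Set (E d)) (v : E d)
    (w : Fin d → E d) :
    FaceMinus₁ i P₁ u ⊕ FaceMinus₂ i P₂ v → FaceMinus₁ i P₁ u ⊕ FaceMinus₂ i P₂ v → Prop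
  | hull (σ : FaceMinus₁ i P₁ u) (τ : FaceMinus₂ i P₂ v) (S : Finset (Fin d))
      (hS : S.card + i ≤ d) (hσ : σ.1 = hullOf u S) (hτ : τ.1 = hullOf w S) :
      Glue i P₁ u P₂ v w (Sum.inl σ) (Sum.inr τ)
  | inter (σ : FaceMinus₁ i P₁ u) (τ : FaceMinus₂ i P₂ v) (S : Finset (Fin d))
      (hS : S.card ≤ i) (hσ : σ.1 = adjInter P₁ u S) (hτ : τ.1 = vertexInter P₂ v w S) :
      Glue i P₁ u P₂ v w (Sum.inl σ) (Sum.inr τ)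

/-- The underlying set of the quotient `(L(P₁)⁻ ⊔ L(P₂)⁻) / ∼`. -/
def MergePoset {d : ℕ} (i : ℕ) (P₁ : Set (E d)) (u : Fin d → E d) (P₂ : Set (E d)) (v : E d)
    (w : Fin d → E d) : Type :=
  Quotient (Relation.EqvGen.setoid (Glue i P₁ u P₂ v w))

/-- The class of an element of `L(P₁)⁻ ⊔ L(P₂)⁻`. -/
def MergePoset.mk {d : ℕ} {i : ℕ} {P₁ : Set (E d)} {u : Fin d → E d} {P₂ : Set (E d)} {v : E d}
    {w : Fin d → E d} (x : FaceMinus₁ i P₁ u ⊕ FaceMinus₂ i P₂ v) : MergePoset i P₁ u P₂ v w :=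
  Quotient.mk (Relation.EqvGen.setoid (Glue i P₁ u P₂ v w)) x

/-- The inherited order: one class is below another if some representative of the first is below
some representative of the second in the disjoint sum `L(P₁)⁻ ⊔ L(P₂)⁻` (where elements of different
summands are incomparable). -/
instance {d : ℕ} {i : ℕ} {P₁ : Set (E d)} {u : Fin d → E d} {P₂ : Set (E d)} {v : E d}
    {w : Fin d → E d} : LE (MergePoset i P₁ u P₂ v w) where
  le a b := ∃ x y : FaceMinus₁ i P₁ u ⊕ FaceMinus₂ i P₂ v,
    MergePoset.mk x = a ∧ MergePoset.mk y = b ∧ x ≤ y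

end PolytopeMerge

open PolytopeMerge

/-!
Everything takes place in the coordinates of `P₂`: with `φ = ψ⁻¹ ∘ projMap T`, the merge is the
image under `ψ` of `M = φ(P₁) ∪ P₂'`, where `P₂' = removeVertex P₂ v`. As `v` is simple,
`v, w_1, …, w_d` is an affine basis whose coordinates at the `w_k` are, up to scaling, the
functionals of the facets `H'_k` (`exists_vertex_basis`). The coordinate at `v` is nonnegative on
`φ(P₁)`, and `P₂'` is the part of `P₂` on which it is nonpositive (`VertexFrame.removeVertex_eq`),
so the two pieces meet in the simplex `[w_1, …, w_d]`.

A face of `M` is the zero set of an affine functional `n` that is nonnegative on `M`, and it is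
found from the sign of `n v` and the number of zeros of `n` among the `w_k`.

* If `0 < n v`, the zeros of `n` lie in `P₂'` and form a face of `P₂` off `v`
  (`MergeFrame.sep_eq_of_pos`).
* If `n v ≤ 0` and `n` has at least `d - i` zeros `w_k`, `k ∈ T`, then `n v = 0`. Namely, near the
  face `[u_k : k ∈ T]` the `i`-simple polytope `P₁` is cut out by `F` and the `H_k`, so some point
  of `⋂_{k ∉ T} H_k` is not in `F` (`FacetFrame.exists_off_facet`), and there `n` is a positive
  multiple of `n v`. The face is then the union of the parts of `⋂_{k ∉ T} H_k` and
  `⋂_{k ∉ T} H'_k` (`jointFace`).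
* If `n v ≤ 0` and `n` has fewer than `d - i` zeros among the `w_k`, its zeros lie in `φ(P₁)` and
  form the image of a face of `P₁`: the faces of dimension at most `d - i` of `P₂` at `v` are
  simplices spanned by `v` and some `w_k`, so they do not reach beyond `[w_1, …, w_d]`
  (`VertexFrame.coord_nonneg_of_simplicial`, `MergeFrame.sep_eq_of_few`).

The same computations show that all these sets are faces of `M`. The functional of a face of `P₁`
or of `P₂` transfers to `M` because a projective map with positive denominator turns nonnegative
affine functionals into nonnegative affine functionals (`ProjectiveOn`).

The order isomorphism is induced by `mergeFace`. It is onto by the case distinction above. For the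
order, when one face of `M` contains another, both come from the same polytope after passing to
other representatives (`MergePair.exists_common`), and there inclusion of the faces of `M` is
inclusion of the faces they come from.

A merging position exists because the linear forms on `ℝ^d × ℝ` belonging to `F, H_1, …, H_d` are
a basis of the dual space. An automorphism that maps them to the barycentric coordinates of
`v, w_1, …, w_d` serves, with `ψ` the identity (`FacetFrame.exists_linearEquiv`).
-/

open PolytopeMerge

namespace PolytopeMerge

open Set

variable {d : ℕ}

/-! ### Affine functionals and faces -/

theorem affineMap_eq_inner (n : E d →ᵃ[ℝ] ℝ) :
    ∃ (y : E d) (m : ℝ), ∀ x, n x = inner ℝ y x + m := by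
  refine ⟨(InnerProductSpace.toDual ℝ (E d)).symm n.linear.toContinuousLinearMap, n 0, fun x => ?_⟩
  have := n.map_vadd 0 x
  simp only [vadd_eq_add, add_zero] at this
  simp [this]

theorem exists_affineMap_inner (y : E d) (m : ℝ) :
    ∃ n : E d →ᵃ[ℝ] ℝ, ∀ x, n x = inner ℝ y x + m :=
  ⟨((InnerProductSpace.toDual ℝ (E d) y).toLinearMap.toAffineMap + AffineMap.const ℝ (E d) m),
    fun x => by simp⟩

theorem isFace_iff {P B : Set (E d)} : IsFace P B ↔
    ∃ n : E d →ᵃ[ℝ] ℝ, (∀ x ∈ P, 0 ≤ n x) ∧ B = {x ∈ P | n x = 0} := by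
  constructor
  · intro h
    rcases B.eq_empty_or_nonempty with rfl | hB
    · refine ⟨AffineMap.const ℝ _ 1, by simp, ?_⟩
      ext x; simp
    · obtain ⟨l, rfl⟩ := h hB
      obtain ⟨b, hb⟩ := hB
      refine ⟨AffineMap.const ℝ _ (l b) - l.toLinearMap.toAffineMap, ?_, ?_⟩
      · intro x hx
        simpa using hb.2 x hx
      · ext x
        constructor
        · rintro ⟨hx, h⟩
          refine ⟨hx, ?_⟩
          simpa [sub_eq_zero] using le_antisymm (h b hb.1) (hb.2 x hx)
        · rintro ⟨hx, h⟩
          refine ⟨hx, fun y hy => ?_⟩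
          have : l b - l x = 0 := by simpa using h
          have := hb.2 y hy
          linarith
  · rintro ⟨n, hn, rfl⟩ ⟨b, hb⟩
    refine ⟨-n.linear.toContinuousLinearMap, ?_⟩
    have key : ∀ x y, n x - n y = n.linear x - n.linear y := fun x y => by
      have h := n.linearMap_vsub x y
      simp only [vsub_eq_sub, map_sub] at h
      linarith
    ext x
    constructor
    · rintro ⟨hx, h⟩
      refine ⟨hx, fun y hy => ?_⟩
      have h1 := key x y
      have h2 := hn y hy
      simp only [neg_apply, LinearMap.coe_toContinuousLinearMap', neg_le_neg_iff]
      linarith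
    · rintro ⟨hx, h⟩
      refine ⟨hx, le_antisymm ?_ (hn x hx)⟩
      have h1 := key x b
      have h2 := hb.2
      have h3 := h b hb.1
      simp only [neg_apply, LinearMap.coe_toContinuousLinearMap', neg_le_neg_iff]
        at h3
      linarith

theorem IsFace.of_affine {P B : Set (E d)} (n : E d →ᵃ[ℝ] ℝ) (hn : ∀ x ∈ P, 0 ≤ n x)
    (hB : B = {x ∈ P | n x = 0}) : IsFace P B := isFace_iff.2 ⟨n, hn, hB⟩

theorem affineMap_sum {ι : Type*} (S : Finset ι) (n : ι → E d →ᵃ[ℝ] ℝ) :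
    ∃ m : E d →ᵃ[ℝ] ℝ, ∀ x, m x = ∑ k ∈ S, n k x := by
  classical
  induction S using Finset.induction_on with
  | empty => exact ⟨0, by simp⟩
  | insert k S hk ih =>
    obtain ⟨m, hm⟩ := ih
    exact ⟨n k + m, fun x => by simp [Finset.sum_insert hk, hm]⟩

theorem affineMap_combo (n : E d →ᵃ[ℝ] ℝ) (x y : E d) (a b : ℝ) (hab : a + b = 1) :
    n (a • x + b • y) = a * n x + b * n y := by
  obtain ⟨z, m, h⟩ := affineMap_eq_inner n
  simp only [h, inner_add_right, inner_smul_right]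
  linear_combination (-m) * hab

theorem convex_nonneg (n : E d →ᵃ[ℝ] ℝ) : Convex ℝ {x | 0 ≤ n x} := by
  intro x hx y hy a b ha hb hab
  simp only [mem_ofPred_eq] at *
  rw [affineMap_combo n x y a b hab]
  positivity

theorem convex_nonpos (n : E d →ᵃ[ℝ] ℝ) : Convex ℝ {x | n x ≤ 0} := by
  have := convex_nonneg (-n)
  simpa using this

theorem convex_zero (n : E d →ᵃ[ℝ] ℝ) : Convex ℝ {x | n x = 0} := by
  have := (convex_nonneg n).inter (convex_nonpos n)
  convert this using 1
  ext x
  simp only [mem_ofPred_eq, mem_inter_iff]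
  constructor
  · intro h; exact ⟨h.ge, h.le⟩
  · rintro ⟨h1, h2⟩; exact le_antisymm h2 h1

/-- A face of a convex hull is the convex hull of the generators it contains. -/
theorem face_convexHull (s : Set (E d)) (n : E d →ᵃ[ℝ] ℝ) (hn : ∀ x ∈ s, 0 ≤ n x) :
    {x ∈ convexHull ℝ s | n x = 0} = convexHull ℝ {x ∈ s | n x = 0} := by
  apply Subset.antisymm
  · rintro x ⟨hx, hx0⟩
    rw [convexHull_eq] at hx
    obtain ⟨ι, t, w, z, hw, hw1, hz, rfl⟩ := hx
    rw [Finset.centerMass_eq_of_sum_1 _ _ hw1] at hx0 ⊢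
    obtain ⟨y, m, h⟩ := affineMap_eq_inner n
    have hval : n (∑ j ∈ t, w j • z j) = ∑ j ∈ t, w j * n (z j) := by
      simp only [h, inner_sum, inner_smul_right, mul_add, Finset.sum_add_distrib,
        ← Finset.sum_mul, hw1, one_mul]
    rw [hval] at hx0
    have hzero := (Finset.sum_eq_zero_iff_of_nonneg
      (fun j hj => mul_nonneg (hw j hj) (hn _ (hz j hj)))).1 hx0
    classical
    rw [← Finset.sum_filter_of_ne (p := fun j => w j ≠ 0)
      (fun j _ hj hw0 => hj (by simp [hw0]))]
    refine (convex_convexHull ℝ _).sum_mem (fun j hj => hw j (Finset.mem_filter.1 hj).1) ?_ ?_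
    · rw [Finset.sum_filter_ne_zero, hw1]
    · intro j hj
      obtain ⟨hj, hj0⟩ := Finset.mem_filter.1 hj
      refine subset_convexHull ℝ _ ⟨hz j hj, ?_⟩
      rcases mul_eq_zero.1 (hzero j hj) with h0 | h0
      · exact absurd h0 hj0
      · exact h0
  · refine convexHull_min ?_ ((convex_convexHull ℝ s).inter (convex_zero n))
    rintro x ⟨hx, h⟩
    exact ⟨subset_convexHull ℝ s hx, h⟩

theorem nonneg_convexHull {s : Set (E d)} {n : E d →ᵃ[ℝ] ℝ} (hn : ∀ x ∈ s, 0 ≤ n x) :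
    ∀ x ∈ convexHull ℝ s, 0 ≤ n x := fun _ hx =>
  convexHull_min (t := {x | 0 ≤ n x}) hn (convex_nonneg n) hx

theorem IsFace.subset {P B : Set (E d)} (h : IsFace P B) : B ⊆ P := IsExposed.subset h

theorem IsFace.convex {P B : Set (E d)} (h : IsFace P B) (hP : Convex ℝ P) : Convex ℝ B :=
  IsExposed.convex h hP

/-! ### Vertices -/

theorem mem_extremePoints_of_mem_vertices {P : Set (E d)} {x : E d} (hx : x ∈ vertices P) :
    x ∈ P.extremePoints ℝ :=
  exposedPoints_subset_extremePoints (𝕜 := ℝ) (mem_exposedPoints_iff_exposed_singleton.2 hx)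

theorem vertices_subset {P : Set (E d)} : vertices P ⊆ P := fun _ hx =>
  (mem_extremePoints_of_mem_vertices hx).1

theorem vertices_convexHull_subset {s : Set (E d)} : vertices (convexHull ℝ s) ⊆ s := fun _ hx =>
  extremePoints_convexHull_subset (mem_extremePoints_of_mem_vertices hx)

/-- A functional that strictly separates a point from a convex hull. -/
theorem exists_affineMap_separating {s : Set (E d)} (hs : Convex ℝ s) (hc : IsClosed s) {x : E d}
    (hx : x ∉ s) : ∃ n : E d →ᵃ[ℝ] ℝ, (∀ y ∈ s, 0 < n y) ∧ n x < 0 := by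
  obtain ⟨f, r, h1, h2⟩ := geometric_hahn_banach_closed_point hs hc hx
  refine ⟨AffineMap.const ℝ _ r - f.toLinearMap.toAffineMap, fun y hy => ?_, ?_⟩
  · simpa using h1 y hy
  · simpa using h2

theorem isClosed_convexHull_finset (s : Finset (E d)) : IsClosed (convexHull ℝ (s : Set (E d))) :=
  s.finite_toSet.isClosed_convexHull ℝ

/-- A polytope is the convex hull of its vertices. -/
theorem convexHull_vertices {P : Set (E d)} (hP : IsPolytope P) :
    (vertices P).Finite ∧ convexHull ℝ (vertices P) = P := by
  classical
  obtain ⟨⟨s, hs⟩, -⟩ := hP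
  have hfin : (vertices P).Finite := s.finite_toSet.subset (hs ▸ vertices_convexHull_subset)
  refine ⟨hfin, Subset.antisymm (convexHull_min vertices_subset (hs ▸ convex_convexHull ℝ _)) ?_⟩
  -- a generating set of least cardinality consists of vertices
  obtain ⟨t, ht, hmin⟩ : ∃ t : Finset (E d), P = convexHull ℝ (t : Set (E d)) ∧
      ∀ t' : Finset (E d), P = convexHull ℝ (t' : Set (E d)) → t.card ≤ t'.card := by
    have hex : ∃ k, ∃ t : Finset (E d), P = convexHull ℝ (t : Set (E d)) ∧ t.card = k :=
      ⟨_, s, hs, rfl⟩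
    obtain ⟨t, ht, hk⟩ := Nat.find_spec hex
    exact ⟨t, ht, fun t' ht' => hk ▸ Nat.find_min' hex ⟨t', ht', rfl⟩⟩
  suffices h : (t : Set (E d)) ⊆ vertices P by
    conv_lhs => rw [ht]
    exact convexHull_mono h
  intro x hx
  have hx' : x ∈ t := hx
  have hnot : x ∉ convexHull ℝ ((t.erase x : Finset (E d)) : Set (E d)) := by
    intro h
    have h2 : P = convexHull ℝ ((t.erase x : Finset (E d)) : Set (E d)) := by
      rw [ht]
      apply Subset.antisymm
      · refine convexHull_min (fun y hy => ?_) (convex_convexHull ℝ _)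
        by_cases hyx : y = x
        · rwa [hyx]
        · exact subset_convexHull ℝ _ (by simpa [hyx] using hy)
      · exact convexHull_mono (by simp)
    have := hmin _ h2
    rw [Finset.card_erase_of_mem hx'] at this
    have : 0 < t.card := Finset.card_pos.2 ⟨x, hx'⟩
    omega
  obtain ⟨n, h1, h2⟩ := exists_affineMap_separating (convex_convexHull ℝ _)
    (isClosed_convexHull_finset _) hnot
  let g : E d →ᵃ[ℝ] ℝ := n - AffineMap.const ℝ _ (n x)
  have hg : ∀ y, g y = n y - n x := fun y => by simp [g]
  refine IsFace.of_affine g ?_ ?_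
  · rw [ht]
    refine nonneg_convexHull fun y hy => ?_
    by_cases hyx : y = x
    · simp [hg, hyx]
    · have := h1 y (subset_convexHull ℝ _ (by simpa [hyx] using hy))
      rw [hg]
      linarith
  · have hpos : ∀ y ∈ t, y ≠ x → 0 < g y := by
      intro y hy hyx
      have := h1 y (subset_convexHull ℝ _ (by simpa [hyx] using hy))
      rw [hg]
      linarith
    rw [ht, face_convexHull]
    · have : {y ∈ (t : Set (E d)) | g y = 0} = {x} := by
        ext y
        simp only [mem_ofPred_eq, mem_singleton_iff]
        constructor
        · rintro ⟨hy, h0⟩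
          by_contra hyx
          exact (hpos y hy hyx).ne' h0
        · rintro rfl
          exact ⟨hx, by simp [hg]⟩
      rw [this, convexHull_singleton]
    · intro y hy
      by_cases hyx : y = x
      · simp [hg, hyx]
      · exact (hpos y hy hyx).le

theorem IsPolytope.convex {P : Set (E d)} (hP : IsPolytope P) : Convex ℝ P := by
  obtain ⟨⟨s, rfl⟩, -⟩ := hP
  exact convex_convexHull ℝ _

/-! ### Facet inequalities -/

theorem dim_of_nonempty {B : Set (E d)} (hB : B.Nonempty) :
    dim B = (Module.finrank ℝ (vectorSpan ℝ B) : ℤ) := by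
  simp [dim, hB.ne_empty]

/-- The polar of a finite set with respect to the point `p`. -/
def polarSet (s : Finset (E d)) (p : E d) : Set (E d) := {y | ∀ x ∈ s, inner ℝ y (x - p) ≤ 1}

theorem convex_polarSet (s : Finset (E d)) (p : E d) : Convex ℝ (polarSet s p) := by
  intro y hy z hz a b ha hb hab x hx
  rw [inner_add_left, inner_smul_left, inner_smul_left]
  have h1 := hy x hx
  have h2 := hz x hx
  simp only [conj_trivial]
  nlinarith

theorem polarSet_le_one {s : Finset (E d)} {p y : E d} (hy : y ∈ polarSet s p) :
    ∀ x ∈ convexHull ℝ (s : Set (E d)), inner ℝ y (x - p) ≤ 1 := by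
  obtain ⟨n, hn⟩ := exists_affineMap_inner (-y) (1 + inner ℝ y p)
  have hn' : ∀ x, n x = 1 - inner ℝ y (x - p) := fun x => by
    rw [hn, inner_neg_left, inner_sub_right]; ring
  intro x hx
  have := nonneg_convexHull (n := n) (fun x hx => by
    have := hy x hx
    rw [hn']; linarith) x hx
  rw [hn'] at this
  linarith

theorem isCompact_polarSet {s : Finset (E d)} {p : E d}
    (hp : p ∈ interior (convexHull ℝ (s : Set (E d)))) : IsCompact (polarSet s p) := by
  obtain ⟨r, hr, hball⟩ := Metric.isOpen_iff.1 isOpen_interior p hp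
  refine Metric.isCompact_of_isClosed_isBounded ?_ ?_
  · have : polarSet s p = ⋂ x ∈ s, {y | inner ℝ y (x - p) ≤ 1} := by
      ext y; simp [polarSet]
    rw [this]
    exact isClosed_biInter fun x _ => isClosed_le (by fun_prop) continuous_const
  · refine (Metric.isBounded_closedBall (x := (0 : E d)) (r := 2 / r)).subset fun y hy => ?_
    rw [mem_closedBall_zero_iff]
    by_cases h0 : y = 0
    · subst h0; simp; positivity
    have hny : 0 < ‖y‖ := norm_pos_iff.2 h0
    have hmem : p + (r / 2 / ‖y‖) • y ∈ convexHull ℝ (s : Set (E d)) := by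
      refine interior_subset (hball ?_)
      rw [Metric.mem_ball, dist_eq_norm, add_sub_cancel_left, norm_smul, Real.norm_eq_abs,
        abs_of_pos (by positivity), div_mul_cancel₀ _ hny.ne']
      linarith
    have := polarSet_le_one hy _ hmem
    rw [add_sub_cancel_left, inner_smul_right, real_inner_self_eq_norm_sq] at this
    have h2 : r / 2 / ‖y‖ * ‖y‖ ^ 2 = r / 2 * ‖y‖ := by field_simp
    rw [h2] at this
    rw [le_div_iff₀ hr]
    linarith

/-- At an extreme point `y` of the polar, only `0` is orthogonal to all active generators. -/
theorem eq_zero_of_extreme_polarSet {s : Finset (E d)} {p y z : E d}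
    (hy : y ∈ (polarSet s p).extremePoints ℝ)
    (hz : ∀ x ∈ s, inner ℝ y (x - p) = 1 → inner ℝ z (x - p) = 0) : z = 0 := by
  -- the inactive inequalities leave room for moving by `± ε z`
  obtain ⟨ε, hε, hmove⟩ : ∃ ε : ℝ, 0 < ε ∧
      ∀ x ∈ s, inner ℝ y (x - p) + ε * |inner ℝ z (x - p)| ≤ 1 := by
    have hev : ∀ᶠ ε in nhdsWithin (0 : ℝ) (Ioi 0),
        ∀ x ∈ s, inner ℝ y (x - p) + ε * |inner ℝ z (x - p)| ≤ 1 := by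
      rw [Filter.eventually_all_finset]
      intro x hx
      rcases (hy.1 x hx).eq_or_lt with h | h
      · simp [hz x hx h, h]
      · apply Filter.Eventually.filter_mono nhdsWithin_le_nhds
        have hc : ContinuousAt (fun ε : ℝ => inner ℝ y (x - p) + ε * |inner ℝ z (x - p)|) 0 := by
          fun_prop
        have := hc.eventually_lt_const (u := 1) (by simpa using h)
        exact this.mono fun _ h => le_of_lt h
    obtain ⟨ε, h1, h2⟩ := (hev.and self_mem_nhdsWithin).exists
    exact ⟨ε, h2, h1⟩
  have h1 : y + ε • z ∈ polarSet s p := fun x hx => by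
    have := hmove x hx
    rw [inner_add_left, inner_smul_left]
    simp only [conj_trivial]
    nlinarith [le_abs_self (inner ℝ z (x - p))]
  have h2 : y - ε • z ∈ polarSet s p := fun x hx => by
    have := hmove x hx
    rw [inner_sub_left, inner_smul_left]
    simp only [conj_trivial]
    nlinarith [neg_abs_le (inner ℝ z (x - p))]
  have h3 : y + ε • z = y := by
    refine (mem_extremePoints.1 hy).2 _ h1 _ h2 ?_ |>.1
    exact ⟨1 / 2, 1 / 2, by norm_num, by norm_num, by norm_num, by module⟩
  have : ε • z = 0 := by simpa using h3
  exact (smul_eq_zero.1 this).resolve_left hε.ne'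

theorem finite_extremePoints_polarSet (s : Finset (E d)) (p : E d) :
    ((polarSet s p).extremePoints ℝ).Finite := by
  classical
  refine Set.Finite.of_finite_image (f := fun y => s.filter fun x => inner ℝ y (x - p) = 1)
    ((s.powerset.finite_toSet).subset ?_) ?_
  · rintro _ ⟨y, -, rfl⟩
    simp only [Finset.coe_powerset, mem_preimage, mem_powerset_iff, Finset.coe_subset]
    exact Finset.filter_subset _ _
  · intro y hy y' hy' h
    have : y - y' = 0 := by
      refine eq_zero_of_extreme_polarSet hy fun x hx hx1 => ?_
      have hmem : x ∈ s.filter fun x => inner ℝ y' (x - p) = 1 := by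
        simp only at h
        rw [← h]; simp [hx, hx1]
      rw [inner_sub_left, hx1, (Finset.mem_filter.1 hmem).2, sub_self]
    exact sub_eq_zero.1 this

theorem finrank_vectorSpan_le_of_zero {B : Set (E d)} {y : E d} (hy : y ≠ 0) {c : ℝ}
    (h : ∀ x ∈ B, inner ℝ y x = c) : Module.finrank ℝ (vectorSpan ℝ B) + 1 ≤ d := by
  have h1 : vectorSpan ℝ B ≤ (ℝ ∙ y)ᗮ := by
    rw [vectorSpan, Submodule.span_le]
    rintro _ ⟨a, ha, b, hb, rfl⟩
    rw [SetLike.mem_coe, Submodule.mem_orthogonal_singleton_iff_inner_right]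
    simp [inner_sub_right, h a ha, h b hb]
  have h2 := Submodule.finrank_mono h1
  have h3 := Submodule.finrank_add_finrank_orthogonal (ℝ ∙ y)
  rw [finrank_span_singleton hy, finrank_euclideanSpace_fin] at h3
  omega

/-- A full-dimensional polytope is cut out by finitely many facet inequalities. They are the
extreme points of its polar. -/
theorem exists_facet_functionals (hd : 1 ≤ d) {P : Set (E d)} (hP : IsPolytope P) :
    ∃ N : Set (E d →ᵃ[ℝ] ℝ), N.Finite ∧
      (∀ n ∈ N, (∀ x ∈ P, 0 ≤ n x) ∧ IsFacet P {x ∈ P | n x = 0}) ∧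
      ∀ x, (∀ n ∈ N, 0 ≤ n x) → x ∈ P := by
  obtain ⟨⟨s, rfl⟩, hspan⟩ := hP
  obtain ⟨p, hp⟩ : (interior (convexHull ℝ (s : Set (E d)))).Nonempty := by
    rw [interior_convexHull_nonempty_iff_affineSpan_eq_top]
    rwa [affineSpan_convexHull] at hspan
  have hex : ∀ y : E d, ∃ n : E d →ᵃ[ℝ] ℝ, ∀ x, n x = 1 - inner ℝ y (x - p) := fun y => by
    obtain ⟨n, hn⟩ := exists_affineMap_inner (-y) (1 + inner ℝ y p)
    exact ⟨n, fun x => by rw [hn, inner_neg_left, inner_sub_right]; ring⟩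
  choose n hn using hex
  have hK := isCompact_polarSet hp
  refine ⟨n '' (polarSet s p).extremePoints ℝ, (finite_extremePoints_polarSet s p).image n, ?_, ?_⟩
  · rintro _ ⟨y, hy, rfl⟩
    have hnn : ∀ x ∈ convexHull ℝ (s : Set (E d)), 0 ≤ n y x := fun x hx => by
      rw [hn]
      have := polarSet_le_one hy.1 x hx
      linarith
    refine ⟨hnn, IsFace.of_affine _ hnn rfl, ?_⟩
    have hB : {x ∈ convexHull ℝ (s : Set (E d)) | n y x = 0} =
        convexHull ℝ {x ∈ (s : Set (E d)) | n y x = 0} :=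
      face_convexHull _ _ fun x hx => hnn x (subset_convexHull ℝ _ hx)
    have hact : ∀ x, n y x = 0 ↔ inner ℝ y (x - p) = 1 := fun x => by
      rw [hn, sub_eq_zero, eq_comm]
    set A := {x ∈ (s : Set (E d)) | n y x = 0} with hA
    have hAne : A.Nonempty := by
      by_contra hempty
      have hz : ∀ z : E d, z = 0 := fun z => by
        refine eq_zero_of_extreme_polarSet hy fun x hx hx1 => ?_
        exact absurd ⟨x, hx, (hact x).2 hx1⟩ hempty
      have : Subsingleton (E d) := ⟨fun a b => by rw [hz a, hz b]⟩
      have h0 := Module.finrank_zero_of_subsingleton (R := ℝ) (M := E d)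
      rw [finrank_euclideanSpace_fin] at h0
      omega
    obtain ⟨a, ha⟩ := hAne
    have hy0 : y ≠ 0 := by
      rintro rfl
      have := (hact a).1 ha.2
      simp at this
    rw [hB, dim_of_nonempty (convexHull_nonempty_iff.2 ⟨a, ha⟩), ← direction_affineSpan,
      affineSpan_convexHull, direction_affineSpan]
    have hle := finrank_vectorSpan_le_of_zero (B := A) hy0 (c := 1 + inner ℝ y p) fun x hx => by
      have := (hact x).1 hx.2
      rw [inner_sub_right] at this
      linarith
    have htop : vectorSpan ℝ A ⊔ (ℝ ∙ (a - p)) = ⊤ := by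
      rw [← Submodule.orthogonal_eq_bot_iff, eq_bot_iff]
      intro z hz
      rw [Submodule.mem_bot]
      refine eq_zero_of_extreme_polarSet hy fun x hx hx1 => ?_
      have h1 : x - p ∈ vectorSpan ℝ A ⊔ (ℝ ∙ (a - p)) := by
        have : x - p = (x - a) + (a - p) := by abel
        rw [this]
        refine Submodule.add_mem_sup ?_ (Submodule.mem_span_singleton_self _)
        exact vsub_mem_vectorSpan ℝ ⟨hx, (hact x).2 hx1⟩ ha
      exact (Submodule.mem_orthogonal' _ _).1 hz _ h1
    have h1 := Submodule.finrank_add_le_finrank_add_finrank (vectorSpan ℝ A) (ℝ ∙ (a - p))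
    have h2 : Module.finrank ℝ (ℝ ∙ (a - p)) = 1 := finrank_span_singleton fun h => by
      have := (hact a).1 ha.2
      simp [h] at this
    rw [htop, finrank_top, finrank_euclideanSpace_fin] at h1
    omega
  · intro x hx
    by_contra hxP
    obtain ⟨g, hg1, hg2⟩ := exists_affineMap_separating (convex_convexHull ℝ _)
      (isClosed_convexHull_finset s) hxP
    obtain ⟨z, m, hz⟩ := affineMap_eq_inner g
    have hgp := hg1 p (interior_subset hp)
    -- the separating functional, normalized to the value `1` at `p`
    have hy : -(g p)⁻¹ • z ∈ polarSet s p := fun q hq => by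
      have h1 := hg1 q (subset_convexHull ℝ _ hq)
      rw [hz] at h1
      have h2 : inner ℝ (-(g p)⁻¹ • z) (q - p) = 1 - (g p)⁻¹ * g q := by
        rw [inner_smul_left, inner_sub_right, hz q]
        simp only [conj_trivial]
        have : (g p)⁻¹ * (inner ℝ z p + m) = 1 := by rw [← hz p]; exact inv_mul_cancel₀ hgp.ne'
        linarith
      rw [h2, hz q]
      have : 0 < (g p)⁻¹ * (inner ℝ z q + m) := by positivity
      linarith
    rw [← closure_convexHull_extremePoints hK (convex_polarSet s p)] at hy
    have hsub : closure (convexHull ℝ ((polarSet s p).extremePoints ℝ)) ⊆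
        {y | inner ℝ y (x - p) ≤ 1} := by
      refine closure_minimal (convexHull_min ?_ ?_) (isClosed_le (by fun_prop) continuous_const)
      · intro y hy
        have := hx _ ⟨y, hy, rfl⟩
        rw [hn] at this
        simp only [mem_ofPred_eq]
        linarith
      · intro y hy z hz a b ha hb hab
        simp only [mem_ofPred_eq] at *
        rw [inner_add_left, inner_smul_left, inner_smul_left]
        simp only [conj_trivial]
        nlinarith
    have h3 := hsub hy
    have h2 : inner ℝ (-(g p)⁻¹ • z) (x - p) = 1 - (g p)⁻¹ * g x := by
      rw [inner_smul_left, inner_sub_right, hz x]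
      simp only [conj_trivial]
      have : (g p)⁻¹ * (inner ℝ z p + m) = 1 := by rw [← hz p]; exact inv_mul_cancel₀ hgp.ne'
      linarith
    simp only [mem_ofPred_eq] at h3
    rw [h2] at h3
    have : 0 < (g p)⁻¹ * (-g x) := mul_pos (inv_pos.2 hgp) (by linarith)
    linarith

/-! ### Affine bases -/

theorem affine_zero_of_mem_affineSpan {s : Set (E d)} {f : E d →ᵃ[ℝ] ℝ} (hf : ∀ x ∈ s, f x = 0)
    {x : E d} (hx : x ∈ affineSpan ℝ s) : f x = 0 := by
  have h : affineSpan ℝ s ≤ (AffineSubspace.mk' (0 : ℝ) ⊥).comap f := by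
    rw [affineSpan_le]
    intro y hy
    simp [hf y hy]
  simpa using h hx

/-- `d` affinely independent points on a hyperplane and one point off it form an affine basis. -/
theorem exists_affineBasis_option {u : Fin d → E d} (hu : AffineIndependent ℝ u)
    {f : E d →ᵃ[ℝ] ℝ} (hf : ∀ k, f (u k) = 0) {p : E d} (hp : f p ≠ 0) :
    ∃ b : AffineBasis (Option (Fin d)) ℝ (E d), b none = p ∧ ∀ k, b (some k) = u k := by
  let q : Option (Fin d) → E d := fun o => o.elim p u
  have hi : AffineIndependent ℝ q := by
    refine AffineIndependent.affineIndependent_of_notMem_span (i := none) ?_ ?_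
    · let e : {y : Option (Fin d) // y ≠ none} ≃ Fin d :=
        { toFun := fun y => y.1.get (Option.isSome_iff_ne_none.2 y.2)
          invFun := fun k => ⟨some k, by simp⟩
          left_inv := fun y => by ext; simp
          right_inv := fun k => by simp }
      rw [← affineIndependent_equiv e.symm]
      exact hu
    · intro hmem
      refine hp (affine_zero_of_mem_affineSpan ?_ hmem)
      rintro _ ⟨o, ho, rfl⟩
      cases o with
      | none => exact absurd rfl ho
      | some k => exact hf k
  refine ⟨⟨q, hi, ?_⟩, rfl, fun k => rfl⟩
  rw [hi.affineSpan_eq_top_iff_card_eq_finrank_add_one]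
  simp

theorem affineBasis_expand (b : AffineBasis (Option (Fin d)) ℝ (E d)) (n : E d →ᵃ[ℝ] ℝ) (x : E d) :
    n x = b.coord none x * n (b none) + ∑ k, b.coord (some k) x * n (b (some k)) := by
  obtain ⟨y, m, h⟩ := affineMap_eq_inner n
  have h1 := b.linear_combination_coord_eq_self x
  have h2 := b.sum_coord_apply_eq_one x
  rw [← Fintype.sum_option (fun o => b.coord o x * n (b o))]
  conv_lhs => rw [h, ← h1]
  simp only [h, mul_add, Finset.sum_add_distrib, ← Finset.sum_mul, h2, one_mul, inner_sum,
    inner_smul_right]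

/-- An affine functional is determined by its values on an affine basis. -/
theorem affineBasis_ext (b : AffineBasis (Option (Fin d)) ℝ (E d)) {n n' : E d →ᵃ[ℝ] ℝ}
    (h0 : n (b none) = n' (b none)) (h : ∀ k, n (b (some k)) = n' (b (some k))) (x : E d) :
    n x = n' x := by
  rw [affineBasis_expand b n, affineBasis_expand b n']
  simp [h0, h]

theorem finrank_vectorSpan_le_of_affine {B : Set (E d)} {n : E d →ᵃ[ℝ] ℝ} (h : ∀ x ∈ B, n x = 0)
    {p : E d} (hp : n p ≠ 0) (hB : B.Nonempty) : Module.finrank ℝ (vectorSpan ℝ B) + 1 ≤ d := by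
  obtain ⟨y, m, hn⟩ := affineMap_eq_inner n
  refine finrank_vectorSpan_le_of_zero (y := y) (c := -m) ?_ fun x hx => ?_
  · rintro rfl
    obtain ⟨x, hx⟩ := hB
    have h1 := h x hx
    rw [hn] at h1 hp
    simp_all
  · have := h x hx
    rw [hn] at this
    linarith

theorem finrank_vectorSpan_top {P : Set (E d)} (hP : IsPolytope P) :
    Module.finrank ℝ (vectorSpan ℝ P) = d := by
  rw [← direction_affineSpan, hP.2, AffineSubspace.direction_top, finrank_top,
    finrank_euclideanSpace_fin]

theorem IsPolytope.nonempty {P : Set (E d)} (hP : IsPolytope P) : P.Nonempty := by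
  by_contra h
  rw [not_nonempty_iff_eq_empty] at h
  have := hP.2
  rw [h, AffineSubspace.span_empty] at this
  exact AffineSubspace.bot_ne_top ℝ (E d) (E d) this

/-! ### Subsets of a simplex -/

theorem dim_hullOf {u : Fin d → E d} (hu : AffineIndependent ℝ u) (S : Finset (Fin d)) :
    dim (hullOf u S) = (S.card : ℤ) - 1 := by
  rcases S.eq_empty_or_nonempty with rfl | hS
  · simp [hullOf, dim]
  · rw [hullOf, dim_of_nonempty (convexHull_nonempty_iff.2 (by simpa using hS)),
      ← direction_affineSpan, affineSpan_convexHull, direction_affineSpan]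
    classical
    have := hu.finrank_vectorSpan_image_finset (s := S) (n := S.card - 1)
      (by have := hS.card_pos; omega)
    rw [Finset.coe_image] at this
    rw [this]
    have := hS.card_pos
    omega

theorem facetOf_eq (u : Fin d → E d) : facetOf u = convexHull ℝ (range u) := by
  simp [facetOf, hullOf]

theorem hullOf_subset_facetOf (u : Fin d → E d) (S : Finset (Fin d)) : hullOf u S ⊆ facetOf u :=
  convexHull_mono (image_mono (by simp))

theorem mem_hullOf {u : Fin d → E d} {S : Finset (Fin d)} {k : Fin d} (hk : k ∈ S) :
    u k ∈ hullOf u S := subset_convexHull ℝ _ ⟨k, hk, rfl⟩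

theorem mem_facetOf (u : Fin d → E d) (k : Fin d) : u k ∈ facetOf u := mem_hullOf (by simp)

theorem facetOf_inter_zero {u : Fin d → E d} {n : E d →ᵃ[ℝ] ℝ} (hn : ∀ k, 0 ≤ n (u k))
    {S : Finset (Fin d)} (hS : ∀ k, k ∈ S ↔ n (u k) = 0) :
    {x ∈ facetOf u | n x = 0} = hullOf u S := by
  rw [facetOf_eq, face_convexHull _ _ (by simpa using hn), hullOf]
  congr 1
  ext x
  constructor
  · rintro ⟨⟨k, rfl⟩, h⟩
    exact ⟨k, by simpa [hS] using h, rfl⟩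
  · rintro ⟨k, hk, rfl⟩
    exact ⟨⟨k, rfl⟩, (hS k).1 (by simpa using hk)⟩

/-! ### The facets adjacent to a simplex facet -/

/-- The supporting functionals `f` of the simplex facet `F = [u_1, …, u_d]` of `P` and `h_k` of the
adjacent facets `H_k`, the latter normalized by `h_k (u_k) = 1`. -/
structure FacetFrame (P : Set (E d)) (u : Fin d → E d) (f : E d →ᵃ[ℝ] ℝ)
    (h : Fin d → E d →ᵃ[ℝ] ℝ) : Prop where
  indep : AffineIndependent ℝ u
  f_nonneg : ∀ x ∈ P, 0 ≤ f x
  facet_eq : facetOf u = {x ∈ P | f x = 0}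
  facet : IsFacet P (facetOf u)
  exists_pos : ∃ p ∈ P, 0 < f p
  h_nonneg : ∀ k, ∀ x ∈ P, 0 ≤ h k x
  h_self : ∀ k, h k (u k) = 1
  h_ne : ∀ k j, j ≠ k → h k (u j) = 0
  exists_h : ∀ k, ∃ y ∈ P, h k y = 0 ∧ 0 < f y
  adj_eq : ∀ k, adjFacet P u k = {x ∈ P | h k x = 0}
  adj_facet : ∀ k, IsFacet P (adjFacet P u k)

/-- The functional of the facet adjacent to a simplex facet along the ridge `[u_j : j ≠ k]`: its
hyperplane is found by rotating about the ridge until a vertex off the facet is met. -/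
theorem exists_adj_functional {P : Set (E d)} (hP : IsPolytope P) {u : Fin d → E d}
    (hu : AffineIndependent ℝ u) {f : E d →ᵃ[ℝ] ℝ} (hf : ∀ x ∈ P, 0 ≤ f x)
    (hF : facetOf u = {x ∈ P | f x = 0}) (hpos : ∃ p ∈ P, 0 < f p) (k : Fin d) :
    ∃ h : E d →ᵃ[ℝ] ℝ, (∀ x ∈ P, 0 ≤ h x) ∧ h (u k) = 1 ∧ (∀ j, j ≠ k → h (u j) = 0) ∧
      ∃ y ∈ P, h y = 0 ∧ 0 < f y := by
  obtain ⟨p, hp, hfp⟩ := hpos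
  have hfu : ∀ j, f (u j) = 0 := fun j => ((hF ▸ mem_facetOf u j : u j ∈ {x ∈ P | f x = 0})).2
  obtain ⟨b, -, hb⟩ := exists_affineBasis_option hu hfu hfp.ne'
  obtain ⟨hfin, hhull⟩ := convexHull_vertices hP
  set V := {x ∈ vertices P | 0 < f x} with hV
  have hVfin : V.Finite := hfin.subset fun x hx => hx.1
  have hVne : V.Nonempty := by
    by_contra hempty
    have h0 : ∀ x ∈ vertices P, 0 ≤ (-f) x := fun x hx => by
      by_contra hlt
      exact hempty ⟨x, hx, by simpa using hlt⟩
    have := nonneg_convexHull h0 p (by rwa [hhull])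
    simp at this
    linarith
  -- tilt the hyperplane around the ridge until it meets a vertex off `F`
  obtain ⟨y, hy, hmin⟩ := hVfin.exists_minimalFor (fun x => b.coord (some k) x / f x) V hVne
  have hmin' : ∀ x ∈ V, b.coord (some k) y / f y ≤ b.coord (some k) x / f x := fun x hx => by
    rcases le_total (b.coord (some k) y / f y) (b.coord (some k) x / f x) with h | h
    · exact h
    · exact hmin hx h
  set β := b.coord (some k) y / f y with hβ
  let h : E d →ᵃ[ℝ] ℝ := b.coord (some k) - β • f
  have hval : ∀ x, h x = b.coord (some k) x - β * f x := fun x => by simp [h]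
  refine ⟨h, ?_, ?_, ?_, y, vertices_subset hy.1, ?_, hy.2⟩
  · rw [← hhull]
    refine nonneg_convexHull fun x hx => ?_
    rw [hval]
    rcases (hf x (vertices_subset hx)).eq_or_lt with h0 | h0
    · have hxF : x ∈ facetOf u := hF ▸ ⟨vertices_subset hx, h0.symm⟩
      rw [← h0, mul_zero, sub_zero]
      rw [facetOf_eq] at hxF
      refine nonneg_convexHull ?_ x hxF
      rintro _ ⟨j, rfl⟩
      rw [← hb, AffineBasis.coord_apply]
      split_ifs <;> norm_num
    · have := hmin' x ⟨hx, h0⟩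
      rw [le_div_iff₀ h0] at this
      linarith
  · rw [hval, hfu, ← hb, AffineBasis.coord_apply]; simp
  · intro j hj
    rw [hval, hfu, ← hb, AffineBasis.coord_apply_ne]
    · simp
    · simpa using hj.symm
  · rw [hval, hβ, div_mul_cancel₀ _ hy.2.ne', sub_self]

/-- A simplex facet has supporting functionals as in `FacetFrame`. In particular, there is only one
facet `H_k` for each `k`. -/
theorem exists_facetFrame {P : Set (E d)} (hP : IsPolytope P) {u : Fin d → E d}
    (hu : IsSimplexFacet P u) : ∃ f h, FacetFrame P u f h := by
  obtain ⟨hind, hfacet⟩ := hu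
  obtain ⟨f, hf, hF⟩ := isFace_iff.1 hfacet.1
  have hpos : ∃ p ∈ P, 0 < f p := by
    by_contra! hle
    have h1 : facetOf u = P := by
      rw [hF]
      exact Subset.antisymm (fun x hx => hx.1) fun x hx => ⟨hx, le_antisymm (hle x hx) (hf x hx)⟩
    have h2 := hfacet.2
    rw [h1, dim_of_nonempty hP.nonempty, finrank_vectorSpan_top hP] at h2
    omega
  choose h h1 h2 h3 h4 using exists_adj_functional hP hind hf hF hpos
  have hfu : ∀ j, f (u j) = 0 := fun j => ((hF ▸ mem_facetOf u j : u j ∈ {x ∈ P | f x = 0})).2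
  have huP : ∀ j, u j ∈ P := fun j => ((hF ▸ mem_facetOf u j : u j ∈ {x ∈ P | f x = 0})).1
  have hinter : ∀ k, {x ∈ P | h k x = 0} ∩ facetOf u = hullOf u {k}ᶜ := fun k => by
    rw [← facetOf_inter_zero (n := h k) (fun j => h1 k _ (huP j)) (fun j => ?_)]
    · ext x
      simp only [mem_inter_iff, mem_ofPred_eq]
      have : x ∈ facetOf u → x ∈ P := fun hx => by rw [hF] at hx; exact hx.1
      tauto
    · rcases eq_or_ne j k with rfl | hjk
      · simp [h2]
      · simp [h3 k j hjk, hjk]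
  have hisfacet : ∀ k, IsFacet P {x ∈ P | h k x = 0} := fun k => by
    refine ⟨IsFace.of_affine (h k) (h1 k) rfl, ?_⟩
    obtain ⟨y, hyP, hy0, hfy⟩ := h4 k
    have hne : {x ∈ P | h k x = 0}.Nonempty := ⟨y, hyP, hy0⟩
    rw [dim_of_nonempty hne]
    have hle := finrank_vectorSpan_le_of_affine (B := {x ∈ P | h k x = 0}) (n := h k)
      (fun x hx => hx.2) (p := u k) (by simp [h2]) hne
    obtain ⟨b, hb0, hb⟩ := exists_affineBasis_option hind hfu hfy.ne'
    classical
    have hge := b.ind.finrank_vectorSpan_image_finset (s := {some k}ᶜ) (n := d - 1) (by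
      rw [Finset.card_compl]
      simp
      have := k.pos
      omega)
    have hsub : vectorSpan ℝ (↑(({some k}ᶜ : Finset (Option (Fin d))).image b) : Set (E d)) ≤
        vectorSpan ℝ {x ∈ P | h k x = 0} := by
      refine vectorSpan_mono ℝ ?_
      rw [Finset.coe_image]
      rintro _ ⟨o, ho, rfl⟩
      cases o with
      | none => rw [hb0]; exact ⟨hyP, hy0⟩
      | some j => rw [hb]; exact ⟨huP j, h3 k j (by simpa using ho)⟩
    have := Submodule.finrank_mono hsub
    have := k.pos
    omega
  have hadj : ∀ k, adjFacet P u k = {x ∈ P | h k x = 0} := fun k => by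
    apply Subset.antisymm
    · refine sUnion_subset ?_
      rintro H ⟨hH, hHF⟩
      obtain ⟨n, hn, rfl⟩ := isFace_iff.1 hH.1
      have hnu : ∀ j, j ≠ k → n (u j) = 0 := fun j hj => by
        have : u j ∈ {x ∈ P | n x = 0} ∩ facetOf u := by
          rw [hHF]; exact mem_hullOf (by simpa using hj)
        exact this.1.2
      have hnk : 0 < n (u k) := by
        refine (hn _ (huP k)).lt_of_ne fun h0 => ?_
        have : u k ∈ {x ∈ P | h k x = 0} ∩ facetOf u := by
          rw [hinter, ← hHF]
          exact ⟨⟨huP k, h0.symm⟩, mem_facetOf u k⟩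
        have := this.1.2
        rw [h2] at this
        norm_num at this
      obtain ⟨y, hyP, hy0, hfy⟩ := h4 k
      obtain ⟨b, hb0, hb⟩ := exists_affineBasis_option hind hfu hfy.ne'
      have hexp : ∀ x, n x = (n (u k) • h k + (n y / f y) • f) x := by
        refine affineBasis_ext b ?_ fun j => ?_
        · rw [hb0]
          simp [hy0, hfy.ne']
        · rw [hb]
          rcases eq_or_ne j k with rfl | hjk
          · simp [h2, hfu]
          · simp [h3 k j hjk, hfu, hnu j hjk]
      have hexp' : ∀ x, n x = n (u k) * h k x + n y / f y * f x := fun x => by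
        rw [hexp]; simp
      rintro x ⟨hxP, hx0⟩
      refine ⟨hxP, ?_⟩
      have hx := hexp' x
      rw [hx0] at hx
      have t1 : 0 ≤ n (u k) * h k x := mul_nonneg hnk.le (h1 k x hxP)
      have t2 : 0 ≤ n y / f y * f x := mul_nonneg (div_nonneg (hn y hyP) hfy.le) (hf x hxP)
      have t3 : n (u k) * h k x = 0 := by linarith
      exact (mul_eq_zero.1 t3).resolve_left hnk.ne'
    · exact fun x hx => mem_sUnion.2 ⟨_, ⟨hisfacet k, hinter k⟩, hx⟩
  exact ⟨f, h, hind, hf, hF, hfacet, hpos, h1, h2, h3, h4, hadj, fun k => hadj k ▸ hisfacet k⟩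

/-! ### Faces around a simplex facet -/

namespace FacetFrame

variable {P : Set (E d)} {u : Fin d → E d} {f : E d →ᵃ[ℝ] ℝ} {h : Fin d → E d →ᵃ[ℝ] ℝ}

theorem u_mem (D : FacetFrame P u f h) (j : Fin d) : u j ∈ P :=
  ((D.facet_eq ▸ mem_facetOf u j : u j ∈ {x ∈ P | f x = 0})).1

theorem f_u (D : FacetFrame P u f h) (j : Fin d) : f (u j) = 0 :=
  ((D.facet_eq ▸ mem_facetOf u j : u j ∈ {x ∈ P | f x = 0})).2

theorem h_u (D : FacetFrame P u f h) (k j : Fin d) : h k (u j) = if k = j then 1 else 0 := by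
  split_ifs with hkj
  · rw [← hkj, D.h_self]
  · exact D.h_ne k j (Ne.symm hkj)

theorem adjInter_eq (D : FacetFrame P u f h) (S : Finset (Fin d)) :
    adjInter P u S = {x ∈ P | ∀ k ∈ S, h k x = 0} := by
  ext x
  simp only [adjInter, D.adj_eq, mem_inter_iff, mem_iInter, mem_ofPred_eq]
  exact ⟨fun hx => ⟨hx.1, fun k hk => (hx.2 k hk).2⟩,
    fun hx => ⟨hx.1, fun k hk => ⟨hx.1, hx.2 k hk⟩⟩⟩

theorem isFace_adjInter (D : FacetFrame P u f h) (S : Finset (Fin d)) :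
    IsFace P (adjInter P u S) := by
  obtain ⟨n, hn⟩ := affineMap_sum S h
  refine IsFace.of_affine n (fun x hx => ?_) ?_
  · rw [hn]; exact Finset.sum_nonneg fun k _ => D.h_nonneg k x hx
  · rw [D.adjInter_eq]
    ext x
    simp only [mem_ofPred_eq, hn, and_congr_right_iff]
    intro hx
    rw [Finset.sum_eq_zero_iff_of_nonneg fun k _ => D.h_nonneg k x hx]

theorem u_mem_adjInter (D : FacetFrame P u f h) {S : Finset (Fin d)} {j : Fin d} :
    u j ∈ adjInter P u S ↔ j ∉ S := by
  rw [D.adjInter_eq]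
  simp [D.u_mem, D.h_u]

theorem mem_hullOf_iff (D : FacetFrame P u f h) {S : Finset (Fin d)} {x : E d} :
    x ∈ hullOf u S ↔ x ∈ P ∧ f x = 0 ∧ ∀ k ∉ S, h k x = 0 := by
  obtain ⟨n, hn⟩ := affineMap_sum Sᶜ h
  have h1 := facetOf_inter_zero (u := u) (n := n) (S := S)
    (fun k => by rw [hn]; exact Finset.sum_nonneg fun j _ => D.h_nonneg j _ (D.u_mem k))
    (fun k => by simp [hn, D.h_u])
  rw [← h1, D.facet_eq]
  simp only [mem_ofPred_eq, hn, and_assoc, and_congr_right_iff]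
  intro hx _
  rw [Finset.sum_eq_zero_iff_of_nonneg fun k _ => D.h_nonneg k x hx]
  simp

theorem u_mem_hullOf (D : FacetFrame P u f h) {S : Finset (Fin d)} {j : Fin d} :
    u j ∈ hullOf u S ↔ j ∈ S := by
  refine ⟨fun hj => ?_, mem_hullOf⟩
  by_contra hjS
  have := (D.mem_hullOf_iff.1 hj).2.2 j hjS
  rw [D.h_self] at this
  norm_num at this

theorem isFace_hullOf (D : FacetFrame P u f h) (S : Finset (Fin d)) : IsFace P (hullOf u S) := by
  obtain ⟨n, hn⟩ := affineMap_sum Sᶜ h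
  have hnn : ∀ x ∈ P, 0 ≤ n x := fun x hx => by
    rw [hn]; exact Finset.sum_nonneg fun k _ => D.h_nonneg k x hx
  refine IsFace.of_affine (f + n) (fun x hx => ?_) ?_
  · exact add_nonneg (D.f_nonneg x hx) (hnn x hx)
  · ext x
    rw [D.mem_hullOf_iff]
    simp only [mem_ofPred_eq, and_congr_right_iff, AffineMap.coe_add, Pi.add_apply]
    intro hx
    rw [add_eq_zero_iff_of_nonneg (D.f_nonneg x hx) (hnn x hx), hn,
      Finset.sum_eq_zero_iff_of_nonneg fun k _ => D.h_nonneg k x hx]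
    simp

open Classical in
/-- The faces of `P` inside a simplex facet are the faces of the simplex. -/
theorem eq_hullOf (D : FacetFrame P u f h) {B : Set (E d)} (hB : IsFace P B)
    (hBF : B ⊆ facetOf u) : B = hullOf u (Finset.univ.filter fun k => u k ∈ B) := by
  obtain ⟨n, hn, rfl⟩ := isFace_iff.1 hB
  rw [← facetOf_inter_zero (n := n) (fun k => hn _ (D.u_mem k)) (fun k => by simp [D.u_mem])]
  apply Subset.antisymm
  · exact fun x hx => ⟨hBF hx, hx.2⟩
  · rintro x ⟨hx, h0⟩
    rw [D.facet_eq] at hx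
    exact ⟨hx.1, h0⟩

/-- The facets of an `i`-simple polytope through a `(d-i-1)`-face of a simplex facet are the facet
itself and the adjacent facets through that face. -/
theorem facets_containing_hullOf (D : FacetFrame P u f h) {i : ℕ}
    (hsimple : IsSimple i P)
    {T : Finset (Fin d)} (hT : T.card + i = d) {G : Set (E d)} (hG : IsFacet P G)
    (hTG : hullOf u T ⊆ G) : G = facetOf u ∨ ∃ k ∉ T, G = adjFacet P u k := by
  have hcard := hsimple _ (D.isFace_hullOf T) (by rw [dim_hullOf D.indep]; omega)
  let g : Option (Fin d) → Set (E d) := fun o => o.elim (facetOf u) (adjFacet P u)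
  have hginj : Function.Injective g := by
    have key : ∀ k j, u j ∈ adjFacet P u k ↔ k ≠ j := fun k j => by
      rw [D.adj_eq]; simp [D.u_mem, D.h_u]
    intro a b hab
    cases a with
    | none => cases b with
      | none => rfl
      | some k => 
        have h3 : facetOf u = adjFacet P u k := hab
        exact absurd (h3 ▸ mem_facetOf u k : u k ∈ adjFacet P u k) (by simp [key])
    | some j => cases b with
      | none =>
        have h3 : adjFacet P u j = facetOf u := hab
        exact absurd (h3.symm ▸ mem_facetOf u j : u j ∈ adjFacet P u j) (by simp [key])
      | some k =>
        have h1 := key j k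
        have h2 := key k k
        have h3 : adjFacet P u j = adjFacet P u k := hab
        rw [h3, h2] at h1
        simp only [ne_eq, not_true_eq_false, false_iff, not_not] at h1
        rw [h1]
  classical
  let X : Finset (Option (Fin d)) := insert none (Tᶜ.image some)
  have hXcard : X.card = i + 1 := by
    rw [Finset.card_insert_of_notMem (by simp), Finset.card_image_of_injective _
      (Option.some_injective _), Finset.card_compl, Fintype.card_fin]
    omega
  have hsub : g '' (X : Set (Option (Fin d))) ⊆ {G | IsFacet P G ∧ hullOf u T ⊆ G} := by
    rintro _ ⟨o, ho, rfl⟩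
    cases o with
    | none => exact ⟨D.facet, hullOf_subset_facetOf u T⟩
    | some k =>
      refine ⟨D.adj_facet k, fun x hx => ?_⟩
      have hk : k ∉ T := by simpa [X] using ho
      show x ∈ adjFacet P u k
      rw [D.adj_eq]
      exact ⟨(D.mem_hullOf_iff.1 hx).1, (D.mem_hullOf_iff.1 hx).2.2 k hk⟩
  have heq := eq_of_subset_of_ncard_le hsub
    (by rw [hcard, ncard_image_of_injective _ hginj, ncard_coe_finset, hXcard])
    (finite_of_ncard_pos (by omega))
  have hmem : G ∈ g '' (X : Set (Option (Fin d))) := by rw [heq]; exact ⟨hG, hTG⟩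
  obtain ⟨o, ho, rfl⟩ := hmem
  cases o with
  | none => exact Or.inl rfl
  | some k => exact Or.inr ⟨k, by simpa [X] using ho, rfl⟩

theorem eq_smul_f (D : FacetFrame P u f h) {n : E d →ᵃ[ℝ] ℝ} (hn : ∀ x ∈ P, 0 ≤ n x)
    (h0 : ∀ k, n (u k) = 0) : ∃ c : ℝ, 0 ≤ c ∧ ∀ x, n x = c * f x := by
  obtain ⟨p, hp, hfp⟩ := D.exists_pos
  obtain ⟨b, hb0, hb⟩ := exists_affineBasis_option D.indep D.f_u hfp.ne'
  refine ⟨n p / f p, div_nonneg (hn p hp) hfp.le, fun x => ?_⟩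
  rw [affineBasis_ext b (n := n) (n' := (n p / f p) • f)]
  · simp
  · simp [hb0, hfp.ne']
  · simp [hb, h0, D.f_u]

theorem eq_smul_h (D : FacetFrame P u f h) {n : E d →ᵃ[ℝ] ℝ} (hn : ∀ x ∈ P, 0 ≤ n x) {k : Fin d}
    (h0 : ∀ x ∈ adjFacet P u k, n x = 0) : ∃ c : ℝ, 0 ≤ c ∧ ∀ x, n x = c * h k x := by
  obtain ⟨y, hy, hy0, hfy⟩ := D.exists_h k
  obtain ⟨b, hb0, hb⟩ := exists_affineBasis_option D.indep D.f_u hfy.ne'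
  rw [D.adj_eq] at h0
  refine ⟨n (u k), hn _ (D.u_mem k), fun x => ?_⟩
  rw [affineBasis_ext b (n := n) (n' := n (u k) • h k)]
  · simp
  · simp [hb0, hy0, h0 y ⟨hy, hy0⟩]
  · intro j
    rcases eq_or_ne j k with rfl | hjk
    · simp [hb, D.h_self]
    · simp [hb, D.h_ne k j hjk, h0 (u j) ⟨D.u_mem j, D.h_ne k j hjk⟩]

/-- Around the relative interior of a face `[u_k : k ∈ T]` with `|T| ≥ d - i`, an `i`-simple
polytope is cut out by `F` and the `H_k`, so `⋂_{k ∉ T} H_k` leaves `F`. -/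
theorem exists_off_facet (hd : 1 ≤ d) (hP : IsPolytope P) (D : FacetFrame P u f h) {i : ℕ}
    (hid : i < d) (hsimple : IsSimple i P) {T : Finset (Fin d)} (hT : d ≤ T.card + i) :
    ∃ z ∈ P, (∀ k ∉ T, h k z = 0) ∧ 0 < f z := by
  obtain ⟨T', hT'T, hT'⟩ := Finset.exists_subset_card_eq (s := T) (n := d - i) (by omega)
  suffices H : ∃ z ∈ P, (∀ k ∉ T', h k z = 0) ∧ 0 < f z by
    obtain ⟨z, h1, h2, h3⟩ := H
    exact ⟨z, h1, fun k hk => h2 k fun h => hk (hT'T h), h3⟩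
  clear hT
  have hne : T'.Nonempty := Finset.card_pos.1 (by omega)
  obtain ⟨t, ht⟩ := hne
  have hcpos : (0 : ℝ) < T'.card := by
    have : 0 < T'.card := Finset.card_pos.2 ⟨t, ht⟩
    exact_mod_cast this
  obtain ⟨N, hNfin, hN, hNP⟩ := exists_facet_functionals hd hP
  obtain ⟨p, hp, hfp⟩ := D.exists_pos
  -- the barycentre of the face
  let x₁ : E d := (T'.card : ℝ)⁻¹ • ∑ k ∈ T', u k
  have hx₁ : ∀ n : E d →ᵃ[ℝ] ℝ, n x₁ = (T'.card : ℝ)⁻¹ * ∑ k ∈ T', n (u k) := fun n => by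
    obtain ⟨y, m, hn⟩ := affineMap_eq_inner n
    simp only [x₁, hn, inner_smul_right, inner_sum, Finset.sum_add_distrib, Finset.sum_const,
      nsmul_eq_mul]
    field_simp
  -- a direction leaving `F` inside all the hyperplanes of the `H_k`, `k ∉ T'`
  let e : E d := (p - u t) - ∑ k, h k p • (u k - u t)
  have hz : ∀ (n : E d →ᵃ[ℝ] ℝ) (ε : ℝ), n (x₁ + ε • e) =
      n x₁ + ε * (n p - n (u t) - ∑ k, h k p * (n (u k) - n (u t))) := fun n ε => by
    obtain ⟨y, m, hn⟩ := affineMap_eq_inner n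
    simp only [e, hn, inner_smul_right, inner_add_right, inner_sub_right, inner_sum]
    simp only [add_sub_add_right_eq_sub]
    ring
  have hfz : ∀ ε, f (x₁ + ε • e) = ε * f p := fun ε => by
    rw [hz, hx₁]; simp [D.f_u]
  have hhz : ∀ ε, ∀ k ∉ T', h k (x₁ + ε • e) = 0 := fun ε k hk => by
    have hkt : k ≠ t := fun h => hk (h ▸ ht)
    rw [hz, hx₁]
    have h1 : ∑ j ∈ T', h k (u j) = 0 := Finset.sum_eq_zero fun j hj =>
      D.h_ne k j fun h => hk (h ▸ hj)
    rw [h1]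
    simp [D.h_u, hkt]
  have hev : ∀ᶠ ε in nhdsWithin (0 : ℝ) (Ioi 0), ∀ n ∈ N, 0 ≤ n (x₁ + ε • e) := by
    rw [Filter.eventually_all_finite hNfin]
    intro n hn
    obtain ⟨hnP, hnfacet⟩ := hN n hn
    have hnu : ∀ k, 0 ≤ n (u k) := fun k => hnP _ (D.u_mem k)
    have hx0 : 0 ≤ n x₁ := by
      rw [hx₁]
      exact mul_nonneg (inv_nonneg.2 hcpos.le) (Finset.sum_nonneg fun k _ => hnu k)
    rcases hx0.eq_or_lt with h0 | h0
    · -- an active facet contains the whole face `[u_k : k ∈ T']`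
      rw [hx₁, eq_comm, mul_eq_zero, or_iff_right (inv_pos.2 hcpos).ne',
        Finset.sum_eq_zero_iff_of_nonneg fun k _ => hnu k] at h0
      have hTG : hullOf u T' ⊆ {x ∈ P | n x = 0} := by
        refine convexHull_min ?_ (hP.convex.inter (convex_zero n))
        rintro _ ⟨k, hk, rfl⟩
        exact ⟨D.u_mem k, h0 k hk⟩
      filter_upwards [self_mem_nhdsWithin] with ε hε
      have hε' : (0 : ℝ) < ε := hε
      rcases D.facets_containing_hullOf hsimple (by omega) hnfacet hTG with hG | ⟨k, hk, hG⟩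
      · obtain ⟨c, hc, hcf⟩ := D.eq_smul_f hnP fun k => by
          have : u k ∈ {x ∈ P | n x = 0} := hG ▸ mem_facetOf u k
          exact this.2
        rw [hcf, hfz]
        positivity
      · obtain ⟨c, hc, hcf⟩ := D.eq_smul_h (k := k) hnP fun x hx => by
          rw [← hG] at hx
          exact hx.2
        rw [hcf, hhz ε k hk, mul_zero]
    · apply Filter.Eventually.filter_mono nhdsWithin_le_nhds
      have hc : ContinuousAt (fun ε : ℝ => n x₁ +
          ε * (n p - n (u t) - ∑ k, h k p * (n (u k) - n (u t)))) 0 := by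
        fun_prop
      have := hc.eventually_const_lt (u := 0) (by simpa using h0)
      exact this.mono fun ε h => by rw [hz]; exact h.le
  obtain ⟨ε, h1, h2⟩ := (hev.and self_mem_nhdsWithin).exists
  exact ⟨x₁ + ε • e, hNP _ h1, hhz ε, by rw [hfz]; exact mul_pos h2 hfp⟩

end FacetFrame

/-! ### Simple vertices -/

theorem exists_pos_of_facet {P : Set (E d)} (hP : IsPolytope P) {n : E d →ᵃ[ℝ] ℝ}
    (hn : ∀ x ∈ P, 0 ≤ n x) (hG : IsFacet P {x ∈ P | n x = 0}) : ∃ p ∈ P, 0 < n p := by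
  by_contra! hle
  have h1 : {x ∈ P | n x = 0} = P :=
    Subset.antisymm (fun x hx => hx.1) fun x hx => ⟨hx, le_antisymm (hle x hx) (hn x hx)⟩
  have h2 := hG.2
  rw [h1, dim_of_nonempty hP.nonempty, finrank_vectorSpan_top hP] at h2
  omega

/-- Facet functionals are unique up to scaling. -/
theorem eq_smul_of_facet (hd : 1 ≤ d) {P : Set (E d)} (hP : IsPolytope P) {n n' : E d →ᵃ[ℝ] ℝ}
    (hn : ∀ x ∈ P, 0 ≤ n x) (hn' : ∀ x ∈ P, 0 ≤ n' x) (hG : IsFacet P {x ∈ P | n x = 0})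
    (h0 : ∀ x ∈ P, n x = 0 → n' x = 0) : ∃ c : ℝ, 0 ≤ c ∧ ∀ x, n' x = c * n x := by
  obtain ⟨p, hp, hnp⟩ := exists_pos_of_facet hP hn hG
  set G := {x ∈ P | n x = 0} with hGdef
  have hGne : G.Nonempty := by
    by_contra h
    rw [not_nonempty_iff_eq_empty] at h
    have := hG.2
    rw [h] at this
    simp only [dim, ↓reduceIte] at this
    omega
  obtain ⟨t, htG, hspan, hind⟩ := exists_affineIndependent ℝ (E d) G
  have hdim := hG.2
  rw [dim_of_nonempty hGne, ← direction_affineSpan, ← hspan, direction_affineSpan] at hdim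
  have hfin := finite_set_of_fin_dim_affineIndependent ℝ hind
  have := hfin.fintype
  have htne : t.Nonempty := by
    rw [← affineSpan_nonempty ℝ, hspan, affineSpan_nonempty]; exact hGne
  have : Nonempty t := htne.to_subtype
  have hcard : Fintype.card t = d := by
    have h1 := hind.finrank_vectorSpan_add_one
    rw [Subtype.range_coe] at h1
    rw [Fintype.card_eq_nat_card] at h1 ⊢
    change _ = Nat.card t at h1
    omega
  let u : Fin d → E d := fun k => (Fintype.equivFinOfCardEq hcard).symm k
  have hu : AffineIndependent ℝ u := hind.comp_embedding
    (Fintype.equivFinOfCardEq hcard).symm.toEmbedding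
  have huG : ∀ k, u k ∈ G := fun k => htG (Subtype.coe_prop _)
  obtain ⟨b, hb0, hb⟩ := exists_affineBasis_option hu (fun k => (huG k).2) hnp.ne'
  refine ⟨n' p / n p, div_nonneg (hn' p hp) hnp.le, fun x => ?_⟩
  rw [affineBasis_ext b (n := n') (n' := (n' p / n p) • n)]
  · simp
  · simp [hb0, hnp.ne']
  · intro k
    simp [hb, (huG k).2, h0 _ (huG k).1 (huG k).2]

theorem affineIndependent_of_dual {ι : Type*} {q : ι → E d} (g : ι → E d →ᵃ[ℝ] ℝ)
    (h1 : ∀ o, g o (q o) ≠ 0) (h2 : ∀ o o', o' ≠ o → g o (q o') = 0) : AffineIndependent ℝ q := by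
  rw [affineIndependent_iff]
  intro s w hw hs o ho
  obtain ⟨y, m, hy⟩ := affineMap_eq_inner (g o)
  have h3 : ∑ j ∈ s, w j * g o (q j) = 0 := by
    have : inner ℝ y (∑ j ∈ s, w j • q j) + (∑ j ∈ s, w j) * m = 0 := by rw [hs, hw]; simp
    rw [← this]
    simp only [hy, mul_add, Finset.sum_add_distrib, inner_sum, inner_smul_right, Finset.sum_mul]
  rw [Finset.sum_eq_single_of_mem o ho fun j _ hj => by rw [h2 o j hj, mul_zero]] at h3
  exact (mul_eq_zero.1 h3).resolve_right (h1 o)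

/-- The facet functionals at a simple vertex: `d` of them, cutting out the polytope near the
vertex. -/
theorem exists_vertex_functionals (hd : 1 ≤ d) {P : Set (E d)} (hP : IsPolytope P) {v : E d}
    (hv : IsSimpleVertex P v) : ∃ n : Fin d → E d →ᵃ[ℝ] ℝ,
      (∀ k, ∀ x ∈ P, 0 ≤ n k x) ∧ (∀ k, n k v = 0) ∧
      (∀ k, IsFacet P {x ∈ P | n k x = 0}) ∧
      (∀ G, IsFacet P G → v ∈ G → ∃ k, G = {x ∈ P | n k x = 0}) ∧
      ∀ e : E d, (∀ k, 0 ≤ n k (v + e)) →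
        ∀ᶠ ε in nhdsWithin (0 : ℝ) (Ioi 0), v + ε • e ∈ P := by
  obtain ⟨hvert, hcard⟩ := hv
  set 𝒢 := {G | IsFacet P G ∧ v ∈ G} with h𝒢
  have hfin : 𝒢.Finite := finite_of_ncard_pos (by omega)
  have := hfin.to_subtype
  let e := Finite.equivFinOfCardEq (α := 𝒢) (n := d) hcard
  have hface : ∀ k, ∃ n : E d →ᵃ[ℝ] ℝ, (∀ x ∈ P, 0 ≤ n x) ∧ (e.symm k).1 = {x ∈ P | n x = 0} :=
    fun k => isFace_iff.1 (e.symm k).2.1.1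
  choose n hn hG using hface
  have hvn : ∀ k, n k v = 0 := fun k => by
    have : v ∈ {x ∈ P | n k x = 0} := hG k ▸ (e.symm k).2.2
    exact this.2
  have hfac : ∀ k, IsFacet P {x ∈ P | n k x = 0} := fun k => hG k ▸ (e.symm k).2.1
  have hall : ∀ G, IsFacet P G → v ∈ G → ∃ k, G = {x ∈ P | n k x = 0} := fun G h1 h2 => by
    refine ⟨e ⟨G, h1, h2⟩, ?_⟩
    rw [← hG]; simp
  refine ⟨n, hn, hvn, hfac, hall, fun q hq => ?_⟩
  obtain ⟨N, hNfin, hN, hNP⟩ := exists_facet_functionals hd hP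
  have hev : ∀ᶠ ε in nhdsWithin (0 : ℝ) (Ioi 0), ∀ m ∈ N, 0 ≤ m (v + ε • q) := by
    rw [Filter.eventually_all_finite hNfin]
    intro m hm
    obtain ⟨hmP, hmfacet⟩ := hN m hm
    have hval : ∀ (m : E d →ᵃ[ℝ] ℝ) (ε : ℝ), m (v + ε • q) = m v + ε * (m (v + q) - m v) :=
      fun m ε => by
        have : v + ε • q = (1 - ε) • v + ε • (v + q) := by module
        rw [this, affineMap_combo _ _ _ _ _ (by ring)]; ring
    rcases (hmP v (vertices_subset hvert)).eq_or_lt with h0 | h0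
    · obtain ⟨k, hk⟩ := hall _ hmfacet ⟨vertices_subset hvert, h0.symm⟩
      obtain ⟨c, hc, hcm⟩ := eq_smul_of_facet hd hP (hn k) hmP (hfac k) fun x hx hx0 => by
        have : x ∈ {x ∈ P | m x = 0} := hk ▸ ⟨hx, hx0⟩
        exact this.2
      filter_upwards [self_mem_nhdsWithin] with ε hε
      have hε' : (0 : ℝ) < ε := hε
      rw [hcm, hval, hvn]
      have := hq k
      simp only [zero_add, sub_zero]
      positivity
    · apply Filter.Eventually.filter_mono nhdsWithin_le_nhds
      have hc : ContinuousAt (fun ε : ℝ => m v + ε * (m (v + q) - m v)) 0 := by fun_prop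
      have := hc.eventually_const_lt (u := 0) (by simpa using h0)
      exact this.mono fun ε h => by rw [hval]; exact h.le
  exact hev.mono fun ε h => hNP _ h

/-- The edges at a simple vertex: the edge off the `k`-th facet ends in a vertex. -/
theorem exists_edge {P : Set (E d)} (hP : IsPolytope P) {v : E d}
    (hvert : v ∈ vertices P) {n : Fin d → E d →ᵃ[ℝ] ℝ} (hn : ∀ k, ∀ x ∈ P, 0 ≤ n k x)
    (hvn : ∀ k, n k v = 0)
    (hloc : ∀ e : E d, (∀ k, 0 ≤ n k (v + e)) →
        ∀ᶠ ε in nhdsWithin (0 : ℝ) (Ioi 0), v + ε • e ∈ P) (k : Fin d) :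
    ∃ x ∈ vertices P, x ≠ v ∧ IsFace P (segment ℝ v x) ∧ 0 < n k x ∧ ∀ l, l ≠ k → n l x = 0 := by
  classical
  let L : E d →ₗ[ℝ] (Fin d → ℝ) := LinearMap.pi fun k => (n k).linear
  have hL : ∀ e k, L e k = n k (v + e) := fun e k => by
    have := (n k).map_vadd v e
    simp only [vadd_eq_add, hvn, add_zero] at this
    rw [add_comm, this]; rfl
  have hinj : Function.Injective L := by
    rw [injective_iff_map_eq_zero]
    intro e he
    have h1 : ∀ k, n k (v + e) = 0 := fun k => by rw [← hL, he]; rfl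
    have h2 : ∀ k, n k (v + -e) = 0 := fun k => by rw [← hL, map_neg, he]; simp
    obtain ⟨ε, ⟨h3, h4⟩, h5⟩ := (((hloc e fun k => (h1 k).ge).and
      (hloc (-e) fun k => (h2 k).ge)).and self_mem_nhdsWithin).exists
    have h6 := (mem_extremePoints.1 (mem_extremePoints_of_mem_vertices hvert)).2 _ h3 _ h4
      ⟨1 / 2, 1 / 2, by norm_num, by norm_num, by norm_num, by module⟩
    have h7 : ε • e = 0 := by simpa using h6.1
    exact (smul_eq_zero.1 h7).resolve_left (ne_of_gt h5)
  have hsurj : Function.Surjective L :=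
    (LinearMap.injective_iff_surjective_of_finrank_eq_finrank (by simp)).1 hinj
  obtain ⟨e, he⟩ := hsurj (Pi.single k 1)
  have hray : ∀ x, (∀ l, l ≠ k → n l x = 0) → x = v + n k x • e := fun x hx => by
    have : L (x - v) = L (n k x • e) := by
      ext l
      rw [map_smul, he, hL, add_sub_cancel]
      rcases eq_or_ne l k with rfl | hl
      · simp
      · simp [hx l hl, hl]
    rw [← hinj this, add_sub_cancel]
  obtain ⟨m, hm⟩ := affineMap_sum (Finset.univ.erase k) n
  have hm0 : ∀ x ∈ P, 0 ≤ m x := fun x hx => by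
    rw [hm]; exact Finset.sum_nonneg fun l _ => hn l x hx
  have hmiff : ∀ x ∈ P, m x = 0 ↔ ∀ l, l ≠ k → n l x = 0 := fun x hx => by
    rw [hm, Finset.sum_eq_zero_iff_of_nonneg fun l _ => hn l x hx]
    simp
  obtain ⟨hfin, hhull⟩ := convexHull_vertices hP
  have hface : {x ∈ P | m x = 0} = convexHull ℝ {x ∈ vertices P | m x = 0} := by
    conv_lhs => rw [← hhull]
    exact face_convexHull _ _ fun x hx => hm0 x (vertices_subset hx)
  have hvm : m v = 0 := (hmiff v (vertices_subset hvert)).2 fun l _ => hvn l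
  -- the face is not reduced to `v`, so it has another vertex; take the furthest one
  obtain ⟨x₀, hx₀, hx₀v⟩ : ∃ x ∈ {x ∈ vertices P | m x = 0}, x ≠ v := by
    by_contra! hall
    obtain ⟨ε, h1, h2⟩ := ((hloc e fun l => by
      rw [← hL, he, Pi.single_apply]; split_ifs <;> norm_num).and self_mem_nhdsWithin).exists
    have h2' : (0 : ℝ) < ε := h2
    have h3 : v + ε • e ∈ {x ∈ P | m x = 0} := by
      refine ⟨h1, (hmiff _ h1).2 fun l hl => ?_⟩
      rw [← hL, map_smul, he]; simp [hl]
    rw [hface] at h3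
    have h4 : v + ε • e = v := convexHull_min (t := {v}) hall (convex_singleton v) h3
    have h5 : e = 0 := by simpa [h2'.ne'] using h4
    rw [h5, map_zero] at he
    have := congrFun he k
    simp at this
  obtain ⟨x, hx, hmax⟩ := (hfin.subset
    (sep_subset (vertices P) fun x => m x = 0)).exists_maximalFor (n k) _ ⟨x₀, hx₀⟩
  have hzero : ∀ y ∈ {x ∈ vertices P | m x = 0}, ∀ l, l ≠ k → n l y = 0 := fun y hy =>
    (hmiff y (vertices_subset hy.1)).1 hy.2
  have hle : ∀ y ∈ {x ∈ vertices P | m x = 0}, n k y ≤ n k x := fun y hy => by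
    rcases le_total (n k y) (n k x) with h | h
    · exact h
    · exact hmax hy h
  have hpos : 0 < n k x := by
    refine lt_of_lt_of_le ((hn k x₀ (vertices_subset hx₀.1)).lt_of_ne fun h0 => hx₀v ?_)
      (hle x₀ hx₀)
    rw [hray x₀ (hzero x₀ hx₀), ← h0]; simp
  have hxv : x ≠ v := fun h => by rw [h, hvn] at hpos; exact lt_irrefl _ hpos
  refine ⟨x, hx.1, hxv, IsFace.of_affine m hm0 ?_, hpos, hzero x hx⟩
  apply Subset.antisymm
  · refine segment_subset_iff ℝ |>.2 fun a b ha hb hab => ?_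
    have := (hP.convex.inter (convex_zero m)) ⟨vertices_subset hvert, hvm⟩
      ⟨vertices_subset hx.1, hx.2⟩ ha hb hab
    exact this
  · rw [hface]
    refine convexHull_min (fun y hy => ?_) (convex_segment v x)
    have h1 := hray y (hzero y hy)
    have h2 := hray x (hzero x hx)
    have h3 := hn k y (vertices_subset hy.1)
    refine ⟨1 - n k y / n k x, n k y / n k x, ?_, by positivity, by ring, ?_⟩
    · rw [sub_nonneg, div_le_one hpos]; exact hle y hy
    · have h4 : n k y / n k x * n k x = n k y := div_mul_cancel₀ _ hpos.ne'
      have h5 : ∀ q r : ℝ, (1 - q) • v + q • (v + r • e) = v + (q * r) • e := fun q r => by module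
      have h6 := h5 (n k y / n k x) (n k x)
      rwa [← h2, h4, ← h1] at h6

/-- At a simple vertex `v` with neighbors `w_1, …, w_d`, the points `v, w_1, …, w_d` form an affine
basis whose coordinates at the `w_k` are the facet functionals at `v`. -/
theorem exists_vertex_basis (hd : 2 ≤ d) {P : Set (E d)} (hP : IsPolytope P) {v : E d}
    (hv : IsSimpleVertex P v) {w : Fin d → E d} (hw : IsNeighborList P v w) :
    ∃ b : AffineBasis (Option (Fin d)) ℝ (E d), b none = v ∧ (∀ k, b (some k) = w k) ∧
      (∀ x ∈ P, ∀ k, 0 ≤ b.coord (some k) x) ∧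
      ∀ k, vertexFacet P v w k = {x ∈ P | b.coord (some k) x = 0} := by
  classical
  obtain ⟨n, hn, hvn, hfac, hall, hloc⟩ := exists_vertex_functionals (by omega) hP hv
  choose x hx hxv hxe hxpos hxzero using exists_edge hP hv.1 hn hvn hloc
  obtain ⟨hwinj, hwrange⟩ := hw
  have hxr : ∀ k, ∃ j, w j = x k := fun k => by
    have : x k ∈ range w := by rw [hwrange]; exact ⟨hx k, hxv k, hxe k⟩
    exact this
  choose π hπ using hxr
  have hπinj : Function.Injective π := fun k l hkl => by
    by_contra hne
    have h1 : x k = x l := by rw [← hπ, ← hπ, hkl]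
    have h2 := hxpos k
    rw [h1, hxzero l k hne] at h2
    exact lt_irrefl _ h2
  have hπsurj : Function.Surjective π := Finite.surjective_of_injective hπinj
  choose σ hσ using hπsurj
  have hσinj : Function.Injective σ := fun j l h => by rw [← hσ j, ← hσ l, h]
  have hσsurj : Function.Surjective σ := Finite.surjective_of_injective hσinj
  have hwx : ∀ j, w j = x (σ j) := fun j => by rw [← hπ, hσ]
  have hpos : ∀ j, 0 < n (σ j) (w j) := fun j => by rw [hwx]; exact hxpos _
  have hzero : ∀ j l, l ≠ j → n (σ j) (w l) = 0 := fun j l hl => by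
    rw [hwx]; exact hxzero _ _ fun h => hl (hσinj h.symm)
  have hind : AffineIndependent ℝ w :=
    affineIndependent_of_dual (fun j => n (σ j)) (fun j => (hpos j).ne') hzero
  obtain ⟨m, hm⟩ := affineMap_sum Finset.univ fun j => (n (σ j) (w j))⁻¹ • n (σ j)
  obtain ⟨b, hb0, hb⟩ := exists_affineBasis_option hind
    (f := AffineMap.const ℝ _ 1 - m) (fun k => by
      simp only [AffineMap.coe_sub, Pi.sub_apply, AffineMap.const_apply, hm]
      rw [Finset.sum_eq_single k]
      · simp [(hpos k).ne']
      · intro j _ hj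
        simp [hzero j k hj.symm]
      · simp) (p := v) (by simp [hm, hvn])
  have hcoord : ∀ j y, b.coord (some j) y = (n (σ j) (w j))⁻¹ * n (σ j) y := fun j y => by
    rw [affineBasis_ext b (n := b.coord (some j)) (n' := (n (σ j) (w j))⁻¹ • n (σ j))]
    · simp
    · rw [AffineBasis.coord_apply, hb0]; simp [hvn]
    · intro l
      rw [AffineBasis.coord_apply, hb]
      rcases eq_or_ne l j with rfl | hl
      · simp [(hpos l).ne']
      · simp [hl.symm, hzero j l hl]
  have hset : ∀ j, {y ∈ P | b.coord (some j) y = 0} = {y ∈ P | n (σ j) y = 0} := fun j => by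
    ext y
    simp [hcoord, (hpos j).ne']
  refine ⟨b, hb0, hb, fun y hy j => ?_, fun k => ?_⟩
  · rw [hcoord]
    exact mul_nonneg (inv_nonneg.2 (hpos j).le) (hn _ y hy)
  · have hvP := vertices_subset hv.1
    have hseg : ∀ m j, segment ℝ v (w j) ⊆ {y ∈ P | n (σ m) y = 0} ↔ j ≠ m := fun m j => by
      constructor
      · rintro h rfl
        exact (hpos j).ne' (h (right_mem_segment ℝ v (w j))).2
      · intro h
        refine (hP.convex.inter (convex_zero (n (σ m)))).segment_subset ⟨hvP, hvn _⟩ ⟨?_, ?_⟩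
        · rw [hwx]; exact vertices_subset (hx _)
        · exact hzero m j h
    rw [hset]
    apply Subset.antisymm
    · refine sUnion_subset ?_
      rintro H ⟨hH, hHj⟩
      have : ∃ j : Fin d, j ≠ k := by
        have : Nontrivial (Fin d) := Fin.nontrivial_iff_two_le.2 hd
        exact exists_ne k
      obtain ⟨j, hj⟩ := this
      obtain ⟨l, hl⟩ := hall H hH ((hHj j).2 hj (left_mem_segment ℝ _ _))
      obtain ⟨m, rfl⟩ := hσsurj l
      have hmk : m = k := by
        by_contra hne
        have h1 := (hHj m).2 hne
        rw [hl, hseg] at h1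
        exact h1 rfl
      rw [hl, hmk]
    · exact fun y hy => mem_sUnion.2 ⟨_, ⟨hfac (σ k), hseg k⟩, hy⟩

/-! ### Coordinates at a simple vertex -/

/-- A simple vertex `v` of `P` with neighbors `w_1, …, w_d`, together with the affine basis
`v, w_1, …, w_d`. Its coordinates at the `w_k` are the functionals of the facets at `v`, and the
coordinate at `v` is positive on the side of `v` of the hyperplane through the neighbors. -/
structure VertexFrame (P : Set (E d)) (v : E d) (w : Fin d → E d)
    (b : AffineBasis (Option (Fin d)) ℝ (E d)) : Prop where
  polytope : IsPolytope P
  b_none : b none = v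
  b_some : ∀ k, b (some k) = w k
  b_vertex : ∀ o, b o ∈ vertices P
  coord_nonneg : ∀ x ∈ P, ∀ k, 0 ≤ b.coord (some k) x
  facet_eq : ∀ k, vertexFacet P v w k = {x ∈ P | b.coord (some k) x = 0}

theorem exists_vertexFrame (hd : 2 ≤ d) {P : Set (E d)} (hP : IsPolytope P) {v : E d}
    (hv : IsSimpleVertex P v) {w : Fin d → E d} (hw : IsNeighborList P v w) :
    ∃ b, VertexFrame P v w b := by
  obtain ⟨b, h1, h2, h3, h4⟩ := exists_vertex_basis hd hP hv hw
  refine ⟨b, hP, h1, h2, ?_, h3, h4⟩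
  rintro (_ | k)
  · rw [h1]; exact hv.1
  · rw [h2]
    have : w k ∈ range w := mem_range_self k
    rw [hw.2] at this
    exact this.1

section Basis

variable (b : AffineBasis (Option (Fin d)) ℝ (E d))

@[simp] theorem coord_none_none : b.coord none (b none) = 1 := b.coord_apply_eq none

@[simp] theorem coord_none_some (k : Fin d) : b.coord none (b (some k)) = 0 :=
  b.coord_apply_ne (by simp)

@[simp] theorem coord_some_none (k : Fin d) : b.coord (some k) (b none) = 0 :=
  b.coord_apply_ne (by simp)

theorem coord_some_some (k j : Fin d) : b.coord (some k) (b (some j)) = if k = j then 1 else 0 := by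
  rw [b.coord_apply]; simp

theorem mem_hull_basis {x : E d} (h0 : 0 ≤ b.coord none x) (h : ∀ k, 0 ≤ b.coord (some k) x) :
    x ∈ convexHull ℝ (range b) := by
  rw [b.convexHull_eq_nonneg_coord]
  rintro (_ | k)
  · exact h0
  · exact h k

/-- The convex hull `[b_k : k ∈ S]` in barycentric coordinates. -/
theorem mem_hullOf_basis {w : Fin d → E d} (hw : ∀ k, b (some k) = w k) {S : Finset (Fin d)}
    {x : E d} : x ∈ hullOf w S ↔
      b.coord none x = 0 ∧ (∀ k, 0 ≤ b.coord (some k) x) ∧ ∀ k ∉ S, b.coord (some k) x = 0 := by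
  constructor
  · intro hx
    refine ⟨?_, fun k => ?_, fun k hk => ?_⟩
    · refine convexHull_min (t := {x | b.coord none x = 0}) ?_ (convex_zero _) hx
      rintro _ ⟨k, -, rfl⟩
      simp [← hw]
    · refine nonneg_convexHull ?_ x hx
      rintro _ ⟨j, -, rfl⟩
      rw [← hw, coord_some_some]
      split_ifs <;> norm_num
    · refine convexHull_min (t := {x | b.coord (some k) x = 0}) ?_ (convex_zero _) hx
      rintro _ ⟨j, hj, rfl⟩
      have : k ≠ j := fun h => hk (h ▸ hj)
      simp [← hw, this]
  · rintro ⟨h0, h1, h2⟩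
    have hsum := b.sum_coord_apply_eq_one x
    have hx := b.linear_combination_coord_eq_self x
    rw [Fintype.sum_option, h0] at hsum hx
    rw [← hx, zero_smul, zero_add]
    rw [zero_add] at hsum
    rw [← Finset.sum_subset (Finset.subset_univ S) fun k _ hk => h2 k hk] at hsum
    rw [← Finset.sum_subset (Finset.subset_univ S) fun k _ hk => by rw [h2 k hk, zero_smul]]
    refine (convex_convexHull ℝ _).sum_mem (fun k _ => h1 k) hsum fun k hk => ?_
    exact subset_convexHull ℝ _ ⟨k, hk, (hw k).symm⟩

theorem mem_facetOf_basis {w : Fin d → E d} (hw : ∀ k, b (some k) = w k)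
    {x : E d} : x ∈ facetOf w ↔ b.coord none x = 0 ∧ ∀ k, 0 ≤ b.coord (some k) x := by
  rw [facetOf, mem_hullOf_basis b hw]
  simp

end Basis

namespace VertexFrame

variable {P : Set (E d)} {v : E d} {w : Fin d → E d} {b : AffineBasis (Option (Fin d)) ℝ (E d)}

theorem b_mem (D : VertexFrame P v w b) (o : Option (Fin d)) : b o ∈ P :=
  vertices_subset (D.b_vertex o)

theorem vertexInter_eq (D : VertexFrame P v w b) (S : Finset (Fin d)) :
    vertexInter P v w S = {x ∈ P | ∀ k ∈ S, b.coord (some k) x = 0} := by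
  ext x
  simp only [vertexInter, D.facet_eq, mem_inter_iff, mem_iInter, mem_ofPred_eq]
  exact ⟨fun hx => ⟨hx.1, fun k hk => (hx.2 k hk).2⟩,
    fun hx => ⟨hx.1, fun k hk => ⟨hx.1, hx.2 k hk⟩⟩⟩

theorem isFace_vertexInter (D : VertexFrame P v w b) (S : Finset (Fin d)) :
    IsFace P (vertexInter P v w S) := by
  obtain ⟨n, hn⟩ := affineMap_sum S fun k => b.coord (some k)
  refine IsFace.of_affine n (fun x hx => ?_) ?_
  · rw [hn]; exact Finset.sum_nonneg fun k _ => D.coord_nonneg x hx k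
  · rw [D.vertexInter_eq]
    ext x
    simp only [mem_ofPred_eq, hn, and_congr_right_iff]
    intro hx
    rw [Finset.sum_eq_zero_iff_of_nonneg fun k _ => D.coord_nonneg x hx k]

theorem v_mem_vertexInter (D : VertexFrame P v w b) (S : Finset (Fin d)) :
    v ∈ vertexInter P v w S := by
  rw [D.vertexInter_eq, ← D.b_none]
  exact ⟨D.b_mem _, fun k _ => by simp⟩

theorem w_mem_vertexInter (D : VertexFrame P v w b) {S : Finset (Fin d)} {j : Fin d} :
    w j ∈ vertexInter P v w S ↔ j ∉ S := by
  rw [D.vertexInter_eq, ← D.b_some]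
  simp [D.b_mem, coord_some_some]

theorem w_mem (D : VertexFrame P v w b) (j : Fin d) : w j ∈ P := D.b_some j ▸ D.b_mem _

theorem facetOf_subset (D : VertexFrame P v w b) : facetOf w ⊆ P := by
  rw [facetOf_eq]
  refine convexHull_min ?_ D.polytope.convex
  rintro _ ⟨j, rfl⟩
  exact D.w_mem j

theorem hull_basis_subset (D : VertexFrame P v w b) : convexHull ℝ (range b) ⊆ P := by
  refine convexHull_min ?_ D.polytope.convex
  rintro _ ⟨j, rfl⟩
  exact D.b_mem j

/-- The only vertices of `P` in the simplex `[v, w_1, …, w_d]` are its vertices. -/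
theorem vertex_in_basis (D : VertexFrame P v w b) {x : E d} (hx : x ∈ vertices P)
    (h0 : 0 ≤ b.coord none x) : ∃ o, b o = x := by
  have h1 := mem_hull_basis b h0 (D.coord_nonneg x (vertices_subset hx))
  have h2 := inter_extremePoints_subset_extremePoints_of_subset (𝕜 := ℝ) D.hull_basis_subset
    ⟨h1, mem_extremePoints_of_mem_vertices hx⟩
  have h3 : x ∈ range b := extremePoints_convexHull_subset h2
  exact h3

theorem coord_nonpos_of_vertex (D : VertexFrame P v w b) {x : E d} (hx : x ∈ vertices P)
    (hxv : x ≠ v) : b.coord none x ≤ 0 := by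
  by_contra! h
  obtain ⟨o, rfl⟩ := D.vertex_in_basis hx h.le
  cases o with
  | none => exact hxv D.b_none
  | some k => simp at h

/-- Removing a simple vertex cuts the polytope along the hyperplane through its neighbors. -/
theorem removeVertex_eq (D : VertexFrame P v w b) :
    removeVertex P v = {x ∈ P | b.coord none x ≤ 0} := by
  obtain ⟨hfin, hhull⟩ := convexHull_vertices D.polytope
  apply Subset.antisymm
  · refine convexHull_min ?_ (D.polytope.convex.inter (convex_nonpos _))
    rintro x ⟨hx, hxv⟩
    exact ⟨vertices_subset hx, D.coord_nonpos_of_vertex hx hxv⟩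
  · rintro y ⟨hy, hy0⟩
    by_contra hnot
    -- a functional separating `y` from the other vertices would have to be positive at `v` too
    obtain ⟨n, h1, h2⟩ := exists_affineMap_separating (convex_convexHull ℝ _)
      ((hfin.subset sdiff_subset).isClosed_convexHull ℝ) hnot
    have hw : ∀ k, 0 < n (b (some k)) := fun k => by
      refine h1 _ (subset_convexHull ℝ _ ⟨D.b_vertex _, ?_⟩)
      rw [← D.b_none]
      exact fun h => absurd (b.ind.injective h) (by simp)
    have hexp := affineBasis_expand b n y
    have hsum : 0 ≤ ∑ k, b.coord (some k) y * n (b (some k)) :=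
      Finset.sum_nonneg fun k _ => mul_nonneg (D.coord_nonneg y hy k) (hw k).le
    have hv : 0 < n (b none) := by
      by_contra! hle
      have := mul_nonneg_of_nonpos_of_nonpos hy0 hle
      linarith
    have : 0 ≤ n y := by
      refine nonneg_convexHull (s := vertices P) (fun x hx => ?_) y (hhull.symm ▸ hy)
      rcases eq_or_ne x v with rfl | hxv
      · rw [← D.b_none]; exact hv.le
      · exact (h1 x (subset_convexHull ℝ _ ⟨hx, hxv⟩)).le
    linarith

open Classical in
/-- The faces at a simple vertex are the intersections of the facets there. -/
theorem eq_vertexInter (D : VertexFrame P v w b) {B : Set (E d)} (hB : IsFace P B) (hv : v ∈ B) :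
    B = vertexInter P v w (Finset.univ.filter fun k => w k ∉ B) := by
  obtain ⟨n, hn, rfl⟩ := isFace_iff.1 hB
  rw [D.vertexInter_eq]
  ext x
  simp only [mem_ofPred_eq, and_congr_right_iff, Finset.mem_filter, Finset.mem_univ, true_and]
  intro hx
  rw [affineBasis_expand b n x, D.b_none, hv.2, mul_zero, zero_add,
    Finset.sum_eq_zero_iff_of_nonneg fun k _ =>
      mul_nonneg (D.coord_nonneg x hx k) (hn _ (D.b_mem _))]
  simp only [Finset.mem_univ, true_imp_iff, mul_eq_zero, D.b_some, D.w_mem, true_and]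
  exact forall_congr' fun k => by tauto

/-- The intersection of `P` with `⋂_{k ∈ S} H'_k` has the expected dimension. -/
theorem dim_vertexInter (D : VertexFrame P v w b) (S : Finset (Fin d)) :
    dim (vertexInter P v w S) = (d : ℤ) - S.card := by
  classical
  have hne : (vertexInter P v w S).Nonempty := ⟨v, D.v_mem_vertexInter S⟩
  let A : Finset (Option (Fin d)) := (S.image some)ᶜ
  have hA : A.card = d - S.card + 1 := by
    rw [Finset.card_compl, Finset.card_image_of_injective _ (Option.some_injective _)]
    have := S.card_le_univ
    simp only [Fintype.card_option, Fintype.card_fin] at this ⊢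
    omega
  have hspan : affineSpan ℝ (vertexInter P v w S) =
      affineSpan ℝ (b '' (A : Set (Option (Fin d)))) := by
    apply le_antisymm
    · rw [affineSpan_le]
      intro x hx
      rw [D.vertexInter_eq] at hx
      rw [SetLike.mem_coe, ← b.affineCombination_coord_eq_self x]
      refine affineCombination_mem_affineSpan_image (b.sum_coord_apply_eq_one x) ?_ b
      intro o _ ho
      have : o ∈ S.image some := by simpa [A] using ho
      obtain ⟨k, hk, rfl⟩ := Finset.mem_image.1 this
      exact hx.2 k hk
    · refine affineSpan_mono ℝ ?_
      rintro _ ⟨o, ho, rfl⟩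
      cases o with
      | none => rw [D.b_none]; exact D.v_mem_vertexInter S
      | some k => rw [D.b_some, D.w_mem_vertexInter]; simpa [A] using ho
  have h1 := b.ind.finrank_vectorSpan_image_finset hA
  rw [Finset.coe_image] at h1
  rw [dim_of_nonempty hne, ← direction_affineSpan, hspan, direction_affineSpan, h1]
  have := S.card_le_univ
  simp only [Fintype.card_fin] at this
  omega

/-- In a `(d-i)`-simplicial polytope, the faces of dimension at most `d - i` at `v` are simplices
spanned by `v` and its neighbors, so they lie on the side of `v`. -/
theorem coord_nonneg_of_simplicial (D : VertexFrame P v w b) {i : ℕ} (hid : i ≤ d)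
    (hsimp : IsSimplicial (d - i) P) {T : Finset (Fin d)} (hT : T.card + i ≤ d) {x : E d}
    (hx : x ∈ P) (h0 : ∀ k ∉ T, b.coord (some k) x = 0) : 0 ≤ b.coord none x := by
  classical
  obtain ⟨T', hTT', -, hT'⟩ := Finset.exists_subsuperset_card_eq (Finset.subset_univ T)
    (n := d - i) (by omega) (by simp)
  obtain ⟨p, -, hp⟩ := hsimp _ (D.isFace_vertexInter T'ᶜ) (by
    rw [D.dim_vertexInter, Finset.card_compl, Fintype.card_fin]
    omega)
  have hxB : x ∈ vertexInter P v w T'ᶜ := by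
    rw [D.vertexInter_eq]
    exact ⟨hx, fun k hk => h0 k fun h => (Finset.mem_compl.1 hk) (hTT' h)⟩
  let A : Finset (Option (Fin d)) := insert none (T'.image some)
  have hA : A.card = d - i + 1 := by
    rw [Finset.card_insert_of_notMem (by simp), Finset.card_image_of_injective _
      (Option.some_injective _), hT']
  have hsub : A.image b ⊆ Finset.univ.image p := by
    intro y hy
    obtain ⟨o, ho, rfl⟩ := Finset.mem_image.1 hy
    have hoB : b o ∈ vertexInter P v w T'ᶜ := by
      cases o with
      | none => rw [D.b_none]; exact D.v_mem_vertexInter _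
      | some k => rw [D.b_some, D.w_mem_vertexInter]; simpa [A] using ho
    have h2 := inter_extremePoints_subset_extremePoints_of_subset (𝕜 := ℝ)
      (D.isFace_vertexInter T'ᶜ).subset ⟨hoB, mem_extremePoints_of_mem_vertices (D.b_vertex o)⟩
    rw [hp] at h2
    simpa using extremePoints_convexHull_subset h2
  have heq := Finset.eq_of_subset_of_card_le hsub (by
    rw [Finset.card_image_of_injective _ b.ind.injective, hA]
    exact Finset.card_image_le.trans (by simp))
  rw [hp] at hxB
  refine nonneg_convexHull (n := b.coord none) ?_ x hxB
  rintro _ ⟨j, rfl⟩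
  have : p j ∈ A.image b := by rw [heq]; simp
  obtain ⟨o, -, ho⟩ := Finset.mem_image.1 this
  rw [← ho]
  cases o <;> simp

/-- In a `(d-i)`-simplicial polytope, at most `d - i` neighbors of a simple vertex span a face. -/
theorem isFace_hullOf (D : VertexFrame P v w b) {i : ℕ} (hid : i ≤ d)
    (hsimp : IsSimplicial (d - i) P) {S : Finset (Fin d)} (hS : S.card + i ≤ d) :
    IsFace P (hullOf w S) := by
  obtain ⟨hfin, hhull⟩ := convexHull_vertices D.polytope
  obtain ⟨q, hq⟩ := affineMap_sum Sᶜ fun k => b.coord (some k)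
  have hq0 : ∀ x ∈ P, 0 ≤ q x := fun x hx => by
    rw [hq]; exact Finset.sum_nonneg fun k _ => D.coord_nonneg x hx k
  have hqiff : ∀ x ∈ P, q x = 0 ↔ ∀ k ∉ S, b.coord (some k) x = 0 := fun x hx => by
    rw [hq, Finset.sum_eq_zero_iff_of_nonneg fun k _ => D.coord_nonneg x hx k]
    simp
  have hqc : ∀ x ∈ P, q x = 0 → 0 ≤ b.coord none x := fun x hx h =>
    D.coord_nonneg_of_simplicial hid hsimp hS hx ((hqiff x hx).1 h)
  -- `[v, w_k : k ∈ S]` is the face `q = 0`; tilt its hyperplane slightly away from `v`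
  obtain ⟨N, hN⟩ := (hfin.image fun x => - b.coord none x / q x).bddAbove
  let g : E d →ᵃ[ℝ] ℝ := b.coord none + (N + 1) • q
  have hg : ∀ x, g x = b.coord none x + (N + 1) * q x := fun x => by simp [g]
  have hpos : ∀ x ∈ vertices P, q x ≠ 0 → 0 < g x := fun x hx hqx => by
    have h1 : 0 < q x := (hq0 x (vertices_subset hx)).lt_of_ne (Ne.symm hqx)
    have h2 : - b.coord none x / q x ≤ N := hN ⟨x, hx, rfl⟩
    rw [div_le_iff₀ h1] at h2
    rw [hg]
    linarith
  have hnn : ∀ x ∈ vertices P, 0 ≤ g x := fun x hx => by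
    by_cases hqx : q x = 0
    · rw [hg, hqx, mul_zero, add_zero]; exact hqc x (vertices_subset hx) hqx
    · exact (hpos x hx hqx).le
  refine IsFace.of_affine g (fun x hx => nonneg_convexHull hnn x (hhull.symm ▸ hx)) ?_
  conv_rhs => rw [← hhull]
  rw [face_convexHull _ _ hnn, hullOf]
  congr 1
  ext x
  constructor
  · rintro ⟨k, hk, rfl⟩
    have h1 : q (w k) = 0 := by
      refine (hqiff _ (D.w_mem k)).2 fun j hj => ?_
      have : j ≠ k := fun h => hj (h ▸ hk)
      rw [← D.b_some, coord_some_some, if_neg this]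
    have h2 : w k ∈ vertices P := D.b_some k ▸ D.b_vertex (some k)
    have h3 : b.coord none (w k) = 0 := by rw [← D.b_some]; simp
    exact ⟨h2, by rw [hg, h1, h3]; simp⟩
  · rintro ⟨hx, h0⟩
    have hqx : q x = 0 := by
      by_contra h
      exact (hpos x hx h).ne' h0
    rw [hg, hqx, mul_zero, add_zero] at h0
    obtain ⟨o, rfl⟩ := D.vertex_in_basis hx h0.ge
    cases o with
    | none => simp at h0
    | some k =>
      refine ⟨k, ?_, (D.b_some k).symm⟩
      by_contra hk
      have := (hqiff _ (D.b_mem _)).1 hqx k hk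
      rw [coord_some_some] at this
      simp at this

open Classical in
theorem eq_hullOf (D : VertexFrame P v w b) {B : Set (E d)} (hB : IsFace P B)
    (hBF : B ⊆ facetOf w) : B = hullOf w (Finset.univ.filter fun k => w k ∈ B) := by
  obtain ⟨n, hn, rfl⟩ := isFace_iff.1 hB
  rw [← facetOf_inter_zero (n := n) (fun k => hn _ (D.w_mem k)) (fun k => by simp [D.w_mem])]
  apply Subset.antisymm
  · exact fun x hx => ⟨hBF hx, hx.2⟩
  · rintro x ⟨hx, h0⟩
    exact ⟨D.facetOf_subset hx, h0⟩

theorem v_notMem_facetOf (D : VertexFrame P v w b) : v ∉ facetOf w := fun h => by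
  have := ((mem_facetOf_basis b D.b_some).1 h).1
  rw [← D.b_none] at this
  simp at this

end VertexFrame

/-! ### Faces of the merge -/

/-- Two convex sets in position for merging, in the coordinates of the simplex `[v, w_1, …, w_d]`:
a polytope `R` with the simple vertex `v` and a convex subset `Q` of the simplex that contains the
facet `[w_1, …, w_d]` and for which the facets of the simplex at `v` intersect off that facet as
they do for an `i`-simple polytope. -/
structure MergeFrame (i : ℕ) (Q R : Set (E d)) (v : E d) (w : Fin d → E d)
    (b : AffineBasis (Option (Fin d)) ℝ (E d)) : Prop where
  frame : VertexFrame R v w b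
  lt : i < d
  simplicial : IsSimplicial (d - i) R
  convex_Q : Convex ℝ Q
  coord_nonneg_Q : ∀ x ∈ Q, ∀ o, 0 ≤ b.coord o x
  w_mem_Q : ∀ k, w k ∈ Q
  exists_off : ∀ T : Finset (Fin d), d ≤ T.card + i →
    ∃ z ∈ Q, (∀ k ∉ T, b.coord (some k) z = 0) ∧ 0 < b.coord none z

/-- The faces of the merge that come from both polytopes. -/
def jointFace (b : AffineBasis (Option (Fin d)) ℝ (E d)) (Q R : Set (E d)) (v : E d)
    (S : Finset (Fin d)) : Set (E d) :=
  {x ∈ Q ∪ removeVertex R v | ∀ k ∈ S, b.coord (some k) x = 0}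

namespace MergeFrame

variable {i : ℕ} {Q R : Set (E d)} {v : E d} {w : Fin d → E d}
  {b : AffineBasis (Option (Fin d)) ℝ (E d)}

theorem facetOf_subset_Q (D : MergeFrame i Q R v w b) : facetOf w ⊆ Q := by
  rw [facetOf_eq]
  refine convexHull_min ?_ D.convex_Q
  rintro _ ⟨j, rfl⟩
  exact D.w_mem_Q j

theorem mem_remove (D : MergeFrame i Q R v w b) {x : E d} :
    x ∈ removeVertex R v ↔ x ∈ R ∧ b.coord none x ≤ 0 := by
  rw [D.frame.removeVertex_eq]; rfl

theorem facetOf_subset_remove (D : MergeFrame i Q R v w b) : facetOf w ⊆ removeVertex R v :=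
  fun _ hx => D.mem_remove.2
    ⟨D.frame.facetOf_subset hx, ((mem_facetOf_basis b D.frame.b_some).1 hx).1.le⟩

theorem mem_facetOf_of_Q (D : MergeFrame i Q R v w b) {x : E d} (hx : x ∈ Q)
    (h0 : b.coord none x ≤ 0) : x ∈ facetOf w :=
  (mem_facetOf_basis b D.frame.b_some).2
    ⟨le_antisymm h0 (D.coord_nonneg_Q x hx none), fun _ => D.coord_nonneg_Q x hx _⟩

theorem mem_facetOf_of_R (D : MergeFrame i Q R v w b) {x : E d} (hx : x ∈ R)
    (h0 : b.coord none x = 0) : x ∈ facetOf w :=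
  (mem_facetOf_basis b D.frame.b_some).2 ⟨h0, D.frame.coord_nonneg x hx⟩

theorem coord_nonneg (D : MergeFrame i Q R v w b) {x : E d} (hx : x ∈ Q ∪ removeVertex R v)
    (k : Fin d) : 0 ≤ b.coord (some k) x := by
  rcases hx with hx | hx
  · exact D.coord_nonneg_Q x hx _
  · exact D.frame.coord_nonneg x (D.mem_remove.1 hx).1 k

/-- A segment from `Q` to the truncated polytope crosses the facet `[w_1, …, w_d]`. -/
theorem convex_union (D : MergeFrame i Q R v w b) : Convex ℝ (Q ∪ removeVertex R v) := by
  have hR' : Convex ℝ (removeVertex R v) := convex_convexHull ℝ _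
  have key : ∀ x ∈ Q, ∀ y ∈ removeVertex R v, segment ℝ x y ⊆ Q ∪ removeVertex R v := by
    intro x hx y hy
    rcases le_or_gt (b.coord none x) 0 with hx0 | hx0
    · exact (hR'.segment_subset (D.facetOf_subset_remove (D.mem_facetOf_of_Q hx hx0)) hy).trans
        subset_union_right
    obtain ⟨hyR, hy0⟩ := D.mem_remove.1 hy
    set α := b.coord none x
    set β := b.coord none y with hβ
    have hαβ : 0 < α - β := by linarith
    let s := α / (α - β)
    let m := (1 - s) • x + s • y
    have hs0 : 0 < s := div_pos hx0 hαβ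
    have hs1 : 0 ≤ 1 - s := by
      have : s ≤ 1 := (div_le_one hαβ).2 (by linarith)
      linarith
    have hsαβ : s * (α - β) = α := div_mul_cancel₀ _ hαβ.ne'
    have hm : m ∈ facetOf w := by
      rw [mem_facetOf_basis b D.frame.b_some]
      constructor
      · rw [affineMap_combo _ _ _ _ _ (by ring)]
        linear_combination -hsαβ
      · intro k
        rw [affineMap_combo _ _ _ _ _ (by ring)]
        have h1 := D.coord_nonneg_Q x hx (some k)
        have h2 := D.frame.coord_nonneg y hyR k
        positivity
    rw [segment_eq_image]
    rintro _ ⟨t, ⟨ht0, ht1⟩, rfl⟩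
    rcases le_or_gt t s with hts | hts
    · left
      have hq0 : 0 ≤ t / s := by positivity
      have hq1 : t / s ≤ 1 := (div_le_one hs0).2 hts
      have hq : t / s * s = t := div_mul_cancel₀ _ hs0.ne'
      have := D.convex_Q hx (D.facetOf_subset_Q hm) (sub_nonneg.2 hq1) hq0 (by ring)
      convert this using 1
      have h1 : ∀ q : ℝ, (1 - q) • x + q • m = (1 - q * s) • x + (q * s) • y := fun q => by
        simp only [m]; module
      rw [h1, hq]
    · right
      have hs1' : 0 < 1 - s := by linarith
      set q := (t - s) / (1 - s) with hqdef
      have hq0 : 0 ≤ q := div_nonneg (by linarith) hs1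
      have hq1 : q ≤ 1 := (div_le_one hs1').2 (by linarith)
      have hq : q * (1 - s) = t - s := div_mul_cancel₀ _ hs1'.ne'
      have := hR' (D.facetOf_subset_remove hm) hy (sub_nonneg.2 hq1) hq0 (by ring)
      convert this using 1
      have h1 : ∀ q : ℝ,
          (1 - q) • m + q • y = (1 - (q * (1 - s) + s)) • x + (q * (1 - s) + s) • y :=
        fun q => by simp only [m]; module
      rw [h1, hq]
      congr 2
      ring
  rw [convex_iff_segment_subset]
  rintro x (hx | hx) y (hy | hy)
  · exact (D.convex_Q.segment_subset hx hy).trans subset_union_left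
  · exact key x hx y hy
  · rw [segment_symm]; exact key y hy x hx
  · exact (hR'.segment_subset hx hy).trans subset_union_right

/-- A functional that is nonnegative at the `w_k` and nonpositive at `v` is nonnegative beyond the
hyperplane through the `w_k`. -/
theorem nonneg_remove (D : MergeFrame i Q R v w b) {n : E d →ᵃ[ℝ] ℝ} (hw : ∀ k, 0 ≤ n (w k))
    (hv : n v ≤ 0) {y : E d} (hy : y ∈ removeVertex R v) : 0 ≤ n y := by
  obtain ⟨hyR, hy0⟩ := D.mem_remove.1 hy
  rw [affineBasis_expand b n y, D.frame.b_none]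
  refine add_nonneg (mul_nonneg_of_nonpos_of_nonpos hy0 hv) (Finset.sum_nonneg fun k _ => ?_)
  rw [D.frame.b_some]
  exact mul_nonneg (D.frame.coord_nonneg y hyR k) (hw k)

theorem coord_eq_zero_of_remove (D : MergeFrame i Q R v w b) {n : E d →ᵃ[ℝ] ℝ}
    (hw : ∀ k, 0 ≤ n (w k)) (hv : n v ≤ 0) {y : E d} (hy : y ∈ removeVertex R v) (h0 : n y = 0)
    {k : Fin d} (hk : n (w k) ≠ 0) : b.coord (some k) y = 0 := by
  obtain ⟨hyR, hy0⟩ := D.mem_remove.1 hy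
  rw [affineBasis_expand b n y, D.frame.b_none] at h0
  simp only [D.frame.b_some] at h0
  have h1 : ∀ k, 0 ≤ b.coord (some k) y * n (w k) := fun k =>
    mul_nonneg (D.frame.coord_nonneg y hyR k) (hw k)
  have h2 := mul_nonneg_of_nonpos_of_nonpos hy0 hv
  have h3 := Finset.sum_nonneg fun k (_ : k ∈ Finset.univ) => h1 k
  have h4 := (Finset.sum_eq_zero_iff_of_nonneg fun k _ => h1 k).1 (by linarith) k
    (Finset.mem_univ k)
  exact (mul_eq_zero.1 h4).resolve_right hk

/-- With few zeros among the `w_k`, a functional as in `nonneg_remove` vanishes in the truncated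
polytope only on `[w_1, …, w_d]`, because the face of `R` at `v` in question is a simplex. -/
theorem mem_facetOf_of_few (D : MergeFrame i Q R v w b) {n : E d →ᵃ[ℝ] ℝ} (hw : ∀ k, 0 ≤ n (w k))
    (hv : n v ≤ 0) {T : Finset (Fin d)} (hT : ∀ k, n (w k) = 0 → k ∈ T) (hcard : T.card + i ≤ d)
    {y : E d} (hy : y ∈ removeVertex R v) (h0 : n y = 0) : y ∈ facetOf w := by
  obtain ⟨hyR, hy0⟩ := D.mem_remove.1 hy
  refine D.mem_facetOf_of_R hyR (le_antisymm hy0 ?_)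
  refine D.frame.coord_nonneg_of_simplicial D.lt.le D.simplicial hcard hyR fun k hk => ?_
  exact D.coord_eq_zero_of_remove hw hv hy h0 fun h => hk (hT k h)

/-- Nonnegativity on the simplex. -/
theorem nonneg_of_coord_nonneg (D : MergeFrame i Q R v w b) {n : E d →ᵃ[ℝ] ℝ}
    (hw : ∀ k, 0 ≤ n (w k)) (hv : 0 ≤ n v) {y : E d} (hy : ∀ o, 0 ≤ b.coord o y) : 0 ≤ n y := by
  rw [affineBasis_expand b n y, D.frame.b_none]
  refine add_nonneg (mul_nonneg (hy _) hv) (Finset.sum_nonneg fun k _ => ?_)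
  rw [D.frame.b_some]
  exact mul_nonneg (hy _) (hw k)

theorem coord_none_eq_zero (D : MergeFrame i Q R v w b) {n : E d →ᵃ[ℝ] ℝ}
    (hw : ∀ k, 0 ≤ n (w k)) (hv : 0 < n v) {y : E d} (hy : ∀ o, 0 ≤ b.coord o y) (h0 : n y = 0) :
    b.coord none y = 0 := by
  rw [affineBasis_expand b n y, D.frame.b_none] at h0
  have h1 : 0 ≤ ∑ k, b.coord (some k) y * n (b (some k)) := Finset.sum_nonneg fun k _ => by
    rw [D.frame.b_some]
    exact mul_nonneg (hy _) (hw k)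
  have h2 := mul_nonneg (hy none) hv.le
  have h3 : b.coord none y * n v = 0 := by linarith
  exact (mul_eq_zero.1 h3).resolve_right hv.ne'

theorem nonneg_R (D : MergeFrame i Q R v w b) {n : E d →ᵃ[ℝ] ℝ}
    (hn : ∀ x ∈ Q ∪ removeVertex R v, 0 ≤ n x) (hv : 0 ≤ n v) {y : E d} (hy : y ∈ R) :
    0 ≤ n y := by
  rcases le_or_gt (b.coord none y) 0 with h | h
  · exact hn y (Or.inr (D.mem_remove.2 ⟨hy, h⟩))
  · refine D.nonneg_of_coord_nonneg (fun k => hn _ (Or.inl (D.w_mem_Q k))) hv ?_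
    rintro (_ | k)
    · exact h.le
    · exact D.frame.coord_nonneg y hy k

/-- A face of `R` off `v` lies in the truncated polytope. -/
theorem subset_remove (D : MergeFrame i Q R v w b) {n : E d →ᵃ[ℝ] ℝ} (hn : ∀ x ∈ R, 0 ≤ n x)
    (hv : 0 < n v) {y : E d} (hy : y ∈ R) (h0 : n y = 0) : y ∈ removeVertex R v := by
  refine D.mem_remove.2 ⟨hy, ?_⟩
  by_contra! h
  refine h.ne' (D.coord_none_eq_zero (fun k => hn _ (D.frame.w_mem k)) hv ?_ h0)
  rintro (_ | k)
  · exact h.le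
  · exact D.frame.coord_nonneg y hy k

theorem sep_eq_of_pos (D : MergeFrame i Q R v w b) {n : E d →ᵃ[ℝ] ℝ} (hn : ∀ x ∈ R, 0 ≤ n x)
    (hv : 0 < n v) : {x ∈ Q ∪ removeVertex R v | n x = 0} = {x ∈ R | n x = 0} := by
  ext x
  constructor
  · rintro ⟨hx | hx, h0⟩
    · have h1 := D.coord_none_eq_zero (fun k => hn _ (D.frame.w_mem k)) hv
        (D.coord_nonneg_Q x hx) h0
      exact ⟨D.frame.facetOf_subset (D.mem_facetOf_of_Q hx h1.le), h0⟩
    · exact ⟨(D.mem_remove.1 hx).1, h0⟩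
  · rintro ⟨hx, h0⟩
    exact ⟨Or.inr (D.subset_remove hn hv hx h0), h0⟩

theorem isFace_of_pos (D : MergeFrame i Q R v w b) {n : E d →ᵃ[ℝ] ℝ} (hn : ∀ x ∈ R, 0 ≤ n x)
    (hv : 0 < n v) : IsFace (Q ∪ removeVertex R v) {x ∈ R | n x = 0} := by
  refine IsFace.of_affine n ?_ (D.sep_eq_of_pos hn hv).symm
  rintro x (hx | hx)
  · exact D.nonneg_of_coord_nonneg (fun k => hn _ (D.frame.w_mem k)) hv.le (D.coord_nonneg_Q x hx)
  · exact hn x (D.mem_remove.1 hx).1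

/-- The faces of `R` off `v` are faces of the merge. -/
theorem isFace_of_frame_face (D : MergeFrame i Q R v w b) {B : Set (E d)} (hB : IsFace R B)
    (hv : v ∉ B) : IsFace (Q ∪ removeVertex R v) B := by
  obtain ⟨n, hn, rfl⟩ := isFace_iff.1 hB
  have hvR : v ∈ R := D.frame.b_none ▸ D.frame.b_mem none
  exact D.isFace_of_pos hn ((hn v hvR).lt_of_ne fun h => hv ⟨hvR, h.symm⟩)

theorem face_subset_remove (D : MergeFrame i Q R v w b) {B : Set (E d)} (hB : IsFace R B)
    (hv : v ∉ B) : B ⊆ removeVertex R v := by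
  obtain ⟨n, hn, rfl⟩ := isFace_iff.1 hB
  have hvR : v ∈ R := D.frame.b_none ▸ D.frame.b_mem none
  exact fun x hx => D.subset_remove hn ((hn v hvR).lt_of_ne fun h => hv ⟨hvR, h.symm⟩) hx.1 hx.2

theorem isFace_joint (D : MergeFrame i Q R v w b) (S : Finset (Fin d)) :
    IsFace (Q ∪ removeVertex R v) (jointFace b Q R v S) := by
  obtain ⟨n, hn⟩ := affineMap_sum S fun k => b.coord (some k)
  refine IsFace.of_affine n (fun x hx => ?_) ?_
  · rw [hn]; exact Finset.sum_nonneg fun k _ => D.coord_nonneg hx k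
  · ext x
    simp only [jointFace, mem_ofPred_eq, hn, and_congr_right_iff]
    intro hx
    rw [Finset.sum_eq_zero_iff_of_nonneg fun k _ => D.coord_nonneg hx k]

/-- A functional that is nonnegative on `Q` and vanishes at many of the `w_k` is nonnegative
at `v`. -/
theorem nonneg_v_of_many (D : MergeFrame i Q R v w b) {n : E d →ᵃ[ℝ] ℝ} (hn : ∀ x ∈ Q, 0 ≤ n x)
    {T : Finset (Fin d)} (hT : ∀ k ∈ T, n (w k) = 0) (hcard : d ≤ T.card + i) : 0 ≤ n v := by
  obtain ⟨z, hz, h1, h2⟩ := D.exists_off T hcard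
  have h3 := hn z hz
  rw [affineBasis_expand b n z, Finset.sum_eq_zero, add_zero, D.frame.b_none] at h3
  · exact nonneg_of_mul_nonneg_right h3 h2
  · intro k _
    by_cases hk : k ∈ T
    · rw [D.frame.b_some, hT k hk, mul_zero]
    · rw [h1 k hk, zero_mul]

theorem zero_iff_of_v (D : MergeFrame i Q R v w b) {n : E d →ᵃ[ℝ] ℝ} (hn : ∀ k, 0 ≤ n (w k))
    (hv : n v = 0) {S : Finset (Fin d)} (hS : ∀ k, k ∈ S ↔ n (w k) ≠ 0) {x : E d}
    (hx : ∀ k, 0 ≤ b.coord (some k) x) : n x = 0 ↔ ∀ k ∈ S, b.coord (some k) x = 0 := by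
  rw [affineBasis_expand b n x, D.frame.b_none, hv, mul_zero, zero_add,
    Finset.sum_eq_zero_iff_of_nonneg fun k _ => by
      rw [D.frame.b_some]; exact mul_nonneg (hx k) (hn k)]
  simp only [Finset.mem_univ, true_imp_iff, mul_eq_zero, D.frame.b_some, hS]
  exact forall_congr' fun k => by tauto

/-- A face of `Q` with few of the `w_k` that is nonpositive at `v` is a face of the merge. -/
theorem sep_eq_of_few (D : MergeFrame i Q R v w b) {n : E d →ᵃ[ℝ] ℝ} (hn : ∀ x ∈ Q, 0 ≤ n x)
    (hv : n v ≤ 0) {T : Finset (Fin d)} (hT : ∀ k, n (w k) = 0 → k ∈ T) (hcard : T.card + i ≤ d) :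
    {x ∈ Q ∪ removeVertex R v | n x = 0} = {x ∈ Q | n x = 0} := by
  ext x
  constructor
  · rintro ⟨hx | hx, h0⟩
    · exact ⟨hx, h0⟩
    · exact ⟨D.facetOf_subset_Q
        (D.mem_facetOf_of_few (fun k => hn _ (D.w_mem_Q k)) hv hT hcard hx h0), h0⟩
  · rintro ⟨hx, h0⟩
    exact ⟨Or.inl hx, h0⟩

/-- A face of `Q` off `[w_1, …, w_d]` is either an intersection of facets of the simplex at `v`, or
it has few of the `w_k` and is a face of the merge. -/
theorem isFace_of_Q_face (D : MergeFrame i Q R v w b) {B : Set (E d)} (hB : IsFace Q B)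
    (hBF : ¬ B ⊆ facetOf w) :
    (∃ S : Finset (Fin d), S.card ≤ i ∧ B = {x ∈ Q | ∀ k ∈ S, b.coord (some k) x = 0}) ∨
    ((∃ T : Finset (Fin d), (∀ k, k ∈ T ↔ w k ∈ B) ∧ T.card + i < d) ∧
      IsFace (Q ∪ removeVertex R v) B) := by
  obtain ⟨n, hn, rfl⟩ := isFace_iff.1 hB
  obtain ⟨z, ⟨hzQ, hz0⟩, hzF⟩ := not_subset.1 hBF
  have hw : ∀ k, 0 ≤ n (w k) := fun k => hn _ (D.w_mem_Q k)
  have hz : b.coord none z ≠ 0 := fun h => hzF (D.mem_facetOf_of_Q hzQ h.le)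
  have hv : n v ≤ 0 := by
    by_contra! h
    exact hz (D.coord_none_eq_zero hw h (D.coord_nonneg_Q z hzQ) hz0)
  obtain ⟨T, hTmem⟩ : ∃ T : Finset (Fin d), ∀ k, k ∈ T ↔ n (w k) = 0 :=
    ⟨Finset.univ.filter fun k => n (w k) = 0, by simp⟩
  rcases lt_or_ge (T.card + i) d with hlt | hge
  · right
    refine ⟨⟨T, fun k => by simp [hTmem, D.w_mem_Q], hlt⟩, IsFace.of_affine n ?_
      (D.sep_eq_of_few hn hv (fun k => (hTmem k).2) hlt.le).symm⟩
    rintro x (hx | hx)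
    · exact hn x hx
    · exact D.nonneg_remove hw hv hx
  · left
    have hv0 : n v = 0 := le_antisymm hv (D.nonneg_v_of_many hn (fun k => (hTmem k).1) hge)
    refine ⟨Tᶜ, by rw [Finset.card_compl, Fintype.card_fin]; omega, ?_⟩
    ext x
    simp only [mem_ofPred_eq, and_congr_right_iff]
    intro hx
    exact D.zero_iff_of_v hw hv0 (fun k => by rw [Finset.mem_compl, hTmem])
      fun k => D.coord_nonneg_Q x hx _

/-- Every face of the merge is a joint face, a face of `Q`, or a face of `R`. -/
theorem face_cases (D : MergeFrame i Q R v w b) {B : Set (E d)}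
    (hB : IsFace (Q ∪ removeVertex R v) B) :
    (∃ S : Finset (Fin d), S.card ≤ i ∧ B = jointFace b Q R v S) ∨
    (IsFace Q B ∧ ∃ T : Finset (Fin d), (∀ k, k ∈ T ↔ w k ∈ B) ∧ T.card + i < d) ∨
    (IsFace R B ∧ v ∉ B) := by
  obtain ⟨n, hn, rfl⟩ := isFace_iff.1 hB
  have hnQ : ∀ x ∈ Q, 0 ≤ n x := fun x hx => hn x (Or.inl hx)
  have hw : ∀ k, 0 ≤ n (w k) := fun k => hnQ _ (D.w_mem_Q k)
  rcases lt_or_ge 0 (n v) with hv | hv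
  · right; right
    have hnR : ∀ x ∈ R, 0 ≤ n x := fun x hx => D.nonneg_R hn hv.le hx
    rw [D.sep_eq_of_pos hnR hv]
    exact ⟨IsFace.of_affine n hnR rfl, fun h => hv.ne' h.2⟩
  · obtain ⟨T, hTmem⟩ : ∃ T : Finset (Fin d), ∀ k, k ∈ T ↔ n (w k) = 0 :=
      ⟨Finset.univ.filter fun k => n (w k) = 0, by simp⟩
    rcases lt_or_ge (T.card + i) d with hlt | hge
    · right; left
      refine ⟨?_, T, fun k => by simp [hTmem, D.w_mem_Q], hlt⟩
      rw [D.sep_eq_of_few hnQ hv (fun k => (hTmem k).2) hlt.le]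
      exact IsFace.of_affine n hnQ rfl
    · left
      have hv0 : n v = 0 := le_antisymm hv (D.nonneg_v_of_many hnQ (fun k => (hTmem k).1) hge)
      refine ⟨Tᶜ, by rw [Finset.card_compl, Fintype.card_fin]; omega, ?_⟩
      ext x
      simp only [jointFace, mem_ofPred_eq, and_congr_right_iff]
      intro hx
      exact D.zero_iff_of_v hw hv0 (fun k => by rw [Finset.mem_compl, hTmem])
        fun k => D.coord_nonneg hx k

end MergeFrame

/-! ### Projective maps -/

theorem eq_of_affine {x y : E d} (h : ∀ g : E d →ᵃ[ℝ] ℝ, g x = g y) : x = y := by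
  obtain ⟨g, hg⟩ := exists_affineMap_inner (x - y) 0
  have := h g
  rw [hg, hg, add_zero, add_zero, ← sub_eq_zero, ← inner_sub_right, inner_self_eq_zero] at this
  exact sub_eq_zero.1 this

/-- The linear functional on `ℝ^d × ℝ` that extends an affine functional on `ℝ^d × {1}`. -/
theorem exists_homogenization (g : E d →ᵃ[ℝ] ℝ) :
    ∃ Λ : (E d × ℝ) →ₗ[ℝ] ℝ, ∀ x, Λ (x, 1) = g x := by
  refine ⟨g.linear ∘ₗ LinearMap.fst ℝ (E d) ℝ + g 0 • LinearMap.snd ℝ (E d) ℝ, fun x => ?_⟩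
  have := g.map_vadd 0 x
  simp only [vadd_eq_add, add_zero] at this
  simp [this]

theorem exists_dehomogenization (Λ : (E d × ℝ) →ₗ[ℝ] ℝ) :
    ∃ g : E d →ᵃ[ℝ] ℝ, ∀ x, g x = Λ (x, 1) := by
  refine ⟨(Λ ∘ₗ LinearMap.inl ℝ (E d) ℝ).toAffineMap + AffineMap.const ℝ _ (Λ (0, 1)), fun x => ?_⟩
  have : ((x, 1) : E d × ℝ) = (x, 0) + (0, 1) := by simp
  rw [this, map_add]
  simp

/-- `φ` restricts to a projective map on `P` with positive denominator `s`: composition with `φ`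
and multiplication by `s` is a bijection between affine functionals. -/
structure ProjectiveOn (P : Set (E d)) (φ : E d → E d) (s : E d → ℝ) : Prop where
  pos : ∀ x ∈ P, 0 < s x
  pull : ∀ g : E d →ᵃ[ℝ] ℝ, ∃ g' : E d →ᵃ[ℝ] ℝ, ∀ x ∈ P, g' x = s x * g (φ x)
  push : ∀ g' : E d →ᵃ[ℝ] ℝ, ∃ g : E d →ᵃ[ℝ] ℝ, ∀ x ∈ P, g' x = s x * g (φ x)

/-- A projective transformation that is defined on a convex set has a denominator of constant sign
there. -/
theorem exists_projectiveOn {P : Set (E d)} (hP : Convex ℝ P) (T : (E d × ℝ) ≃ₗ[ℝ] (E d × ℝ))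
    (hT : ∀ x ∈ P, (T (x, 1)).2 ≠ 0) (ψ : E d ≃ᵃ[ℝ] E d) :
    ∃ s, ProjectiveOn P (fun x => ψ.symm (projMap T x)) s := by
  obtain ⟨t, ht⟩ := exists_dehomogenization (LinearMap.snd ℝ (E d) ℝ ∘ₗ T.toLinearMap)
  have ht' : ∀ x, (T (x, 1)).2 = t x := fun x => by rw [ht]; rfl
  simp only [ht'] at hT
  obtain ⟨ε, hε, hpos⟩ : ∃ ε : ℝ, ε * ε = 1 ∧ ∀ x ∈ P, 0 < ε * t x := by
    by_cases h : ∃ x ∈ P, t x < 0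
    · obtain ⟨x, hx, hx0⟩ := h
      refine ⟨-1, by norm_num, fun y hy => ?_⟩
      by_contra! hle
      have hy0 : 0 < t y := lt_of_le_of_ne (by linarith) (hT y hy).symm
      have hd : 0 < t y - t x := by linarith
      have hmem := hP hx hy (a := t y / (t y - t x)) (b := -t x / (t y - t x))
        (by positivity) (div_nonneg (by linarith) hd.le) (by field_simp; ring)
      refine hT _ hmem ?_
      rw [affineMap_combo _ _ _ _ _ (by field_simp; ring)]
      field_simp
      ring
    · push Not at h
      exact ⟨1, by norm_num, fun x hx => by
        rw [one_mul]; exact lt_of_le_of_ne (h x hx) (hT x hx).symm⟩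
  refine ⟨fun x => ε * t x, hpos, fun g => ?_, fun g' => ?_⟩
  · obtain ⟨Λ, hΛ⟩ := exists_homogenization (g.comp ψ.symm.toAffineMap)
    obtain ⟨g', hg'⟩ := exists_dehomogenization (ε • Λ ∘ₗ T.toLinearMap)
    refine ⟨g', fun x hx => ?_⟩
    have h1 : g (ψ.symm (projMap T x)) = Λ (projMap T x, 1) := by rw [hΛ]; rfl
    have h2 : ((projMap T x, 1) : E d × ℝ) = (t x)⁻¹ • T (x, 1) := by
      rw [projMap, ht']
      ext1
      · rfl
      · simp [ht', hT x hx]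
    rw [h1, h2, hg', map_smul]
    simp only [LinearMap.smul_apply, LinearMap.comp_apply, LinearEquiv.coe_coe, smul_eq_mul]
    have := hT x hx
    field_simp
  · obtain ⟨Λ, hΛ⟩ := exists_homogenization g'
    obtain ⟨g, hg⟩ := exists_dehomogenization (ε • Λ ∘ₗ T.symm.toLinearMap)
    refine ⟨g.comp ψ.toAffineMap, fun x hx => ?_⟩
    have h1 : (g.comp ψ.toAffineMap) (ψ.symm (projMap T x)) = g (projMap T x) := by
      simp
    have h2 : ((projMap T x, 1) : E d × ℝ) = (t x)⁻¹ • T (x, 1) := by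
      rw [projMap, ht']
      ext1
      · rfl
      · simp [ht', hT x hx]
    rw [h1, hg, h2, map_smul, ← hΛ]
    simp only [LinearMap.smul_apply, LinearMap.comp_apply, LinearEquiv.coe_coe, smul_eq_mul,
      LinearEquiv.symm_apply_apply]
    have := hT x hx
    field_simp
    linear_combination (-Λ (x, 1)) * hε

namespace ProjectiveOn

variable {P : Set (E d)} {φ : E d → E d} {s : E d → ℝ}

theorem injOn (H : ProjectiveOn P φ s) : InjOn φ P := by
  intro x hx y hy hxy
  have hs : s x = s y := by
    obtain ⟨g, hg⟩ := H.push (AffineMap.const ℝ _ 1)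
    have h1 := hg x hx
    have h2 := hg y hy
    rw [hxy] at h1
    simp only [AffineMap.const_apply] at h1 h2
    have h0 : g (φ y) ≠ 0 := by rintro h; rw [h] at h1; simp at h1
    exact mul_right_cancel₀ h0 (h1.symm.trans h2)
  refine eq_of_affine fun g' => ?_
  obtain ⟨g, hg⟩ := H.push g'
  rw [hg x hx, hg y hy, hxy, hs]

theorem map_combo (H : ProjectiveOn P φ s) {x y : E d} (hx : x ∈ P) (hy : y ∈ P) {a b : ℝ}
    (hab : a + b = 1) (hm : a • x + b • y ∈ P) :
    φ (a • x + b • y) = (a * s x / s (a • x + b • y)) • φ x + (b * s y / s (a • x + b • y)) • φ y ∧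
      s (a • x + b • y) = a * s x + b * s y := by
  have hs : s (a • x + b • y) = a * s x + b * s y := by
    obtain ⟨g, hg⟩ := H.pull (AffineMap.const ℝ _ 1)
    simp only [AffineMap.const_apply, mul_one] at hg
    rw [← hg _ hm, affineMap_combo _ _ _ _ _ hab, hg x hx, hg y hy]
  have hpos := H.pos _ hm
  refine ⟨eq_of_affine fun g => ?_, hs⟩
  obtain ⟨g', hg'⟩ := H.pull g
  have h1 := hg' _ hm
  rw [affineMap_combo _ _ _ _ _ hab, hg' x hx, hg' y hy] at h1
  rw [affineMap_combo _ _ _ _ _ (by rw [← add_div, ← hs, div_self hpos.ne'])]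
  field_simp
  linarith

theorem convex_image (H : ProjectiveOn P φ s) (hP : Convex ℝ P) : Convex ℝ (φ '' P) := by
  rintro _ ⟨x, hx, rfl⟩ _ ⟨y, hy, rfl⟩ a b ha hb hab
  have hsx := H.pos x hx
  have hsy := H.pos y hy
  have hden : 0 < a * s y + b * s x := by
    rcases ha.eq_or_lt with rfl | ha
    · have : b = 1 := by linarith
      subst this; linarith
    · have := mul_pos ha hsy
      have := mul_nonneg hb hsx.le
      linarith
  set α := a * s y / (a * s y + b * s x) with hα
  set β := b * s x / (a * s y + b * s x) with hβ
  have hαβ : α + β = 1 := by rw [hα, hβ, ← add_div, div_self hden.ne']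
  have hm := hP hx hy (a := α) (b := β) (by positivity) (by positivity) hαβ
  obtain ⟨h1, h2⟩ := H.map_combo hx hy hαβ hm
  refine ⟨_, hm, ?_⟩
  have h3 : α * s x / s (α • x + β • y) = a := by
    rw [h2, hα, hβ]
    have : a * s y * s x + b * s x * s y = s x * s y := by linear_combination (s x * s y) * hab
    field_simp
    linear_combination (-a) * hab
  have h4 : β * s y / s (α • x + β • y) = b := by
    rw [h2, hα, hβ]
    field_simp
    linear_combination (-b) * hab
  rw [h1, h3, h4]

theorem image_convexHull_subset (H : ProjectiveOn P φ s) (hP : Convex ℝ P) {V : Set (E d)}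
    (hV : V ⊆ P) : φ '' convexHull ℝ V ⊆ convexHull ℝ (φ '' V) := by
  have hconv : Convex ℝ {x ∈ P | φ x ∈ convexHull ℝ (φ '' V)} := by
    rintro x ⟨hx, hx'⟩ y ⟨hy, hy'⟩ a b ha hb hab
    have hm := hP hx hy ha hb hab
    obtain ⟨h1, h2⟩ := H.map_combo hx hy hab hm
    refine ⟨hm, ?_⟩
    rw [h1]
    have hpos := H.pos _ hm
    have := (H.pos x hx).le
    have := (H.pos y hy).le
    refine (convex_convexHull ℝ _) hx' hy' (by positivity) (by positivity) ?_
    rw [← add_div, ← h2, div_self hpos.ne']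
  rintro _ ⟨x, hx, rfl⟩
  exact (convexHull_min (t := {x ∈ P | φ x ∈ convexHull ℝ (φ '' V)})
    (fun y hy => ⟨hV hy, subset_convexHull ℝ _ ⟨y, hy, rfl⟩⟩) hconv hx).2

theorem isFace_image (H : ProjectiveOn P φ s) {B : Set (E d)} (hB : IsFace P B) :
    IsFace (φ '' P) (φ '' B) := by
  obtain ⟨n, hn, rfl⟩ := isFace_iff.1 hB
  obtain ⟨g, hg⟩ := H.push n
  refine IsFace.of_affine g ?_ ?_
  · rintro _ ⟨x, hx, rfl⟩
    have := hn x hx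
    rw [hg x hx] at this
    exact nonneg_of_mul_nonneg_right this (H.pos x hx)
  · ext y
    constructor
    · rintro ⟨x, ⟨hx, h0⟩, rfl⟩
      rw [hg x hx] at h0
      exact ⟨⟨x, hx, rfl⟩, (mul_eq_zero.1 h0).resolve_left (H.pos x hx).ne'⟩
    · rintro ⟨⟨x, hx, rfl⟩, h0⟩
      exact ⟨x, ⟨hx, by rw [hg x hx, h0, mul_zero]⟩, rfl⟩

theorem exists_face_of_image (H : ProjectiveOn P φ s) {B : Set (E d)} (hB : IsFace (φ '' P) B) :
    ∃ A, IsFace P A ∧ φ '' A = B := by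
  obtain ⟨n, hn, rfl⟩ := isFace_iff.1 hB
  obtain ⟨g, hg⟩ := H.pull n
  refine ⟨{x ∈ P | g x = 0}, IsFace.of_affine g (fun x hx => ?_) rfl, ?_⟩
  · rw [hg x hx]
    exact mul_nonneg (H.pos x hx).le (hn _ ⟨x, hx, rfl⟩)
  · ext y
    constructor
    · rintro ⟨x, ⟨hx, h0⟩, rfl⟩
      rw [hg x hx] at h0
      exact ⟨⟨x, hx, rfl⟩, (mul_eq_zero.1 h0).resolve_left (H.pos x hx).ne'⟩
    · rintro ⟨⟨x, hx, rfl⟩, h0⟩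
      exact ⟨x, ⟨hx, by rw [hg x hx, h0, mul_zero]⟩, rfl⟩

end ProjectiveOn

/-! ### Merging position -/

/-- The projective map `φ` puts `P` into the simplex `[v, w_1, …, w_d]`, with the simplex facet and
its adjacent facets on the facets of the simplex. -/
structure MergeMap (P : Set (E d)) (u : Fin d → E d) (f : E d →ᵃ[ℝ] ℝ) (h : Fin d → E d →ᵃ[ℝ] ℝ)
    (w : Fin d → E d) (b : AffineBasis (Option (Fin d)) ℝ (E d)) (φ : E d → E d) (s : E d → ℝ) :
    Prop where
  frame : FacetFrame P u f h
  proj : ProjectiveOn P φ s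
  map_u : ∀ k, φ (u k) = w k
  coord_nonneg : ∀ x ∈ P, ∀ o, 0 ≤ b.coord o (φ x)
  f_zero : ∀ x ∈ P, f x = 0 ↔ b.coord none (φ x) = 0
  h_zero : ∀ x ∈ P, ∀ k, h k x = 0 ↔ b.coord (some k) (φ x) = 0

/-- In merging position, the facet functionals of `P₁` at `F` and the `H_k` correspond to nonzero
multiples of the barycentric coordinates of `v, w_1, …, w_d`. -/
theorem MergePosition.exists_mergeMap {P₁ P₂ : Set (E d)} {u : Fin d → E d} {f : E d →ᵃ[ℝ] ℝ}
    {h : Fin d → E d →ᵃ[ℝ] ℝ} (hP₁ : IsPolytope P₁) (D₁ : FacetFrame P₁ u f h) {v : E d}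
    {w : Fin d → E d} {b : AffineBasis (Option (Fin d)) ℝ (E d)} (D₂ : VertexFrame P₂ v w b)
    {T : (E d × ℝ) ≃ₗ[ℝ] (E d × ℝ)} {ψ : E d ≃ᵃ[ℝ] E d} (H : MergePosition P₁ u v w T ψ) :
    ∃ s, MergeMap P₁ u f h w b (fun x => ψ.symm (projMap T x)) s := by
  obtain ⟨hT, a, ha1, -, ha3, ha4, ha5⟩ := H
  obtain ⟨s, hs⟩ := exists_projectiveOn hP₁.convex T hT ψ
  set φ : E d → E d := fun x => ψ.symm (projMap T x) with hφ
  have hφu : ∀ k, φ (u k) = w k := fun k => by simp only [hφ, ← ha5]; simp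
  have hcoord : ∀ x ∈ P₁, ∀ o, 0 ≤ b.coord o (φ x) := fun x hx o => by
    have h1 := ha3 ⟨x, hx, rfl⟩
    refine nonneg_convexHull (n := (b.coord o).comp ψ.symm.toAffineMap) ?_ _ h1
    have hb : ∀ o o', 0 ≤ b.coord o (b o') := fun o o' => by
      rw [b.coord_apply]; split_ifs <;> norm_num
    rintro y (rfl | ⟨k, rfl⟩)
    · simpa [← ha4, ← D₂.b_none] using hb o none
    · simpa [← ha5, ← D₂.b_some] using hb o (some k)
  have hh : ∀ k, ∀ x ∈ P₁, h k x = s x * ((s (u k))⁻¹ * b.coord (some k) (φ x)) := fun k x hx => by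
    obtain ⟨g, hg⟩ := hs.push (h k)
    have hgw : ∀ j, g (w j) = (s (u j))⁻¹ * h k (u j) := fun j => by
      rw [hg _ (D₁.u_mem j), hφu, inv_mul_cancel_left₀ (hs.pos _ (D₁.u_mem j)).ne']
    have hgv : g v = 0 := by
      have := affine_zero_of_mem_affineSpan (f := g.comp ψ.symm.toAffineMap) (fun y hy => ?_)
        (ha1 k)
      · simpa [← ha4] using this
      · obtain ⟨x, hx, rfl⟩ := hy
        rw [D₁.adj_eq] at hx
        have h1 := hg x hx.1
        rw [hx.2, eq_comm, mul_eq_zero] at h1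
        exact h1.resolve_left (hs.pos x hx.1).ne'
    rw [hg x hx, affineBasis_ext b (n := g) (n' := (s (u k))⁻¹ • b.coord (some k))]
    · simp
    · rw [AffineMap.coe_smul, Pi.smul_apply, coord_some_none, D₂.b_none, hgv, smul_zero]
    · intro j
      rw [D₂.b_some, hgw, ← D₂.b_some, AffineMap.coe_smul, Pi.smul_apply, coord_some_some, D₁.h_u]
      split_ifs with hkj
      · rw [hkj]; simp
      · simp
  obtain ⟨c, hc, hf⟩ : ∃ c : ℝ, c ≠ 0 ∧ ∀ x ∈ P₁, f x = s x * (c * b.coord none (φ x)) := by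
    obtain ⟨g, hg⟩ := hs.push f
    have hgw : ∀ j, g (w j) = 0 := fun j => by
      have := hg _ (D₁.u_mem j)
      rw [D₁.f_u, hφu, eq_comm, mul_eq_zero] at this
      exact this.resolve_left (hs.pos _ (D₁.u_mem j)).ne'
    have hgexp : ∀ y, g y = g v * b.coord none y := fun y => by
      rw [affineBasis_ext b (n := g) (n' := g v • b.coord none)]
      · simp
      · rw [AffineMap.coe_smul, Pi.smul_apply, coord_none_none, D₂.b_none, smul_eq_mul, mul_one]
      · intro j
        rw [AffineMap.coe_smul, Pi.smul_apply, coord_none_some, D₂.b_some, hgw, smul_zero]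
    refine ⟨g v, ?_, fun x hx => by rw [hg x hx, hgexp]⟩
    intro h0
    obtain ⟨p, hp, hfp⟩ := D₁.exists_pos
    rw [hg p hp, hgexp, h0] at hfp
    simp at hfp
  refine ⟨s, D₁, hs, hφu, hcoord, fun x hx => ?_, fun x hx k => ?_⟩
  · have := (hs.pos x hx).ne'
    rw [hf x hx]
    simp [this, hc]
  · have h1 := (hs.pos x hx).ne'
    have h2 := (hs.pos _ (D₁.u_mem k)).ne'
    rw [hh k x hx]
    simp [h1, h2]

namespace MergeMap

variable {P : Set (E d)} {u : Fin d → E d} {f : E d →ᵃ[ℝ] ℝ} {h : Fin d → E d →ᵃ[ℝ] ℝ}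
  {w : Fin d → E d} {b : AffineBasis (Option (Fin d)) ℝ (E d)} {φ : E d → E d} {s : E d → ℝ}

theorem mergeFrame (M : MergeMap P u f h w b φ s) (hP : IsPolytope P) {i : ℕ} (hi : i < d)
    (hsimple : IsSimple i P) {R : Set (E d)} {v : E d} (D : VertexFrame R v w b)
    (hsimp : IsSimplicial (d - i) R) : MergeFrame i (φ '' P) R v w b := by
  refine ⟨D, hi, hsimp, M.proj.convex_image hP.convex, ?_,
    fun k => ⟨u k, M.frame.u_mem k, M.map_u k⟩, fun T hT => ?_⟩
  · rintro _ ⟨x, hx, rfl⟩ o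
    exact M.coord_nonneg x hx o
  · obtain ⟨z, hz, h1, h2⟩ := M.frame.exists_off_facet (by omega) hP hi hsimple hT
    refine ⟨φ z, ⟨z, hz, rfl⟩, fun k hk => (M.h_zero z hz k).1 (h1 k hk), ?_⟩
    exact (M.coord_nonneg z hz none).lt_of_ne fun h0 => h2.ne' ((M.f_zero z hz).2 h0.symm)

theorem image_adjInter (M : MergeMap P u f h w b φ s) (S : Finset (Fin d)) :
    φ '' adjInter P u S = {y ∈ φ '' P | ∀ k ∈ S, b.coord (some k) y = 0} := by
  rw [M.frame.adjInter_eq]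
  ext y
  constructor
  · rintro ⟨x, ⟨hx, h0⟩, rfl⟩
    exact ⟨⟨x, hx, rfl⟩, fun k hk => (M.h_zero x hx k).1 (h0 k hk)⟩
  · rintro ⟨⟨x, hx, rfl⟩, h0⟩
    exact ⟨x, ⟨hx, fun k hk => (M.h_zero x hx k).2 (h0 k hk)⟩, rfl⟩

theorem image_hullOf (M : MergeMap P u f h w b φ s) (hP : Convex ℝ P)
    (hb : ∀ k, b (some k) = w k) (S : Finset (Fin d)) : φ '' hullOf u S = hullOf w S := by
  ext y
  rw [mem_hullOf_basis b hb]
  constructor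
  · rintro ⟨x, hx, rfl⟩
    obtain ⟨hx, h0, h1⟩ := M.frame.mem_hullOf_iff.1 hx
    exact ⟨(M.f_zero x hx).1 h0, fun k => M.coord_nonneg x hx _,
      fun k hk => (M.h_zero x hx k).1 (h1 k hk)⟩
  · intro hy
    have hyP : y ∈ φ '' P := by
      refine convexHull_min ?_ (M.proj.convex_image hP) ((mem_hullOf_basis b hb).2 hy)
      rintro _ ⟨k, -, rfl⟩
      exact ⟨u k, M.frame.u_mem k, M.map_u k⟩
    obtain ⟨x, hx, rfl⟩ := hyP
    exact ⟨x, M.frame.mem_hullOf_iff.2 ⟨hx, (M.f_zero x hx).2 hy.1,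
      fun k hk => (M.h_zero x hx k).2 (hy.2.2 k hk)⟩, rfl⟩

end MergeMap

/-! ### Existence of a merging position -/

/-- A linear automorphism of `ℝ^d × ℝ` that realizes the simplex bounded by `F, H_1, …, H_d`, which
may have its apex at infinity, as the simplex `[v, w_1, …, w_d]`. -/
theorem FacetFrame.exists_linearEquiv {P : Set (E d)} {u : Fin d → E d} {f : E d →ᵃ[ℝ] ℝ}
    {h : Fin d → E d →ᵃ[ℝ] ℝ} (D : FacetFrame P u f h)
    (b : AffineBasis (Option (Fin d)) ℝ (E d)) :
    ∃ T : (E d × ℝ) ≃ₗ[ℝ] (E d × ℝ), ∀ x,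
      T (x, 1) = f x • (b none, (1 : ℝ)) + ∑ k, h k x • (b (some k), (1 : ℝ)) := by
  choose Λ hΛ using fun k => exists_homogenization (h k)
  obtain ⟨Λf, hΛf⟩ := exists_homogenization f
  let L : (E d × ℝ) →ₗ[ℝ] (E d × ℝ) :=
    Λf.smulRight (b none, (1 : ℝ)) + ∑ k, (Λ k).smulRight (b (some k), (1 : ℝ))
  have hL : ∀ x, L (x, 1) = f x • (b none, (1 : ℝ)) + ∑ k, h k x • (b (some k), (1 : ℝ)) :=
    fun x => by
      simp only [L, LinearMap.add_apply, LinearMap.sum_apply, LinearMap.smulRight_apply, hΛ, hΛf]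
  have hu : ∀ k, (b (some k), (1 : ℝ)) ∈ LinearMap.range L := fun k => by
    refine ⟨(u k, 1), ?_⟩
    rw [hL, D.f_u, zero_smul, zero_add, Finset.sum_eq_single k]
    · rw [D.h_self, one_smul]
    · intro j _ hj
      rw [D.h_ne j k hj.symm, zero_smul]
    · simp
  have hv : (b none, (1 : ℝ)) ∈ LinearMap.range L := by
    obtain ⟨p, -, hfp⟩ := D.exists_pos
    have h1 : f p • (b none, (1 : ℝ)) = L (p, 1) - ∑ k, h k p • (b (some k), (1 : ℝ)) := by
      rw [hL, add_sub_cancel_right]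
    have h2 : f p • (b none, (1 : ℝ)) ∈ LinearMap.range L := by
      rw [h1]
      exact sub_mem ⟨_, rfl⟩ (sum_mem fun k _ => Submodule.smul_mem _ _ (hu k))
    have := Submodule.smul_mem _ (f p)⁻¹ h2
    rwa [smul_smul, inv_mul_cancel₀ hfp.ne', one_smul] at this
  have h1 : ∀ y : E d, (y, (1 : ℝ)) ∈ LinearMap.range L := fun y => by
    have : (y, (1 : ℝ)) = ∑ o, b.coord o y • (b o, (1 : ℝ)) := by
      ext1
      · rw [Prod.fst_sum]; simp [b.linear_combination_coord_eq_self y]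
      · rw [Prod.snd_sum]; simp [b.sum_coord_apply_eq_one y]
    rw [this]
    refine sum_mem fun o _ => Submodule.smul_mem _ _ ?_
    cases o with
    | none => exact hv
    | some k => exact hu k
  have hsurj : Function.Surjective L := by
    rw [← LinearMap.range_eq_top, eq_top_iff]
    rintro ⟨y, t⟩ -
    have : (y, t) = (y, (1 : ℝ)) + (t - 1) • (((0 : E d), (1 : ℝ))) := by
      ext1 <;> simp
    rw [this]
    exact add_mem (h1 y) (Submodule.smul_mem _ _ (h1 0))
  exact ⟨LinearEquiv.ofBijective L ⟨LinearMap.injective_iff_surjective.2 hsurj, hsurj⟩, hL⟩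

/-- The pair `T, id` is in merging position, for the automorphism `T` of `exists_linearEquiv`. -/
theorem exists_mergePosition {P₁ P₂ : Set (E d)} {u : Fin d → E d}
    {f : E d →ᵃ[ℝ] ℝ} {h : Fin d → E d →ᵃ[ℝ] ℝ} (D₁ : FacetFrame P₁ u f h)
    {v : E d} {w : Fin d → E d} {b : AffineBasis (Option (Fin d)) ℝ (E d)}
    (D₂ : VertexFrame P₂ v w b) : ∃ T ψ, MergePosition P₁ u v w T ψ := by
  obtain ⟨T, hT⟩ := D₁.exists_linearEquiv b
  have hT2 : ∀ x, (T (x, 1)).2 = f x + ∑ k, h k x := fun x => by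
    rw [hT, Prod.snd_add, Prod.snd_sum]; simp
  have hT1 : ∀ x, (T (x, 1)).1 = f x • b none + ∑ k, h k x • b (some k) := fun x => by
    rw [hT, Prod.fst_add, Prod.fst_sum]; simp
  -- `f` and the `h_k` have no common zero on `P₁`, because `T` is injective
  have hpos : ∀ x ∈ P₁, 0 < (T (x, 1)).2 := fun x hx => by
    have h1 := D₁.f_nonneg x hx
    have h2 := fun k => D₁.h_nonneg k x hx
    have h3 : 0 ≤ ∑ k, h k x := Finset.sum_nonneg fun k _ => h2 k
    rw [hT2]
    refine (add_nonneg h1 h3).lt_of_ne fun h0 => ?_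
    have hf0 : f x = 0 := by linarith
    have hh0 : ∑ k, h k x = 0 := by linarith
    have hz : T (x, 1) = 0 := by
      rw [hT, hf0, zero_smul, zero_add]
      refine Finset.sum_eq_zero fun k hk => ?_
      rw [(Finset.sum_eq_zero_iff_of_nonneg fun k _ => h2 k).1 hh0 k hk, zero_smul]
    have := T.map_eq_zero_iff.1 hz
    simp [Prod.ext_iff] at this
  have hproj : ∀ x, projMap T x =
      ((T (x, 1)).2⁻¹ * f x) • b none + ∑ k, ((T (x, 1)).2⁻¹ * h k x) • b (some k) := fun x => by
    rw [projMap, hT1, smul_add, Finset.smul_sum, smul_smul]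
    simp only [smul_smul]
  have hsum : ∀ x ∈ P₁, (T (x, 1)).2⁻¹ * f x + ∑ k, (T (x, 1)).2⁻¹ * h k x = 1 := fun x hx => by
    rw [← Finset.mul_sum, ← mul_add, ← hT2, inv_mul_cancel₀ (hpos x hx).ne']
  have hpu : ∀ k, projMap T (u k) = b (some k) := fun k => by
    have h1 : (T (u k, 1)).2 = 1 := by rw [hT2, D₁.f_u]; simp [D₁.h_u]
    rw [hproj, h1, D₁.f_u]
    simp [D₁.h_u]
  refine ⟨T, AffineEquiv.refl ℝ _, fun x hx => (hpos x hx).ne', v, fun k => ?_, fun hmem => ?_, ?_,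
    rfl, fun k => ?_⟩
  · -- `H_k` has a point off `F`; the line joining its image to `v` stays in the hyperplane
    obtain ⟨y, hy, hy0, hfy⟩ := D₁.exists_h k
    set A := affineSpan ℝ (projMap T '' adjFacet P₁ u k) with hA
    have hyA : projMap T y ∈ A := by
      refine subset_affineSpan ℝ _ ⟨y, ?_, rfl⟩
      rw [D₁.adj_eq]; exact ⟨hy, hy0⟩
    have hwA : ∀ j, j ≠ k → b (some j) ∈ A := fun j hj => by
      refine subset_affineSpan ℝ _ ⟨u j, ?_, hpu j⟩
      rw [D₁.adj_eq]; exact ⟨D₁.u_mem j, D₁.h_ne k j hj⟩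
    set s := (T (y, 1)).2 with hs
    have hs0 : 0 < s := hpos y hy
    have hc : 0 < s⁻¹ * f y := by positivity
    have hdir : (s⁻¹ * f y) • (v - projMap T y) ∈ A.direction := by
      have h1 : (s⁻¹ * f y) • (v - projMap T y) =
          ∑ j, (s⁻¹ * h j y) • (projMap T y - b (some j)) := by
        simp only [smul_sub, Finset.sum_sub_distrib, ← Finset.sum_smul]
        have h2 : ∑ j, s⁻¹ * h j y = 1 - s⁻¹ * f y := by
          have := hsum y hy
          linarith
        have h3 : (s⁻¹ * f y) • v = projMap T y - ∑ j, (s⁻¹ * h j y) • b (some j) := by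
          rw [hproj, add_sub_cancel_right, D₂.b_none]
        rw [h2, h3, sub_smul, one_smul]
        abel
      rw [h1]
      refine sum_mem fun j _ => ?_
      rcases eq_or_ne j k with rfl | hj
      · rw [hy0, mul_zero, zero_smul]; exact zero_mem _
      · exact Submodule.smul_mem _ _ (AffineSubspace.vsub_mem_direction hyA (hwA j hj))
    have hdir' : v - projMap T y ∈ A.direction := by
      have := Submodule.smul_mem _ (s⁻¹ * f y)⁻¹ hdir
      rwa [smul_smul, inv_mul_cancel₀ hc.ne', one_smul] at this
    have := AffineSubspace.vadd_mem_of_mem_direction hdir' hyA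
    simpa using this
  · have h0 := affine_zero_of_mem_affineSpan (f := b.coord none) (fun y hy => ?_) hmem
    · rw [← D₂.b_none] at h0; simp at h0
    · obtain ⟨x, hx, rfl⟩ := hy
      have hxF := hx
      rw [D₁.facet_eq] at hxF
      have hmem : projMap T x ∈ facetOf w := by
        rw [hproj, hxF.2, mul_zero, zero_smul, zero_add, facetOf_eq]
        refine (convex_convexHull ℝ _).sum_mem (fun k _ => ?_) ?_ fun k _ => ?_
        · exact mul_nonneg (inv_nonneg.2 (hpos x hxF.1).le) (D₁.h_nonneg k x hxF.1)
        · have := hsum x hxF.1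
          rwa [hxF.2, mul_zero, zero_add] at this
        · exact subset_convexHull ℝ _ ⟨k, (D₂.b_some k).symm⟩
      exact ((mem_facetOf_basis b D₂.b_some).1 hmem).1
  · rintro _ ⟨x, hx, rfl⟩
    have hmem : ∑ o : Option (Fin d), (T (x, 1)).2⁻¹ * o.elim (f x) (fun k => h k x) = 1 := by
      rw [Fintype.sum_option]; exact hsum x hx
    have hval : projMap T x =
        ∑ o : Option (Fin d), ((T (x, 1)).2⁻¹ * o.elim (f x) (fun k => h k x)) • b o := by
      rw [Fintype.sum_option]; exact hproj x
    rw [hval]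
    refine (convex_convexHull ℝ _).sum_mem (fun o _ => ?_) hmem fun o _ => ?_
    · refine mul_nonneg (inv_nonneg.2 (hpos x hx).le) ?_
      cases o with
      | none => exact D₁.f_nonneg x hx
      | some k => exact D₁.h_nonneg k x hx
    · refine subset_convexHull ℝ _ ?_
      cases o with
      | none => exact Or.inl D₂.b_none
      | some k => exact Or.inr ⟨k, hpu k⟩
  · rw [hpu, D₂.b_some]; rfl

/-! ### The isomorphism of face lattices -/

/-- The face of the merge (before applying `ψ`) that corresponds to a face of `P₁` or of `P₂`. -/
def mergeFace (i : ℕ) (P₁ : Set (E d)) (u : Fin d → E d) (P₂ : Set (E d)) (v : E d)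
    (w : Fin d → E d) (φ : E d → E d) : FaceMinus₁ i P₁ u ⊕ FaceMinus₂ i P₂ v → Set (E d)
  | Sum.inl σ => φ '' σ.1 ∪ {y | ∃ S : Finset (Fin d), S.card ≤ i ∧ σ.1 = adjInter P₁ u S ∧
      y ∈ vertexInter P₂ v w S ∩ removeVertex P₂ v}
  | Sum.inr τ => (τ.1 ∩ removeVertex P₂ v) ∪ {y | ∃ S : Finset (Fin d), S.card ≤ i ∧
      τ.1 = vertexInter P₂ v w S ∧ y ∈ φ '' adjInter P₁ u S}

/-- Two polytopes whose merge, in the coordinates of `P₂`, is `φ(P₁) ∪ P₂'`. -/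
structure MergePair (i : ℕ) (P₁ : Set (E d)) (u : Fin d → E d) (P₂ : Set (E d)) (v : E d)
    (w : Fin d → E d) (b : AffineBasis (Option (Fin d)) ℝ (E d)) (f : E d →ᵃ[ℝ] ℝ)
    (h : Fin d → E d →ᵃ[ℝ] ℝ) (φ : E d → E d) (s : E d → ℝ) : Prop where
  polytope : IsPolytope P₁
  map : MergeMap P₁ u f h w b φ s
  frame : MergeFrame i (φ '' P₁) P₂ v w b

namespace MergePair

variable {i : ℕ} {P₁ : Set (E d)} {u : Fin d → E d} {P₂ : Set (E d)} {v : E d} {w : Fin d → E d}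
  {b : AffineBasis (Option (Fin d)) ℝ (E d)} {f : E d →ᵃ[ℝ] ℝ} {h : Fin d → E d →ᵃ[ℝ] ℝ}
  {φ : E d → E d} {s : E d → ℝ}

theorem joint_eq (M : MergePair i P₁ u P₂ v w b f h φ s) (S : Finset (Fin d)) :
    jointFace b (φ '' P₁) P₂ v S =
      φ '' adjInter P₁ u S ∪ (vertexInter P₂ v w S ∩ removeVertex P₂ v) := by
  rw [M.map.image_adjInter, M.frame.frame.vertexInter_eq]
  ext y
  simp only [jointFace, mem_union, mem_inter_iff, mem_ofPred_eq]
  have : y ∈ removeVertex P₂ v → y ∈ P₂ := fun hy => (M.frame.mem_remove.1 hy).1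
  tauto

theorem joint_inter_Q (M : MergePair i P₁ u P₂ v w b f h φ s) (S : Finset (Fin d)) :
    jointFace b (φ '' P₁) P₂ v S ∩ φ '' P₁ = φ '' adjInter P₁ u S := by
  rw [M.map.image_adjInter]
  ext y
  simp only [jointFace, mem_union, mem_inter_iff, mem_ofPred_eq]
  tauto

theorem joint_inter_remove (M : MergePair i P₁ u P₂ v w b f h φ s) (S : Finset (Fin d)) :
    jointFace b (φ '' P₁) P₂ v S ∩ removeVertex P₂ v =
      vertexInter P₂ v w S ∩ removeVertex P₂ v := by
  rw [M.frame.frame.vertexInter_eq]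
  ext y
  simp only [jointFace, mem_union, mem_inter_iff, mem_ofPred_eq]
  have : y ∈ removeVertex P₂ v → y ∈ P₂ := fun hy => (M.frame.mem_remove.1 hy).1
  tauto

theorem w_mem_joint (M : MergePair i P₁ u P₂ v w b f h φ s) {S : Finset (Fin d)} {j : Fin d} :
    w j ∈ jointFace b (φ '' P₁) P₂ v S ↔ j ∉ S := by
  simp only [jointFace, mem_ofPred_eq, ← M.frame.frame.b_some, coord_some_some]
  have : b (some j) ∈ φ '' P₁ ∪ removeVertex P₂ v :=
    Or.inl (M.frame.frame.b_some j ▸ M.frame.w_mem_Q j)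
  simp [this]

theorem w_mem_image (M : MergePair i P₁ u P₂ v w b f h φ s) {σ : Set (E d)} (hσ : σ ⊆ P₁)
    {k : Fin d} : w k ∈ φ '' σ ↔ u k ∈ σ := by
  rw [← M.map.map_u]
  exact M.map.proj.injOn.mem_image_iff hσ (M.map.frame.u_mem k)

theorem image_subset_facetOf (M : MergePair i P₁ u P₂ v w b f h φ s) {σ : Set (E d)}
    (hσ : σ ⊆ P₁) : φ '' σ ⊆ facetOf w ↔ σ ⊆ facetOf u := by
  have h1 : φ '' facetOf u = facetOf w :=
    M.map.image_hullOf M.polytope.convex M.frame.frame.b_some Finset.univ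
  rw [← h1]
  exact M.map.proj.injOn.image_subset_image_iff hσ
    (fun x hx => (M.map.frame.facet_eq ▸ hx : x ∈ {x ∈ P₁ | f x = 0}).1)

theorem not_joint_subset_remove (M : MergePair i P₁ u P₂ v w b f h φ s) {S : Finset (Fin d)}
    (hS : S.card ≤ i) : ¬ φ '' adjInter P₁ u S ⊆ removeVertex P₂ v := by
  obtain ⟨z, hz, h1, h2⟩ := M.frame.exists_off Sᶜ (by
    rw [Finset.card_compl, Fintype.card_fin]; omega)
  intro hsub
  have hzS : z ∈ φ '' adjInter P₁ u S := by
    rw [M.map.image_adjInter]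
    exact ⟨hz, fun k hk => h1 k (by simpa using hk)⟩
  exact h2.not_ge (M.frame.mem_remove.1 (hsub hzS)).2

theorem not_adjInter_subset (M : MergePair i P₁ u P₂ v w b f h φ s) {S : Finset (Fin d)}
    (hS : S.card ≤ i) : ¬ adjInter P₁ u S ⊆ facetOf u := fun hsub =>
  M.not_joint_subset_remove hS
    (((M.image_subset_facetOf (M.map.frame.isFace_adjInter S).subset).2 hsub).trans
      M.frame.facetOf_subset_remove)

/-- `⋂_{k ∈ S} H_k` as an element of `L(P₁)⁻`. -/
def adj (M : MergePair i P₁ u P₂ v w b f h φ s) (S : Finset (Fin d)) (hS : S.card ≤ i) :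
    FaceMinus₁ i P₁ u :=
  ⟨adjInter P₁ u S, M.map.frame.isFace_adjInter S, fun hsub => M.not_adjInter_subset hS hsub.1⟩

/-- `⋂_{k ∈ S} H'_k` as an element of `L(P₂)⁻`. -/
def vtx (M : MergePair i P₁ u P₂ v w b f h φ s) (S : Finset (Fin d)) (hS : S.card ≤ i) :
    FaceMinus₂ i P₂ v :=
  ⟨vertexInter P₂ v w S, M.frame.frame.isFace_vertexInter S, fun hv => by
    have := hv.2
    rw [M.frame.frame.dim_vertexInter] at this
    omega⟩

/-- `[u_k : k ∈ S]` as an element of `L(P₁)⁻`. -/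
def hullL (M : MergePair i P₁ u P₂ v w b f h φ s) (S : Finset (Fin d)) (hS : S.card + i ≤ d) :
    FaceMinus₁ i P₁ u :=
  ⟨hullOf u S, M.map.frame.isFace_hullOf S, fun hdim => by
    have := hdim.2
    rw [dim_hullOf M.map.frame.indep] at this
    omega⟩

theorem v_notMem_hullOf (M : MergePair i P₁ u P₂ v w b f h φ s) (S : Finset (Fin d)) :
    v ∉ hullOf w S := fun h => M.frame.frame.v_notMem_facetOf (hullOf_subset_facetOf w S h)

/-- `[w_k : k ∈ S]` as an element of `L(P₂)⁻`. -/
def hullR (M : MergePair i P₁ u P₂ v w b f h φ s) (S : Finset (Fin d)) (hS : S.card + i ≤ d) :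
    FaceMinus₂ i P₂ v :=
  ⟨hullOf w S, M.frame.frame.isFace_hullOf M.frame.lt.le M.frame.simplicial hS,
    fun hv => M.v_notMem_hullOf S hv.1⟩

theorem exists_vertexInter (M : MergePair i P₁ u P₂ v w b f h φ s) (τ : FaceMinus₂ i P₂ v)
    (hv : v ∈ τ.1) : ∃ S : Finset (Fin d), S.card ≤ i ∧ τ.1 = vertexInter P₂ v w S := by
  classical
  have h1 := M.frame.frame.eq_vertexInter τ.2.1 hv
  refine ⟨_, ?_, h1⟩
  have h2 := τ.2.2
  simp only [hv, true_and, not_lt] at h2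
  rw [h1, M.frame.frame.dim_vertexInter] at h2
  omega

theorem mergeFace_adj (M : MergePair i P₁ u P₂ v w b f h φ s) {σ : FaceMinus₁ i P₁ u}
    {S : Finset (Fin d)} (hS : S.card ≤ i) (hσ : σ.1 = adjInter P₁ u S) :
    mergeFace i P₁ u P₂ v w φ (Sum.inl σ) = jointFace b (φ '' P₁) P₂ v S := by
  rw [M.joint_eq, mergeFace, hσ]
  congr 1
  ext y
  constructor
  · rintro ⟨S', -, hSS', hy⟩
    have : S = S' := by
      ext j
      rw [← not_iff_not, ← M.map.frame.u_mem_adjInter, hSS', M.map.frame.u_mem_adjInter]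
    rwa [this]
  · exact fun hy => ⟨S, hS, rfl, hy⟩

theorem mergeFace_left {σ : FaceMinus₁ i P₁ u}
    (hσ : ¬ ∃ S : Finset (Fin d), S.card ≤ i ∧ σ.1 = adjInter P₁ u S) :
    mergeFace i P₁ u P₂ v w φ (Sum.inl σ) = φ '' σ.1 := by
  rw [mergeFace]
  refine union_eq_left.2 ?_
  rintro y ⟨S, hS, hσS, -⟩
  exact absurd ⟨S, hS, hσS⟩ hσ

theorem mergeFace_vtx (M : MergePair i P₁ u P₂ v w b f h φ s) {τ : FaceMinus₂ i P₂ v}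
    {S : Finset (Fin d)} (hS : S.card ≤ i) (hτ : τ.1 = vertexInter P₂ v w S) :
    mergeFace i P₁ u P₂ v w φ (Sum.inr τ) = jointFace b (φ '' P₁) P₂ v S := by
  rw [M.joint_eq, mergeFace, hτ, union_comm]
  congr 1
  ext y
  constructor
  · rintro ⟨S', -, hSS', hy⟩
    have : S = S' := by
      ext j
      rw [← not_iff_not, ← M.frame.frame.w_mem_vertexInter, hSS', M.frame.frame.w_mem_vertexInter]
    rwa [this]
  · exact fun hy => ⟨S, hS, rfl, hy⟩

theorem mergeFace_right (M : MergePair i P₁ u P₂ v w b f h φ s) {τ : FaceMinus₂ i P₂ v}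
    (hv : v ∉ τ.1) : mergeFace i P₁ u P₂ v w φ (Sum.inr τ) = τ.1 := by
  rw [mergeFace, inter_eq_left.2 (M.frame.face_subset_remove τ.2.1 hv)]
  refine union_eq_left.2 ?_
  rintro y ⟨S, hS, hτS, -⟩
  exact absurd (hτS ▸ M.frame.frame.v_mem_vertexInter S) hv

theorem mergeFace_inter_Q (M : MergePair i P₁ u P₂ v w b f h φ s) (σ : FaceMinus₁ i P₁ u) :
    mergeFace i P₁ u P₂ v w φ (Sum.inl σ) ∩ φ '' P₁ = φ '' σ.1 := by
  by_cases hσ : ∃ S : Finset (Fin d), S.card ≤ i ∧ σ.1 = adjInter P₁ u S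
  · obtain ⟨S, hS, hσS⟩ := hσ
    rw [M.mergeFace_adj hS hσS, M.joint_inter_Q, hσS]
  · rw [MergePair.mergeFace_left hσ, inter_eq_left]
    exact image_mono σ.2.1.subset

theorem mergeFace_inter_remove (M : MergePair i P₁ u P₂ v w b f h φ s) (τ : FaceMinus₂ i P₂ v) :
    mergeFace i P₁ u P₂ v w φ (Sum.inr τ) ∩ removeVertex P₂ v = τ.1 ∩ removeVertex P₂ v := by
  by_cases hv : v ∈ τ.1
  · obtain ⟨S, hS, hτS⟩ := M.exists_vertexInter τ hv
    rw [M.mergeFace_vtx hS hτS, M.joint_inter_remove, hτS]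
  · rw [M.mergeFace_right hv]

theorem card_le_of_subset_facetOf (M : MergePair i P₁ u P₂ v w b f h φ s) (σ : FaceMinus₁ i P₁ u)
    (hσ : σ.1 ⊆ facetOf u) : ∃ S : Finset (Fin d), S.card + i ≤ d ∧ σ.1 = hullOf u S := by
  classical
  have h1 := M.map.frame.eq_hullOf σ.2.1 hσ
  refine ⟨_, ?_, h1⟩
  have h2 := σ.2.2
  simp only [hσ, true_and, not_le] at h2
  rw [h1, dim_hullOf M.map.frame.indep] at h2
  omega

/-- A face of `P₁` in `L(P₁)⁻` other than the `⋂_{k ∈ S} H_k` has at most `d - i` of the `u_k` and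
is a face of the merge. -/
theorem isFace_left (M : MergePair i P₁ u P₂ v w b f h φ s) {σ : FaceMinus₁ i P₁ u}
    (hσ : ¬ ∃ S : Finset (Fin d), S.card ≤ i ∧ σ.1 = adjInter P₁ u S) :
    (∃ T : Finset (Fin d), (∀ k, k ∈ T ↔ u k ∈ σ.1) ∧ T.card + i ≤ d) ∧
      IsFace (φ '' P₁ ∪ removeVertex P₂ v) (φ '' σ.1) := by
  by_cases hF : σ.1 ⊆ facetOf u
  · obtain ⟨S, hS, hσS⟩ := M.card_le_of_subset_facetOf σ hF
    refine ⟨⟨S, fun k => by rw [hσS, M.map.frame.u_mem_hullOf], hS⟩, ?_⟩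
    rw [hσS, M.map.image_hullOf M.polytope.convex M.frame.frame.b_some]
    exact M.frame.isFace_of_frame_face (M.hullR S hS).2.1 (M.v_notMem_hullOf S)
  · rcases M.frame.isFace_of_Q_face (M.map.proj.isFace_image σ.2.1)
      (fun h => hF ((M.image_subset_facetOf σ.2.1.subset).1 h)) with
      ⟨S, hS, hσS⟩ | ⟨⟨T, hT, hcard⟩, hface⟩
    · rw [← M.map.image_adjInter, M.map.proj.injOn.image_eq_image_iff σ.2.1.subset
        (M.map.frame.isFace_adjInter S).subset] at hσS
      exact absurd ⟨S, hS, hσS⟩ hσ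
    · exact ⟨⟨T, fun k => by rw [hT, M.w_mem_image σ.2.1.subset], hcard.le⟩, hface⟩

theorem isFace_mergeFace (M : MergePair i P₁ u P₂ v w b f h φ s)
    (x : FaceMinus₁ i P₁ u ⊕ FaceMinus₂ i P₂ v) :
    IsFace (φ '' P₁ ∪ removeVertex P₂ v) (mergeFace i P₁ u P₂ v w φ x) := by
  rcases x with σ | τ
  · by_cases hσ : ∃ S : Finset (Fin d), S.card ≤ i ∧ σ.1 = adjInter P₁ u S
    · obtain ⟨S, hS, hσS⟩ := hσ
      rw [M.mergeFace_adj hS hσS]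
      exact M.frame.isFace_joint S
    · rw [MergePair.mergeFace_left hσ]
      exact (M.isFace_left hσ).2
  · by_cases hv : v ∈ τ.1
    · obtain ⟨S, hS, hτS⟩ := M.exists_vertexInter τ hv
      rw [M.mergeFace_vtx hS hτS]
      exact M.frame.isFace_joint S
    · rw [M.mergeFace_right hv]
      exact M.frame.isFace_of_frame_face τ.2.1 hv

theorem joint_anti {S S' : Finset (Fin d)} (hS : S' ⊆ S) :
    jointFace b (φ '' P₁) P₂ v S ⊆ jointFace b (φ '' P₁) P₂ v S' :=
  fun _ hx => ⟨hx.1, fun k hk => hx.2 k (hS hk)⟩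

theorem mergeFace_mono (M : MergePair i P₁ u P₂ v w b f h φ s)
    {x y : FaceMinus₁ i P₁ u ⊕ FaceMinus₂ i P₂ v} (hxy : x ≤ y) :
    mergeFace i P₁ u P₂ v w φ x ⊆ mergeFace i P₁ u P₂ v w φ y := by
  rcases x with σ | τ <;> rcases y with σ' | τ'
  · have hle : σ ≤ σ' := Sum.inl_le_inl_iff.1 hxy
    replace hle : σ.1 ⊆ σ'.1 := hle
    by_cases hσ : ∃ S : Finset (Fin d), S.card ≤ i ∧ σ.1 = adjInter P₁ u S
    · obtain ⟨S, hS, hσS⟩ := hσ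
      -- a face above `⋂_{k ∈ S} H_k` contains many of the `u_k`
      have hσ' : ∃ S : Finset (Fin d), S.card ≤ i ∧ σ'.1 = adjInter P₁ u S := by
        by_contra hnot
        obtain ⟨⟨T, hT, hcard⟩, -⟩ := M.isFace_left hnot
        have hsub : Sᶜ ⊆ T := fun k hk => by
          rw [hT]
          exact hle (hσS ▸ M.map.frame.u_mem_adjInter.2 (by simpa using hk))
        rcases M.frame.isFace_of_Q_face (M.map.proj.isFace_image σ'.2.1) (fun h =>
          M.not_adjInter_subset hS (hσS ▸ hle.trans ((M.image_subset_facetOf σ'.2.1.subset).1 h)))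
          with ⟨S', hS', hσS'⟩ | ⟨⟨T', hT', hcard'⟩, -⟩
        · rw [← M.map.image_adjInter, M.map.proj.injOn.image_eq_image_iff σ'.2.1.subset
            (M.map.frame.isFace_adjInter S').subset] at hσS'
          exact hnot ⟨S', hS', hσS'⟩
        · have hTT' : T = T' := by
            ext k; rw [hT, hT', M.w_mem_image σ'.2.1.subset]
          have := Finset.card_le_card hsub
          rw [Finset.card_compl, Fintype.card_fin, hTT'] at this
          omega
      obtain ⟨S', hS', hσS'⟩ := hσ'
      rw [M.mergeFace_adj hS hσS, M.mergeFace_adj hS' hσS']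
      refine joint_anti fun k hk => ?_
      by_contra hkS
      have h1 : u k ∈ σ'.1 := hle (hσS ▸ M.map.frame.u_mem_adjInter.2 hkS)
      rw [hσS', M.map.frame.u_mem_adjInter] at h1
      exact h1 hk
    · rw [MergePair.mergeFace_left hσ]
      intro y hy
      have : y ∈ φ '' σ'.1 := image_mono hle hy
      rw [← M.mergeFace_inter_Q σ'] at this
      exact this.1
  · exact absurd hxy Sum.not_inl_le_inr
  · exact absurd hxy Sum.not_inr_le_inl
  · have hle : τ ≤ τ' := Sum.inr_le_inr_iff.1 hxy
    replace hle : τ.1 ⊆ τ'.1 := hle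
    by_cases hv : v ∈ τ.1
    · obtain ⟨S, hS, hτS⟩ := M.exists_vertexInter τ hv
      obtain ⟨S', hS', hτS'⟩ := M.exists_vertexInter τ' (hle hv)
      rw [M.mergeFace_vtx hS hτS, M.mergeFace_vtx hS' hτS']
      refine joint_anti fun k hk => ?_
      by_contra hkS
      have h1 : w k ∈ τ'.1 := hle (hτS ▸ M.frame.frame.w_mem_vertexInter.2 hkS)
      rw [hτS', M.frame.frame.w_mem_vertexInter] at h1
      exact h1 hk
    · rw [M.mergeFace_right hv]
      intro y hy
      have h1 : y ∈ τ'.1 ∩ removeVertex P₂ v :=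
        ⟨hle hy, M.frame.face_subset_remove τ.2.1 hv hy⟩
      rw [← M.mergeFace_inter_remove] at h1
      exact h1.1

theorem mergeFace_glue (M : MergePair i P₁ u P₂ v w b f h φ s)
    {x y : FaceMinus₁ i P₁ u ⊕ FaceMinus₂ i P₂ v} (hxy : Glue i P₁ u P₂ v w x y) :
    mergeFace i P₁ u P₂ v w φ x = mergeFace i P₁ u P₂ v w φ y := by
  cases hxy with
  | hull σ τ S hS hσ hτ =>
    rw [MergePair.mergeFace_left, M.mergeFace_right, hσ, hτ,
      M.map.image_hullOf M.polytope.convex M.frame.frame.b_some]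
    · rw [hτ]; exact M.v_notMem_hullOf S
    · rintro ⟨S', hS', hσS'⟩
      exact M.not_adjInter_subset hS' (hσS' ▸ hσ ▸ hullOf_subset_facetOf u S)
  | inter σ τ S hS hσ hτ => rw [M.mergeFace_adj hS hσ, M.mergeFace_vtx hS hτ]

theorem mergeFace_congr (M : MergePair i P₁ u P₂ v w b f h φ s)
    {x y : FaceMinus₁ i P₁ u ⊕ FaceMinus₂ i P₂ v}
    (hxy : Relation.EqvGen (Glue i P₁ u P₂ v w) x y) :
    mergeFace i P₁ u P₂ v w φ x = mergeFace i P₁ u P₂ v w φ y := by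
  induction hxy with
  | rel x y h => exact M.mergeFace_glue h
  | refl x => rfl
  | symm x y _ ih => exact ih.symm
  | trans x y z _ _ ih1 ih2 => exact ih1.trans ih2

theorem mergeFace_eq_of_mk (M : MergePair i P₁ u P₂ v w b f h φ s)
    {x y : FaceMinus₁ i P₁ u ⊕ FaceMinus₂ i P₂ v}
    (hxy : (MergePoset.mk x : MergePoset i P₁ u P₂ v w) = MergePoset.mk y) :
    mergeFace i P₁ u P₂ v w φ x = mergeFace i P₁ u P₂ v w φ y :=
  M.mergeFace_congr (Quotient.exact hxy)

theorem mk_eq_of_glue {x y : FaceMinus₁ i P₁ u ⊕ FaceMinus₂ i P₂ v}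
    (hxy : Glue i P₁ u P₂ v w x y) :
    (MergePoset.mk x : MergePoset i P₁ u P₂ v w) = MergePoset.mk y :=
  Quotient.sound (Relation.EqvGen.rel _ _ hxy)

theorem mk_inr_of_mem (M : MergePair i P₁ u P₂ v w b f h φ s) (τ : FaceMinus₂ i P₂ v)
    (hv : v ∈ τ.1) : ∃ σ : FaceMinus₁ i P₁ u,
      (MergePoset.mk (Sum.inl σ) : MergePoset i P₁ u P₂ v w) = MergePoset.mk (Sum.inr τ) := by
  obtain ⟨S, hS, hτS⟩ := M.exists_vertexInter τ hv
  exact ⟨M.adj S hS, mk_eq_of_glue (Glue.inter _ _ S hS rfl hτS)⟩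

/-- If one face of the merge contains another, both have representatives in the same polytope. -/
theorem exists_common (M : MergePair i P₁ u P₂ v w b f h φ s)
    (x y : FaceMinus₁ i P₁ u ⊕ FaceMinus₂ i P₂ v)
    (hxy : mergeFace i P₁ u P₂ v w φ x ⊆ mergeFace i P₁ u P₂ v w φ y) :
    (∃ σ σ' : FaceMinus₁ i P₁ u,
      (MergePoset.mk (Sum.inl σ) : MergePoset i P₁ u P₂ v w) = MergePoset.mk x ∧
      (MergePoset.mk (Sum.inl σ') : MergePoset i P₁ u P₂ v w) = MergePoset.mk y) ∨
    (∃ τ τ' : FaceMinus₂ i P₂ v,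
      (MergePoset.mk (Sum.inr τ) : MergePoset i P₁ u P₂ v w) = MergePoset.mk x ∧
      (MergePoset.mk (Sum.inr τ') : MergePoset i P₁ u P₂ v w) = MergePoset.mk y) := by
  rcases x with σ | τ <;> rcases y with σ' | τ'
  · exact Or.inl ⟨σ, σ', rfl, rfl⟩
  · by_cases hv : v ∈ τ'.1
    · obtain ⟨σ', hσ'⟩ := M.mk_inr_of_mem τ' hv
      exact Or.inl ⟨σ, σ', rfl, hσ'⟩
    · right
      rw [M.mergeFace_right hv] at hxy
      have h1 : φ '' σ.1 ⊆ facetOf w := by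
        rintro y hy
        have h2 : y ∈ mergeFace i P₁ u P₂ v w φ (Sum.inl σ) := Or.inl hy
        have h3 := M.frame.face_subset_remove τ'.2.1 hv (hxy h2)
        exact M.frame.mem_facetOf_of_Q (image_mono σ.2.1.subset hy) (M.frame.mem_remove.1 h3).2
      obtain ⟨S, hS, hσS⟩ := M.card_le_of_subset_facetOf σ
        ((M.image_subset_facetOf σ.2.1.subset).1 h1)
      exact ⟨M.hullR S hS, τ', (mk_eq_of_glue (Glue.hull _ _ S hS hσS rfl)).symm, rfl⟩
  · by_cases hv : v ∈ τ.1
    · obtain ⟨σ, hσ⟩ := M.mk_inr_of_mem τ hv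
      exact Or.inl ⟨σ, σ', hσ, rfl⟩
    · by_cases hσ : ∃ S : Finset (Fin d), S.card ≤ i ∧ σ'.1 = adjInter P₁ u S
      · obtain ⟨S, hS, hσS⟩ := hσ
        exact Or.inr ⟨τ, M.vtx S hS, rfl, (mk_eq_of_glue (Glue.inter _ _ S hS hσS rfl)).symm⟩
      · left
        rw [M.mergeFace_right hv, MergePair.mergeFace_left hσ] at hxy
        have h1 : τ.1 ⊆ facetOf w := fun y hy =>
          M.frame.mem_facetOf_of_Q (image_mono σ'.2.1.subset (hxy hy))
            (M.frame.mem_remove.1 (M.frame.face_subset_remove τ.2.1 hv hy)).2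
        classical
        have h2 := M.frame.frame.eq_hullOf τ.2.1 h1
        obtain ⟨⟨T, hT, hcard⟩, -⟩ := M.isFace_left hσ
        have h3 : (Finset.univ.filter fun k => w k ∈ τ.1).card + i ≤ d := by
          refine le_trans (Nat.add_le_add_right (Finset.card_le_card fun k hk => ?_) i) hcard
          rw [hT, ← M.w_mem_image σ'.2.1.subset]
          exact hxy (Finset.mem_filter.1 hk).2
        exact ⟨M.hullL _ h3, σ', mk_eq_of_glue (Glue.hull _ _ _ h3 rfl h2), rfl⟩
  · exact Or.inr ⟨τ, τ', rfl, rfl⟩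

theorem subset_of_mergeFace_inl (M : MergePair i P₁ u P₂ v w b f h φ s)
    {σ σ' : FaceMinus₁ i P₁ u}
    (hxy : mergeFace i P₁ u P₂ v w φ (Sum.inl σ) ⊆ mergeFace i P₁ u P₂ v w φ (Sum.inl σ')) :
    σ ≤ σ' := by
  have h1 := inter_subset_inter_left (φ '' P₁) hxy
  rw [M.mergeFace_inter_Q, M.mergeFace_inter_Q,
    M.map.proj.injOn.image_subset_image_iff σ.2.1.subset σ'.2.1.subset] at h1
  exact h1

theorem subset_of_mergeFace_inr (M : MergePair i P₁ u P₂ v w b f h φ s)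
    {τ τ' : FaceMinus₂ i P₂ v}
    (hxy : mergeFace i P₁ u P₂ v w φ (Sum.inr τ) ⊆ mergeFace i P₁ u P₂ v w φ (Sum.inr τ')) :
    τ ≤ τ' := by
  by_cases hv : v ∈ τ.1
  · obtain ⟨S, hS, hτS⟩ := M.exists_vertexInter τ hv
    rw [M.mergeFace_vtx hS hτS] at hxy
    by_cases hv' : v ∈ τ'.1
    · obtain ⟨S', hS', hτS'⟩ := M.exists_vertexInter τ' hv'
      rw [M.mergeFace_vtx hS' hτS'] at hxy
      show τ.1 ⊆ τ'.1
      rw [hτS, hτS', M.frame.frame.vertexInter_eq, M.frame.frame.vertexInter_eq]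
      refine fun x hx => ⟨hx.1, fun k hk => hx.2 k ?_⟩
      by_contra hkS
      exact M.w_mem_joint.1 (hxy (M.w_mem_joint.2 hkS)) hk
    · rw [M.mergeFace_right hv', M.joint_eq] at hxy
      exact absurd ((subset_union_left.trans hxy).trans (M.frame.face_subset_remove τ'.2.1 hv'))
        (M.not_joint_subset_remove hS)
  · intro y hy
    have h1 := inter_subset_inter_left (removeVertex P₂ v) hxy
    rw [M.mergeFace_inter_remove, M.mergeFace_inter_remove] at h1
    exact (h1 ⟨hy, M.frame.face_subset_remove τ.2.1 hv hy⟩).1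

theorem mk_le_iff (M : MergePair i P₁ u P₂ v w b f h φ s)
    (x y : FaceMinus₁ i P₁ u ⊕ FaceMinus₂ i P₂ v) :
    mergeFace i P₁ u P₂ v w φ x ⊆ mergeFace i P₁ u P₂ v w φ y ↔
      (MergePoset.mk x : MergePoset i P₁ u P₂ v w) ≤ MergePoset.mk y := by
  constructor
  · intro hxy
    rcases M.exists_common x y hxy with ⟨σ, σ', h1, h2⟩ | ⟨τ, τ', h1, h2⟩
    · rw [← M.mergeFace_eq_of_mk h1, ← M.mergeFace_eq_of_mk h2] at hxy
      exact ⟨_, _, h1, h2, Sum.inl_le_inl_iff.2 (M.subset_of_mergeFace_inl hxy)⟩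
    · rw [← M.mergeFace_eq_of_mk h1, ← M.mergeFace_eq_of_mk h2] at hxy
      exact ⟨_, _, h1, h2, Sum.inr_le_inr_iff.2 (M.subset_of_mergeFace_inr hxy)⟩
  · rintro ⟨x', y', h1, h2, hle⟩
    rw [← M.mergeFace_eq_of_mk h1, ← M.mergeFace_eq_of_mk h2]
    exact M.mergeFace_mono hle

theorem mk_eq_iff (M : MergePair i P₁ u P₂ v w b f h φ s)
    (x y : FaceMinus₁ i P₁ u ⊕ FaceMinus₂ i P₂ v) :
    mergeFace i P₁ u P₂ v w φ x = mergeFace i P₁ u P₂ v w φ y ↔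
      (MergePoset.mk x : MergePoset i P₁ u P₂ v w) = MergePoset.mk y := by
  refine ⟨fun hxy => ?_, M.mergeFace_eq_of_mk⟩
  rcases M.exists_common x y hxy.subset with ⟨σ, σ', h1, h2⟩ | ⟨τ, τ', h1, h2⟩
  · rw [← M.mergeFace_eq_of_mk h1, ← M.mergeFace_eq_of_mk h2] at hxy
    rw [← h1, ← h2, le_antisymm (M.subset_of_mergeFace_inl hxy.subset)
      (M.subset_of_mergeFace_inl hxy.symm.subset)]
  · rw [← M.mergeFace_eq_of_mk h1, ← M.mergeFace_eq_of_mk h2] at hxy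
    rw [← h1, ← h2, le_antisymm (M.subset_of_mergeFace_inr hxy.subset)
      (M.subset_of_mergeFace_inr hxy.symm.subset)]

theorem exists_mergeFace (M : MergePair i P₁ u P₂ v w b f h φ s) {B : Set (E d)}
    (hB : IsFace (φ '' P₁ ∪ removeVertex P₂ v) B) : ∃ x, mergeFace i P₁ u P₂ v w φ x = B := by
  rcases M.frame.face_cases hB with ⟨S, hS, rfl⟩ | ⟨hQ, T, hT, hcard⟩ | ⟨hR, hv⟩
  · exact ⟨Sum.inl (M.adj S hS), M.mergeFace_adj hS rfl⟩
  · obtain ⟨σ, hσ, rfl⟩ := M.map.proj.exists_face_of_image hQ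
    have hT' : ∀ k, k ∈ T ↔ u k ∈ σ := fun k => by rw [hT, M.w_mem_image hσ.subset]
    refine ⟨Sum.inl ⟨σ, hσ, ?_⟩, MergePair.mergeFace_left ?_⟩
    · rintro ⟨hF, hdim⟩
      classical
      have h1 := M.map.frame.eq_hullOf hσ hF
      have h2 : (Finset.univ.filter fun k => u k ∈ σ) = T := by ext k; simp [hT']
      rw [h2] at h1
      rw [h1, dim_hullOf M.map.frame.indep] at hdim
      omega
    · rintro ⟨S, hS, hσS⟩
      have hσS' : σ = adjInter P₁ u S := hσS
      have hsub : Sᶜ ⊆ T := fun k hk => by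
        rw [hT', hσS', M.map.frame.u_mem_adjInter]
        simpa using hk
      have := Finset.card_le_card hsub
      rw [Finset.card_compl, Fintype.card_fin] at this
      omega
  · exact ⟨Sum.inr ⟨B, hR, fun h => hv h.1⟩, M.mergeFace_right hv⟩

theorem isPolytope (M : MergePair i P₁ u P₂ v w b f h φ s) (hP₂ : IsPolytope P₂) :
    IsPolytope (φ '' P₁ ∪ removeVertex P₂ v) := by
  obtain ⟨hfin₁, hhull₁⟩ := convexHull_vertices M.polytope
  obtain ⟨hfin₂, -⟩ := convexHull_vertices hP₂
  have hfin : (φ '' vertices P₁ ∪ (vertices P₂ \ {v})).Finite :=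
    (hfin₁.image φ).union (hfin₂.subset sdiff_subset)
  constructor
  · refine ⟨hfin.toFinset, ?_⟩
    rw [hfin.coe_toFinset]
    apply Subset.antisymm
    · refine union_subset ?_ (convexHull_mono subset_union_right)
      have := M.map.proj.image_convexHull_subset M.polytope.convex (vertices_subset (P := P₁))
      rw [hhull₁] at this
      exact this.trans (convexHull_mono subset_union_left)
    · refine convexHull_min (union_subset ?_ ?_) M.frame.convex_union
      · exact (image_mono vertices_subset).trans subset_union_left
      · exact (subset_convexHull ℝ _).trans subset_union_right
  · obtain ⟨z, hz, -, hz0⟩ := M.frame.exists_off Finset.univ (by simp)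
    have hind : AffineIndependent ℝ w := by
      have := b.ind.comp_embedding ⟨some, Option.some_injective (Fin d)⟩
      convert this using 1
      ext1 k
      exact (M.frame.frame.b_some k).symm
    obtain ⟨c, hc0, hc⟩ := exists_affineBasis_option hind (f := b.coord none)
      (fun k => by rw [← M.frame.frame.b_some]; simp) hz0.ne'
    rw [eq_top_iff, ← c.tot]
    refine affineSpan_mono ℝ ?_
    rintro _ ⟨o, rfl⟩
    cases o with
    | none => rw [hc0]; exact Or.inl hz
    | some k => rw [hc]; exact Or.inl (M.frame.w_mem_Q k)

end MergePair

theorem projectiveOn_affineEquiv (P : Set (E d)) (ψ : E d ≃ᵃ[ℝ] E d) :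
    ProjectiveOn P ψ fun _ => 1 :=
  ⟨fun _ _ => one_pos, fun g => ⟨g.comp ψ.toAffineMap, fun x _ => by simp⟩,
    fun g' => ⟨g'.comp ψ.symm.toAffineMap, fun x _ => by simp⟩⟩

theorem IsPolytope.image {P : Set (E d)} (hP : IsPolytope P) (ψ : E d ≃ᵃ[ℝ] E d) :
    IsPolytope (ψ '' P) := by
  classical
  obtain ⟨⟨t, ht⟩, hspan⟩ := hP
  refine ⟨⟨t.image ψ, ?_⟩, (ψ.span_eq_top_iff).1 hspan⟩
  rw [ht, Finset.coe_image]
  exact AffineMap.image_convexHull ψ.toAffineMap _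

/-- The passage from the coordinates of `P₂` to the merge: `mergeFace`, followed by `ψ`, induces the
isomorphism of face lattices. -/
theorem MergePosition.isPolytope_and_iso {i : ℕ} {P₁ P₂ : Set (E d)} {u : Fin d → E d} {v : E d}
    {w : Fin d → E d} {b : AffineBasis (Option (Fin d)) ℝ (E d)} {f : E d →ᵃ[ℝ] ℝ}
    {h : Fin d → E d →ᵃ[ℝ] ℝ} {T : (E d × ℝ) ≃ₗ[ℝ] (E d × ℝ)} {ψ : E d ≃ᵃ[ℝ] E d} {s : E d → ℝ}
    (hP₂ : IsPolytope P₂)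
    (M : MergePair i P₁ u P₂ v w b f h (fun x => ψ.symm (projMap T x)) s) :
    IsPolytope (merge P₁ P₂ v T ψ) ∧
      ∃ e : MergePoset i P₁ u P₂ v w ≃o FacePoset (merge P₁ P₂ v T ψ),
        (∀ (σ : FaceMinus₁ i P₁ u) (S : Finset (Fin d)), S.card ≤ i → σ.1 = adjInter P₁ u S →
          (e (MergePoset.mk (Sum.inl σ))).1 =
            projMap T '' adjInter P₁ u S ∪
              ψ '' (vertexInter P₂ v w S ∩ removeVertex P₂ v)) ∧
        (∀ σ : FaceMinus₁ i P₁ u,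
          (¬ ∃ S : Finset (Fin d), S.card ≤ i ∧ σ.1 = adjInter P₁ u S) →
            (e (MergePoset.mk (Sum.inl σ))).1 = projMap T '' σ.1) ∧
        (∀ τ : FaceMinus₂ i P₂ v, v ∉ τ.1 →
          (e (MergePoset.mk (Sum.inr τ))).1 = ψ '' τ.1) := by
  set φ : E d → E d := fun x => ψ.symm (projMap T x) with hφ
  have himg : ∀ A : Set (E d), ψ '' (φ '' A) = projMap T '' A := fun A => by
    rw [image_image]; simp [hφ]
  have hmerge : merge P₁ P₂ v T ψ = ψ '' (φ '' P₁ ∪ removeVertex P₂ v) := by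
    rw [image_union, himg, merge]
  have hψ := projectiveOn_affineEquiv (φ '' P₁ ∪ removeVertex P₂ v) ψ
  have hinj : Function.Injective (image ψ) := ψ.injective.image_injective
  have hface : ∀ x, IsFace (merge P₁ P₂ v T ψ) (ψ '' mergeFace i P₁ u P₂ v w φ x) := fun x => by
    rw [hmerge]; exact hψ.isFace_image (M.isFace_mergeFace x)
  let F : MergePoset i P₁ u P₂ v w → FacePoset (merge P₁ P₂ v T ψ) :=
    Quotient.lift (fun x => ⟨ψ '' mergeFace i P₁ u P₂ v w φ x, hface x⟩) fun x y hxy =>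
      Subtype.ext (congrArg (image ψ) (M.mergeFace_congr hxy))
  have hF : ∀ x, (F (MergePoset.mk x)).1 = ψ '' mergeFace i P₁ u P₂ v w φ x := fun x => rfl
  have hmk : ∀ a : MergePoset i P₁ u P₂ v w, ∃ x, MergePoset.mk x = a := Quotient.exists_rep
  have hbij : Function.Bijective F := by
    constructor
    · intro a a' haa'
      obtain ⟨x, rfl⟩ := hmk a
      obtain ⟨y, rfl⟩ := hmk a'
      have h1 := congrArg Subtype.val haa'
      rw [hF, hF] at h1
      exact (M.mk_eq_iff x y).1 (hinj h1)
    · rintro ⟨B, hB⟩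
      rw [hmerge] at hB
      obtain ⟨A, hA, rfl⟩ := hψ.exists_face_of_image hB
      obtain ⟨x, rfl⟩ := M.exists_mergeFace hA
      exact ⟨MergePoset.mk x, rfl⟩
  refine ⟨hmerge ▸ (M.isPolytope hP₂).image ψ,
    { Equiv.ofBijective F hbij with map_rel_iff' := ?_ }, ?_, ?_, ?_⟩
  · intro a a'
    obtain ⟨x, rfl⟩ := hmk a
    obtain ⟨y, rfl⟩ := hmk a'
    rw [← M.mk_le_iff]
    show ψ '' _ ⊆ ψ '' _ ↔ _
    exact image_subset_image_iff ψ.injective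
  · intro σ S hS hσ
    show ψ '' _ = _
    rw [M.mergeFace_adj hS hσ, M.joint_eq, image_union, himg]
  · intro σ hσ
    show ψ '' _ = _
    rw [MergePair.mergeFace_left hσ, himg]
  · intro τ hτ
    show ψ '' _ = _
    rw [M.mergeFace_right hτ]

end PolytopeMerge

theorem theorem4p9 (d i : ℕ) (hd : 2 ≤ d) (hi : 1 ≤ i) (hid : i ≤ d - 1)
    (P₁ P₂ : Set (E d)) (hP₁ : IsPolytope P₁) (hP₂ : IsPolytope P₂)
    (hP₁_simplicial : IsSimplicial (d - i) P₁) (hP₁_simple : IsSimple i P₁)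
    (hP₂_simplicial : IsSimplicial (d - i) P₂) (hP₂_simple : IsSimple i P₂)
    (u : Fin d → E d) (hu : IsSimplexFacet P₁ u)
    (v : E d) (hv : IsSimpleVertex P₂ v)
    (w : Fin d → E d) (hw : IsNeighborList P₂ v w) :
    -- the merge can be formed
    (∃ T ψ, MergePosition P₁ u v w T ψ) ∧
    -- and, however it is formed, it is a polytope with the asserted face lattice
    ∀ T ψ, MergePosition P₁ u v w T ψ →
      IsPolytope (merge P₁ P₂ v T ψ) ∧
      ∃ e : MergePoset i P₁ u P₂ v w ≃o FacePoset (merge P₁ P₂ v T ψ),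
        (∀ (σ : FaceMinus₁ i P₁ u) (S : Finset (Fin d)), S.card ≤ i → σ.1 = adjInter P₁ u S →
          (e (MergePoset.mk (Sum.inl σ))).1 =
            projMap T '' adjInter P₁ u S ∪
              ψ '' (vertexInter P₂ v w S ∩ removeVertex P₂ v)) ∧
        (∀ σ : FaceMinus₁ i P₁ u,
          (¬ ∃ S : Finset (Fin d), S.card ≤ i ∧ σ.1 = adjInter P₁ u S) →
            (e (MergePoset.mk (Sum.inl σ))).1 = projMap T '' σ.1) ∧
        (∀ τ : FaceMinus₂ i P₂ v, v ∉ τ.1 →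
          (e (MergePoset.mk (Sum.inr τ))).1 = ψ '' τ.1) := by
  obtain ⟨f, h, D₁⟩ := exists_facetFrame hP₁ hu
  obtain ⟨b, D₂⟩ := exists_vertexFrame hd hP₂ hv hw
  refine ⟨exists_mergePosition D₁ D₂, fun T ψ H => ?_⟩
  obtain ⟨s, M⟩ := H.exists_mergeMap hP₁ D₁ D₂
  exact MergePosition.isPolytope_and_iso hP₂
    ⟨hP₁, M, M.mergeFrame hP₁ (by omega) hP₁_simple D₂ hP₂_simplicial⟩
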